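/- **Lemma (Reduction $c_6$ is correct).** All graphs are finite and simple. *Numbers of guards.* For a graph $G$, a configuration is a multiset of vertices (guards); two configurations are traversable if their guards can be paired so that each guard stays or moves along an edge. An m-eternal guard strategy of order $m$ is a nonempty set of configurations with $m$ guards each, with an undirected set of transitions between traversable configurations, such that for each configuration $C$ and each vertex $v$, $v$ is occupied in $C$ or in a configuration joined to $C$ by a transition. $\mathrm{EGC}(G)$ is the least order of such a strategy, and $\mathrm{EDN}(G)$ the least order of one in which no vertex ever holds two guards. *Labelled strategies.* A labelled strategy on $G$ is a graph $S=(\Omega,\mathbb F)$ of states with a set $P(\alpha)\subseteq V(G)$ for each $\alpha\in\Omega$ and, for each orientation $(\alpha,\beta)$ of an edge of $S$, a transition $T(\alpha,\beta)$, i.e. a bijection from $P(\alpha)$ to $P(\beta)$ that keeps each guard in place or moves it along an edge of $G$, with $T(\beta,\alpha)$ the converse of $T(\alpha,\beta)$. It is defending with $m$ guards if $\Omega\ne\emptyset$, $|P(\alpha)|=m$ for all $\alpha$, and each vertex is occupied in $\alpha$ or in a neighbour of $\alpha$, for every state $\alpha$. For an edge $\{x,y\}$ of $G$ let $L$ (resp.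 $R$) be the set of states from which some transition moves a guard from $x$ to $y$ (resp. from $y$ to $x$), and $N=\Omega\setminus(L\cup R)$. The edge has *proper edge states* if $L,R,N$ are nonempty dominating sets of $S$ and $L\cap R=\emptyset$. *Leaf cycles.* A leaf cycle is a cycle with a vertex, called connecting, such that all neighbours of the other vertices of the cycle lie on the cycle or are leaves (if several vertices qualify, each of them may be taken as the connecting vertex). A non-connecting vertex of it is white, pink or red if it is adjacent to exactly $0$, exactly $1$, or at least $2$ leaves. A labelled strategy is *proper* if, on every leaf cycle, proper edge states are held by each edge incident to a white vertex, by each edge of a cycle $(\text{connecting},\text{red},\text{red},\text{connecting})$, and by each edge incident to the connecting vertex, except the edges between the connecting vertex and a red vertex on a cycle $(\text{connecting},\text{red},\text{white},\text{white},\text{red},\text{connecting})$ or $(\text{connecting},\text{white},\text{white},\text{red},\text{connecting})$. It *group defends the leaves* if no state occupies two leaves with a common neighbour. A graph is *defended with $m$ guards* if $m=\mathrm{EDN}=\mathrm{EGC}$ for it and it has a proper defending labelled strategy with $m$ guards and finitely many states. *Statement.* Let $G$ be a cactus (connected, each edge on at most one cycle), let $C$ be a leaf cycle of $G$ with connecting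 vertex $u$, and let $k\ge 0$. Suppose that the colours along $C$ are, in order, 1. $(\text{connecting},\text{red},[\text{white},\text{red}]^{2k},\text{connecting})$ (so $k\ge1$, as a cycle has at least three vertices); put $\ell=1$, $K=3k+1$; or 2. $(\text{connecting},\text{red},[\text{white},\text{red}]^{2k+1},\text{connecting})$; put $\ell=2$, $K=3k+2$. Let $G'$ be obtained from $G$ by deleting all vertices of $C$ other than $u$ together with the leaves adjacent to them, and attaching $\ell$ new leaves to $u$ (the cycle is replaced by a pink vertex in case 1, by a red vertex in case 2). Then: * $\mathrm{EDN}(G)\le \mathrm{EDN}(G')+K$ and $\mathrm{EGC}(G)\ge \mathrm{EGC}(G')+K$; hence if $\mathrm{EDN}(G')=\mathrm{EGC}(G')$, then $\mathrm{EDN}(G)=\mathrm{EDN}(G')+K$ and $\mathrm{EGC}(G)=\mathrm{EGC}(G')+K$. * For every $m$ and every labelled strategy $\mathcal B'$ with finitely many states that defends $G'$ with $m$ guards and in no state of which two of the new leaves are occupied (an empty condition in case 1), there is a labelled strategy $\mathcal B$ with finitely many states that defends $G$ with $m+K$ guards, in which all edges of $C$ have proper edge states, and every edge common to $G$ and $G'$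 that has proper edge states in $\mathcal B'$ has them in $\mathcal B$. If $\mathcal B'$ is proper then so is $\mathcal B$, and if $\mathcal B'$ group defends the leaves then so does $\mathcal B$. * Consequently, if $G'$ is defended with $m$ guards by a strategy that group defends the leaves, then $G$ is defended with $m+K$ guards by a strategy that group defends the leaves. In case 1 also: if $G'$ is defended with $m$ guards, then $G$ is defended with $m+K$ guards. -/

import Mathlib

universe u

namespace EternalDomination

/-! ### Cactus graphs, leaf cycles and their colours -/

/-- A cactus: a connected graph each edge of which lies on at most one cycle
(any two cycles through a common edge have the same edges). -/
def IsCactus {V : Type u} (G : SimpleGraph V) : Prop :=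
  G.Connected ∧
    ∀ (a b : V) (p : G.Walk a a) (q : G.Walk b b), p.IsCycle → q.IsCycle →
      ∀ e : Sym2 V, e ∈ p.edges → e ∈ q.edges → ∀ f : Sym2 V, f ∈ p.edges ↔ f ∈ q.edges

/-- A leaf: a vertex with exactly one neighbour. -/
def IsLeaf {V : Type u} (G : SimpleGraph V) (v : V) : Prop := ∃! w, G.Adj v w

/-- The number of leaves adjacent to `v`. -/
noncomputable def leafCount {V : Type u} (G : SimpleGraph V) (v : V) : ℕ :=
  {w | G.Adj v w ∧ IsLeaf G w}.ncard

/-- `c 0, c 1, …, c (n - 1)` are the consecutive vertices of a leaf cycle with connecting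
vertex `c 0` (indices are cyclic, so `c (n - 1)` is adjacent to `c 0`): every neighbour of a
vertex other than `c 0` is a vertex of the cycle or a leaf. -/
structure IsLeafCycle {V : Type u} (G : SimpleGraph V) {n : ℕ} [NeZero n] (c : Fin n → V) :
    Prop where
  three_le : 3 ≤ n
  injective : Function.Injective c
  adj : ∀ i, G.Adj (c i) (c (i + 1))
  neighbor : ∀ i, i ≠ 0 → ∀ w, G.Adj (c i) w → w ∈ Set.range c ∨ IsLeaf G w

/-- The colours of the vertices of a leaf cycle. -/
inductive Color where
  | white
  | pink
  | red
  | connecting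

open Classical in
/-- The colour of the vertex `c i` of the leaf cycle `c`. -/
noncomputable def color {V : Type u} (G : SimpleGraph V) {n : ℕ} [NeZero n] (c : Fin n → V)
    (i : Fin n) : Color :=
  if i = 0 then Color.connecting
  else if leafCount G (c i) = 0 then Color.white
  else if leafCount G (c i) = 1 then Color.pink
  else Color.red

/-- The leaf sequence of a whole leaf cycle; the connecting vertex is listed first and last. -/
noncomputable def leafSequence {V : Type u} (G : SimpleGraph V) {n : ℕ} [NeZero n]
    (c : Fin n → V) : List Color :=
  List.ofFn (color G c) ++ [Color.connecting]

/-- The sequence `(connecting, red, [white, red]^j, connecting)`. -/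
def rwSequence (j : ℕ) : List Color :=
  [Color.connecting, Color.red] ++ (List.replicate j [Color.white, Color.red]).flatten ++
    [Color.connecting]

/-! ### The replaced graph -/

/-- The non-connecting vertices of the cycle `c` and the leaves adjacent to them. -/
def cyclePart {V : Type u} (G : SimpleGraph V) {n : ℕ} [NeZero n] (c : Fin n → V) : Set V :=
  {v | ∃ i, i ≠ 0 ∧ (v = c i ∨ (G.Adj (c i) v ∧ IsLeaf G v))}

/-- `G` with the leaf cycle `c` replaced by `l` new leaves attached to its connecting vertex `c 0`:
everything of the cycle except `c 0` (with the leaves of the removed vertices) is removed.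
For `l = 1` the cycle is replaced by a pink vertex, for `l = 2` by a red one. -/
def replaceCycle {V : Type u} (G : SimpleGraph V) {n : ℕ} [NeZero n] (c : Fin n → V) (l : ℕ) :
    SimpleGraph ({v : V // v ∉ cyclePart G c} ⊕ Fin l) where
  Adj x y :=
    match x, y with
    | Sum.inl v, Sum.inl w => G.Adj v.1 w.1
    | Sum.inl v, Sum.inr _ => v.1 = c 0
    | Sum.inr _, Sum.inl w => w.1 = c 0
    | Sum.inr _, Sum.inr _ => False
  symm := by
    constructor
    rintro (v | i) (w | j) h
    · exact SimpleGraph.Adj.symm h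
    · exact h
    · exact h
    · exact h
  loopless := by
    constructor
    rintro (v | i) h
    · exact G.loopless.irrefl _ h
    · exact h

/-! ### The two numbers of guards -/

/-- Two configurations (multisets of vertices) are traversable: the guards of the first can be
paired with those of the second so that each guard stays or moves along an edge. -/
def Traversable {V : Type u} (G : SimpleGraph V) (C D : Multiset V) : Prop :=
  ∃ T : Multiset (V × V), T.map Prod.fst = C ∧ T.map Prod.snd = D ∧
    ∀ p ∈ T, p.1 = p.2 ∨ G.Adj p.1 p.2

/-- `(𝒞, F)` is an m-eternal guard strategy of order `k` in `G`, i.e. a nonempty strategy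
defending against vertex attacks. -/
structure IsEternalGuardStrategy {V : Type u} (G : SimpleGraph V) (k : ℕ)
    (𝒞 : Set (Multiset V)) (F : Multiset V → Multiset V → Prop) : Prop where
  nonempty : 𝒞.Nonempty
  card_eq : ∀ C ∈ 𝒞, Multiset.card C = k
  mem : ∀ C D, F C D → C ∈ 𝒞 ∧ D ∈ 𝒞
  symm : ∀ C D, F C D → F D C
  traversable : ∀ C D, F C D → Traversable G C D
  defends : ∀ C ∈ 𝒞, ∀ v : V, v ∈ C ∨ ∃ D ∈ 𝒞, F C D ∧ v ∈ D

/-- The m-eternal guard configuration number: several guards may share a vertex. -/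
noncomputable def EGC {V : Type u} (G : SimpleGraph V) : ℕ :=
  sInf {k | ∃ 𝒞 F, IsEternalGuardStrategy G k 𝒞 F}

/-- The m-eternal domination number: each vertex is occupied by at most one guard. -/
noncomputable def EDN {V : Type u} (G : SimpleGraph V) : ℕ :=
  sInf {k | ∃ 𝒞 F, IsEternalGuardStrategy G k 𝒞 F ∧ ∀ C ∈ 𝒞, C.Nodup}

/-! ### Labelled strategies -/

/-- A (symmetrical) labelled strategy on `G` with set of states `Ω`: a strategy graph on `Ω`,
the set of vertices occupied in each state, and for each edge of the strategy graph a transition,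
which is a bijection between the guards of its two states made of moves along edges of `G` and of
stationary guards. The values `move α β` for nonadjacent `α`, `β` play no role. -/
structure LabelledStrategy {V : Type u} (G : SimpleGraph V) (Ω : Type) where
  graph : SimpleGraph Ω
  pos : Ω → Set V
  move : Ω → Ω → Set (V × V)
  move_valid : ∀ α β, graph.Adj α β → ∀ a b, (a, b) ∈ move α β →
    a ∈ pos α ∧ b ∈ pos β ∧ (G.Adj a b ∨ a = b)
  move_left : ∀ α β, graph.Adj α β → ∀ a ∈ pos α, ∃! b, (a, b) ∈ move α β
  move_right : ∀ α β, graph.Adj α β → ∀ b ∈ pos β, ∃! a, (a, b) ∈ move α β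
  move_symm : ∀ α β, graph.Adj α β → ∀ a b, (a, b) ∈ move α β → (b, a) ∈ move β α

namespace LabelledStrategy

variable {V : Type u} {G : SimpleGraph V} {Ω : Type}

/-- The strategy has a state and uses `m` guards in each state, and for every state and every
vertex, the vertex is occupied in that state or in an adjacent one. -/
def IsDefending (B : LabelledStrategy G Ω) (m : ℕ) : Prop :=
  Nonempty Ω ∧ (∀ α, (B.pos α).Finite ∧ (B.pos α).ncard = m) ∧
    ∀ α v, v ∈ B.pos α ∨ ∃ β, B.graph.Adj α β ∧ v ∈ B.pos β

/-- A dominating set of the strategy graph. -/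
def IsDominating (B : LabelledStrategy G Ω) (S : Set Ω) : Prop :=
  ∀ α, α ∈ S ∨ ∃ β ∈ S, B.graph.Adj α β

/-- The edge states `L` of `(x, y)`: the states from which some transition moves a guard from `x`
to `y`. The edge states `R` of `(x, y)` are `B.leftStates y x`. -/
def leftStates (B : LabelledStrategy G Ω) (x y : V) : Set Ω :=
  {α | ∃ β, B.graph.Adj α β ∧ (x, y) ∈ B.move α β}

/-- The edge states `N` of `(x, y)`: the states from which the edge is never traversed. -/
def idleStates (B : LabelledStrategy G Ω) (x y : V) : Set Ω :=
  (B.leftStates x y ∪ B.leftStates y x)ᶜ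

/-- The edge `{x, y}` has proper edge states: `L`, `R` and `N` are nonempty dominating sets of the
strategy graph, and `L` and `R` are disjoint. -/
def HasProperEdgeStates (B : LabelledStrategy G Ω) (x y : V) : Prop :=
  (B.leftStates x y).Nonempty ∧ (B.leftStates y x).Nonempty ∧ (B.idleStates x y).Nonempty ∧
    Disjoint (B.leftStates x y) (B.leftStates y x) ∧
    B.IsDominating (B.leftStates x y) ∧ B.IsDominating (B.leftStates y x) ∧
    B.IsDominating (B.idleStates x y)

/-- The leaves are group defended: no state occupies two leaves with a common neighbour. -/
def IsLeafGrouped (B : LabelledStrategy G Ω) : Prop :=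
  ∀ α x y z, G.Adj x y → G.Adj x z → IsLeaf G y → IsLeaf G z →
    y ∈ B.pos α → z ∈ B.pos α → y = z

end LabelledStrategy

/-- The edge `{c i, c (i + 1)}` of the leaf cycle `c` joins the connecting vertex with a red vertex
and the leaf sequence of `c` is `(connecting, red, white, white, red, connecting)`, or
`(connecting, white, white, red, connecting)` in one of the two directions. -/
def IsExceptionalEdge {V : Type u} (G : SimpleGraph V) {n : ℕ} [NeZero n] (c : Fin n → V)
    (i : Fin n) : Prop :=
  (leafSequence G c = [.connecting, .red, .white, .white, .red, .connecting] ∨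
    leafSequence G c = [.connecting, .white, .white, .red, .connecting] ∨
    leafSequence G c = [.connecting, .red, .white, .white, .connecting]) ∧
  ((color G c i = .connecting ∧ color G c (i + 1) = .red) ∨
    (color G c i = .red ∧ color G c (i + 1) = .connecting))

/-- The edge `{c i, c (i + 1)}` of the leaf cycle `c` is one of those that must have proper edge
states in a proper strategy. -/
def IsRequiredEdge {V : Type u} (G : SimpleGraph V) {n : ℕ} [NeZero n] (c : Fin n → V)
    (i : Fin n) : Prop :=
  color G c i = .white ∨ color G c (i + 1) = .white ∨
    leafSequence G c = [.connecting, .red, .red, .connecting] ∨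
    ((color G c i = .connecting ∨ color G c (i + 1) = .connecting) ∧ ¬ IsExceptionalEdge G c i)

/-- A proper labelled strategy. -/
def LabelledStrategy.IsProper {V : Type u} {G : SimpleGraph V} {Ω : Type}
    (B : LabelledStrategy G Ω) : Prop :=
  ∀ (n : ℕ) [NeZero n] (c : Fin n → V), IsLeafCycle G c →
    ∀ i, IsRequiredEdge G c i → B.HasProperEdgeStates (c i) (c (i + 1))

/-- `G` is defended with `m` guards: `m` is both its m-eternal domination number and its m-eternal
guard configuration number, and some proper defending labelled strategy uses `m` guards. -/
def IsDefendedWith {V : Type u} (G : SimpleGraph V) (m : ℕ) : Prop :=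
  EDN G = m ∧ EGC G = m ∧
    ∃ (Ω : Type) (_ : Finite Ω) (B : LabelledStrategy G Ω), B.IsDefending m ∧ B.IsProper

/-- As `IsDefendedWith`, by a strategy in which the leaves are group defended. -/
def IsGroupDefendedWith {V : Type u} (G : SimpleGraph V) (m : ℕ) : Prop :=
  EDN G = m ∧ EGC G = m ∧
    ∃ (Ω : Type) (_ : Finite Ω) (B : LabelledStrategy G Ω),
      B.IsDefending m ∧ B.IsProper ∧ B.IsLeafGrouped

/-- Replacing the leaf cycle `c` by `l` leaves attached to its connecting vertex is correct at the
cost of `K` guards. -/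
structure IsCorrectReplacement {V : Type u} (G : SimpleGraph V) {n : ℕ} [NeZero n] (c : Fin n → V)
    (l K : ℕ) : Prop where
  /-- The upper bound. -/
  upper : EDN G ≤ EDN (replaceCycle G c l) + K
  /-- The lower bound. -/
  lower : EGC (replaceCycle G c l) + K ≤ EGC G
  /-- Both bounds are tight as soon as the two numbers agree for the reduced graph. -/
  tight : EDN (replaceCycle G c l) = EGC (replaceCycle G c l) →
    EDN G = EDN (replaceCycle G c l) + K ∧ EGC G = EGC (replaceCycle G c l) + K
  /-- Every defending labelled strategy of the reduced graph that never occupies two of the new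
  leaves at once yields one of `G` with `K` more guards. All cycle edges of `c` have proper edge
  states in it, every other edge that had proper edge states keeps them, and properness of the
  strategy and group defence of the leaves are kept. -/
  strategy : ∀ (m : ℕ) (Ω' : Type) [Finite Ω'] (B' : LabelledStrategy (replaceCycle G c l) Ω'),
    B'.IsDefending m →
    (∀ α (i j : Fin l), Sum.inr i ∈ B'.pos α → Sum.inr j ∈ B'.pos α → i = j) →
    ∃ (Ω : Type) (_ : Finite Ω) (B : LabelledStrategy G Ω),
      B.IsDefending (m + K) ∧
      (∀ i, B.HasProperEdgeStates (c i) (c (i + 1))) ∧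
      (∀ x y : {v : V // v ∉ cyclePart G c}, G.Adj x.1 y.1 →
        B'.HasProperEdgeStates (Sum.inl x) (Sum.inl y) → B.HasProperEdgeStates x.1 y.1) ∧
      (B'.IsProper → B.IsProper) ∧
      (B'.IsLeafGrouped → B.IsLeafGrouped)
  /-- If the reduced graph is defended with `m` guards then `G` is defended with `m + K`. -/
  defended : ∀ m : ℕ, IsGroupDefendedWith (replaceCycle G c l) m → IsGroupDefendedWith G (m + K)

end EternalDomination

/-!
The bounds for `EDN` and `EGC` are proved separately: strategies of the reduced graph are lifted to
`G`, and configurations of `G` are projected to the reduced graph.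

**Lifting.** Number the cycle `0, …, n - 1` from the connecting vertex, so that the odd vertices are
red and the other even ones white. All red vertices keep a guard forever, and each of them has one
more guard nearby: on exactly one of its two neighbours on the cycle, except for at most one red
vertex, the *centre*, which has none there and has a guard on one of its leaves instead. A guard on
a white vertex thus serves both of its red neighbours, and the guarded white vertices are those at
distance `3` modulo `4` from the centre (`Token`, `token_iff`). The centre and its leaf are
arbitrary, and changing them shifts guards along the cycle in one direction (`Forward`, `Flow`). The
connecting vertex takes part as one of the even vertices, and the guards that the given strategy
keeps on it and on the new leaves are taken over by the cycle. Their number fixes the *level* of the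
gadget state, up to the distinction, for one new leaf, of the vertex on which a single guard stands
(`levOne`, `isLevelling_two`); on level `2` an additional guard stays on the connecting vertex or is
parked on a leaf. When the given strategy moves a guard into or out of the connecting vertex, the
level changes accordingly (`UpRel`, `starCount_flag`). That the moves form a bijection is checked
vertex by vertex (`BalAt`, `balAt_of_rel`, `isShift_of_rel`), and the number of guards follows by
comparison with level `0` (`ncard_occ`). The lifted strategy `liftStrategy` has all pairs of a state
of the given strategy and a gadget state of its level.

Within a level all gadget states are adjacent, and each state is adjacent to all the gadget states
above some state of level `1` or `2` (`IsLevelling.exists_hub`). Hence every node of the gadget is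
defended, and for an edge of the cycle it suffices to find, within each such level, states of the
three kinds (`exists_flow`, `exists_idle`, used in `IsLevelling.lift_proper_cycle`). No state is
both in `L` and in `R`, since each state has a side for each edge that determines the direction in
which the edge can be traversed (`Flow.side`). For properness, a leaf cycle of a cactus other than
the given one avoids the removed part and keeps its colours (`leafCycle_cases`, `color_replace`).

**Projection.** A red vertex with its leaves always holds a guard, and two after an attack on a leaf
(`exists_two_le_bunchCount`); hence with its two neighbours on the cycle it holds two guards at any
time (`two_le_neighborhood`). Adding this up over blocks of the cycle, there are always at least `K`
guards on it to be dropped, and enough of the others remain for the connecting vertex. These are put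
on the connecting vertex, except for one on a new leaf if there is a surplus, which an attack on a
leaf of vertex `1` provides (`project`, `egc_replace_add_le`).
-/

namespace EternalDomination

/-! ### States of the cycle gadget -/

/-- A state of the guards on a cycle of even length `n` whose vertex `0` is the connecting vertex,
whose odd vertices are red and whose other even vertices are white. `level` is `0`, `1` or `2`
according to the guards of the given strategy that the cycle takes over. On levels `1` and `2`,
`centre` is the odd index of the red vertex with a guard on its leaf number `leaf`; the values `-1`
and `n + 1` stand for no such vertex. On level `0` there is a single state. -/
structure GadgetState where
  level : ℕ
  centre : ℤ
  leaf : ℕ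

/-- The even index `w` holds a token: on level `0` the multiples of `4` do, on the other levels the
indices at distance `3` modulo `4` from the centre. For `0 < w < n` this means that a guard stands
on the white vertex `w`. The indices `0` and `n` both denote the connecting vertex, seen from its
two neighbours on the cycle. -/
def Token (s : GadgetState) (w : ℕ) : Prop :=
  (s.level = 0 ∧ w % 4 = 0) ∨ (s.level ≠ 0 ∧
    (((w : ℤ) < s.centre ∧ (s.centre - w) % 4 = 3) ∨ (s.centre < w ∧ ((w : ℤ) - s.centre) % 4 = 3)))

/-- Between `s` and `t` the guards move towards larger indices. -/
def Forward (s t : GadgetState) : Prop :=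
  (s.level = 0 ∧ t.level ≠ 0 ∧ t.centre % 4 = 1) ∨ (s.level ≠ 0 ∧ t.level = 0 ∧ s.centre % 4 = 3) ∨
  (s.level ≠ 0 ∧ t.level ≠ 0 ∧ ((s.centre < t.centre ∧ (t.centre - s.centre) % 4 = 0) ∨
    (t.centre < s.centre ∧ (s.centre - t.centre) % 4 = 2)))

/-- Leaf `b` of cycle vertex `j` is occupied: the leaf of the centre and, on level `2`, a parked
guard. For `n % 4 = 2` a guard is parked at vertex `n - 1` in place of a token at `n`, that is, if
the centre is `3` modulo `4`; for `n % 4 = 0` a guard is always parked at vertex `1`. -/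
def LeafOcc (n : ℕ) (s : GadgetState) (j b : ℕ) : Prop :=
  (s.level ≠ 0 ∧ (j : ℤ) = s.centre ∧ b = s.leaf) ∨
  (s.level = 2 ∧ b = 0 ∧
    ((n % 4 = 2 ∧ j + 1 = n ∧ s.centre % 4 = 3) ∨ (n % 4 = 0 ∧ j = 1)))

/-- Cycle vertex `j` is occupied. All red vertices are, white ones according to the tokens, and the
connecting vertex always except on level `1` for `n % 4 = 2` when no token is on it. -/
def CycOcc (n : ℕ) (s : GadgetState) (j : ℕ) : Prop :=
  j % 2 = 1 ∨ (j = 0 ∧ (s.level ≠ 1 ∨ n % 4 = 0 ∨ s.centre % 4 = 3)) ∨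
    (j % 2 = 0 ∧ 0 < j ∧ Token s j)

/-- The occupied nodes of the gadget: `(j, 0)` is the `j`-th cycle vertex, `(j, b + 1)` is the
`b`-th leaf at it. Vertex `0` has no leaves in the gadget. -/
def Occ (n : ℕ) (s : GadgetState) (x : ℕ × ℕ) : Prop :=
  x.1 < n ∧ ((x.2 = 0 ∧ CycOcc n s x.1) ∨ (0 < x.1 ∧ ∃ b, x.2 = b + 1 ∧ LeafOcc n s x.1 b))

/-- A guard moves from cycle vertex `j` to the next one between `s` and `t`. As a rule it leaves a
white vertex that loses its token or enters one that receives it. The exceptions involve the parked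
guard of level `2`: for `n % 4 = 2` it passes the last edge when the token at `n` is lost, or when
the level drops to `1` and this guard is released without a change of the centre; for `n % 4 = 0` a
guard passes the first edge when the level rises to `2`. -/
def Flow (n : ℕ) (s t : GadgetState) (j : ℕ) : Prop :=
  (¬ (n % 4 = 2 ∧ j + 1 = n ∧ (s.level = 2 ∨ t.level = 2)) ∧ Forward s t ∧
    ((j % 2 = 0 ∧ Token s j ∧ ¬ Token t j) ∨ (j % 2 = 1 ∧ ¬ Token s (j + 1) ∧ Token t (j + 1)))) ∨
  (n % 4 = 2 ∧ j + 1 = n ∧ (s.level = 2 ∨ t.level = 2) ∧ Forward s t ∧ Token s n ∧ ¬ Token t n) ∨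
  (n % 4 = 2 ∧ j + 1 = n ∧ s.level = 2 ∧ t.level = 1 ∧ s.centre = t.centre ∧ s.centre % 4 = 3) ∨
  (n % 4 = 0 ∧ j = 0 ∧ s.level = 1 ∧ t.level = 2)

/-- The states that are used. On level `2` the centre `n + 1` is excluded for `n % 4 = 2`, and the
leaf with the parked guard is excluded as the leaf of the centre for `n % 4 = 0`. -/
def IsGadgetState (n : ℕ) (d : ℕ → ℕ) (s : GadgetState) : Prop :=
  (s.level = 0 ∧ s.centre = 0 ∧ s.leaf = 0) ∨
  ((s.level = 1 ∨ s.level = 2) ∧ s.centre % 2 = 1 ∧ -1 ≤ s.centre ∧ s.centre ≤ n + 1 ∧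
    (0 < s.centre → s.centre < n → s.leaf < d s.centre.toNat) ∧
    (s.centre < 0 ∨ n < s.centre → s.leaf = 0) ∧
    (s.level = 2 → (n % 4 = 2 ∧ s.centre < n) ∨ (n % 4 = 0 ∧ ¬ (s.centre = 1 ∧ s.leaf = 0))))

/-- The parity condition of `IsGadgetState` on the centre. -/
def HasOddCentre (s : GadgetState) : Prop :=
  (s.level = 0 ∧ s.centre = 0) ∨ (s.level ≠ 0 ∧ s.centre % 2 = 1)

section
variable {n : ℕ} {d : ℕ → ℕ} {s t : GadgetState}

theorem IsGadgetState.odd (hs : IsGadgetState n d s) : HasOddCentre s := by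
  rcases hs with h | ⟨h, h', -⟩
  · exact Or.inl ⟨h.1, h.2.1⟩
  · exact Or.inr ⟨by omega, h'⟩

theorem token_unique {i : ℕ} (hi : i % 2 = 1) : ¬ (Token s (i - 1) ∧ Token s (i + 1)) := by
  simp only [Token] at *; omega

/-- With `token_unique`: a red vertex other than the centre has exactly one neighbour with a token,
and the centre has none. -/
theorem token_iff (hs : HasOddCentre s) {i : ℕ} (hi : i % 2 = 1) :
    (s.level ≠ 0 ∧ (i : ℤ) = s.centre) ↔ (¬ Token s (i - 1) ∧ ¬ Token s (i + 1)) := by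
  simp only [Token, HasOddCentre] at *; omega

theorem Forward.token_left (h : Forward s t) {i : ℕ} (hi : i % 2 = 1)
    (h1 : t.level ≠ 0) (h2 : (i : ℤ) = t.centre) : Token s (i - 1) := by
  simp only [Token, Forward] at *; omega

theorem Forward.token_right (h : Forward s t) {i : ℕ} (hi : i % 2 = 1)
    (h1 : s.level ≠ 0) (h2 : (i : ℤ) = s.centre) : Token t (i + 1) := by
  simp only [Token, Forward] at *; omega

theorem Forward.asymm (h : Forward s t) : ¬ Forward t s := by
  simp only [Forward] at *; omega

theorem forward_total (hs : HasOddCentre s) (ht : HasOddCentre t) :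
    Forward s t ∨ Forward t s ∨ (s.centre = t.centre ∧ (s.level = 0 ↔ t.level = 0)) := by
  rcases hs with ⟨h1, h2⟩ | ⟨h1, h2⟩ <;> rcases ht with ⟨h3, h4⟩ | ⟨h3, h4⟩ <;>
    simp only [Forward, h1, h3, h2, h4, ne_eq, not_true, not_false_iff, true_and, false_and,
      false_or, or_false, and_true, true_iff, iff_true] <;>
    omega

theorem token_congr (h : s.centre = t.centre) (h' : s.level = 0 ↔ t.level = 0) (w : ℕ) :
    Token s w ↔ Token t w := by
  simp only [Token, h, h', ne_eq]
end

/-! ### Moves of guards and balance at the cycle vertices -/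

/-- `M` is the set of moves of a bijection from `P` to `Q` in which the guards that stay in place
are left out. -/
structure IsShift {X : Type*} (P Q : X → Prop) (M : X → X → Prop) : Prop where
  src : ∀ x y, M x y → P x
  tgt : ∀ x y, M x y → Q y
  func : ∀ x y z, M x y → M x z → y = z
  inj : ∀ x y z, M y x → M z x → y = z
  leave : ∀ x, P x → ¬ Q x → ∃ y, M x y
  enter : ∀ x, Q x → ¬ P x → ∃ y, M y x
  fill : ∀ x y, M x y → Q x → ∃ z, M z x
  drain : ∀ x y, M y x → P x → ∃ z, M x z

/-- Balance at a vertex with three ways in `I₁`, `I₂`, `I₃` and three ways out `O₁`, `O₂`, `O₃`,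
which is occupied before the moves if `A` and afterwards if `A'`: at most one guard comes in, at
most one goes out, and this accounts for the occupation of the vertex. -/
structure Bal (I₁ I₂ I₃ O₁ O₂ O₃ A A' : Prop) : Prop where
  i12 : ¬ (I₁ ∧ I₂)
  i13 : ¬ (I₁ ∧ I₃)
  i23 : ¬ (I₂ ∧ I₃)
  o12 : ¬ (O₁ ∧ O₂)
  o13 : ¬ (O₁ ∧ O₃)
  o23 : ¬ (O₂ ∧ O₃)
  ia : I₁ ∨ I₂ ∨ I₃ → A'
  oa : O₁ ∨ O₂ ∨ O₃ → A
  o : A → ¬ A' → O₁ ∨ O₂ ∨ O₃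
  i : A' → ¬ A → I₁ ∨ I₂ ∨ I₃
  io : A → A' → (I₁ ∨ I₂ ∨ I₃ ↔ O₁ ∨ O₂ ∨ O₃)

/-- The index before `j` in cyclic order. -/
def predIdx (n j : ℕ) : ℕ := if j = 0 then n - 1 else j - 1

/-- The index after `j` in cyclic order. -/
def succIdx (n j : ℕ) : ℕ := if j + 1 = n then 0 else j + 1

/-- The moves inside the gadget: along the cycle in either direction, and between a cycle vertex and
its leaves whose occupation changes. -/
def CycleMove (n : ℕ) (s t : GadgetState) (x y : ℕ × ℕ) : Prop :=
  (x.2 = 0 ∧ y.2 = 0 ∧ x.1 < n ∧ y.1 = succIdx n x.1 ∧ Flow n s t x.1) ∨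
  (x.2 = 0 ∧ y.2 = 0 ∧ y.1 < n ∧ x.1 = succIdx n y.1 ∧ Flow n t s y.1) ∨
  (y.2 = 0 ∧ x.2 ≠ 0 ∧ x.1 = y.1 ∧ Occ n s x ∧ ¬ Occ n t x) ∨
  (x.2 = 0 ∧ y.2 ≠ 0 ∧ x.1 = y.1 ∧ Occ n t y ∧ ¬ Occ n s y)

/-- Leaf `b` of cycle vertex `j` gives up its guard. -/
def LeafOut (n : ℕ) (s t : GadgetState) (j b : ℕ) : Prop := 0 < j ∧ LeafOcc n s j b ∧
    ¬ LeafOcc n t j b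

/-- The occupied nodes whose guards are moved inside the gadget. The flag `o` says that the guard on
the connecting vertex is moved by the given strategy instead. -/
def OccExcept (n : ℕ) (s : GadgetState) (o : Bool) (x : ℕ × ℕ) : Prop :=
    Occ n s x ∧ (o = true → x ≠ (0, 0))

theorem succIdx_predIdx {n j : ℕ} (hn : 3 ≤ n) (hj : j < n) : succIdx n (predIdx n j) = j := by
  unfold succIdx predIdx; split_ifs <;> omega

theorem predIdx_succIdx {n j : ℕ} (hn : 3 ≤ n) : predIdx n (succIdx n j) = j := by
  unfold succIdx predIdx; split_ifs <;> first | omega | simp_all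

theorem predIdx_lt {n j : ℕ} (hn : 3 ≤ n) (hj : j < n) : predIdx n j < n := by
  unfold predIdx; split_ifs <;> omega

theorem succIdx_lt {n j : ℕ} (hn : 3 ≤ n) (hj : j < n) : succIdx n j < n := by
  unfold succIdx; split_ifs <;> omega

theorem predIdx_ne_succIdx {n j : ℕ} (hn : 3 ≤ n) : predIdx n j ≠ succIdx n j := by
  unfold predIdx succIdx; split_ifs <;> omega

/-- Balance at cycle vertex `j`. The flags say whether the given strategy moves a guard out of the
connecting vertex (`o`) and into it (`i`). -/
def BalAt (n : ℕ) (s t : GadgetState) (o i : Bool) (j : ℕ) : Prop :=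
  Bal (Flow n s t (predIdx n j)) (Flow n t s j) (∃ b, LeafOut n s t j b)
    (Flow n s t j) (Flow n t s (predIdx n j)) (∃ b, LeafOut n t s j b)
    (OccExcept n s o (j, 0)) (OccExcept n t i (j, 0))

theorem cycleMove_from_cyc {n : ℕ} (hn : 3 ≤ n) {s t : GadgetState} {j : ℕ} (hj : j < n)
    {y : ℕ × ℕ} :
    CycleMove n s t (j, 0) y ↔ (y = (succIdx n j, 0) ∧ Flow n s t j) ∨
      (y = (predIdx n j, 0) ∧ Flow n t s (predIdx n j)) ∨
      (∃ b, y = (j, b + 1) ∧ LeafOut n t s j b) := by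
  obtain ⟨a, b⟩ := y
  constructor
  · rintro (⟨-, h1, -, h2, h3⟩ | ⟨-, h1, h2, h3, h4⟩ | ⟨-, h, -⟩ | ⟨-, h, h', ⟨h2, h3⟩, h4⟩)
    · simp only at h1 h2
      exact Or.inl ⟨by rw [h1, h2], h3⟩
    · simp only at h1 h2 h3 h4
      have : a = predIdx n j := by rw [h3, predIdx_succIdx hn]
      exact Or.inr (Or.inl ⟨by rw [h1, this], this ▸ h4⟩)
    · exact absurd rfl h
    · simp only at h h' h2 h3 h4
      subst h'
      rcases h3 with h3 | ⟨h3, e, rfl, h5⟩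
      · exact absurd h3.1 h
      · refine Or.inr (Or.inr ⟨e, rfl, h3, h5, fun h6 => h4 ⟨h2, Or.inr ⟨h3, e, rfl, h6⟩⟩⟩)
  · rintro (⟨h, h'⟩ | ⟨h, h'⟩ | ⟨e, h, h1, h2, h3⟩)
    · rw [h]; exact Or.inl ⟨rfl, rfl, hj, rfl, h'⟩
    · rw [h]; exact Or.inr (Or.inl ⟨rfl, rfl, predIdx_lt hn hj, (succIdx_predIdx hn hj).symm, h'⟩)
    · rw [h]
      refine Or.inr (Or.inr (Or.inr ⟨rfl, by simp, rfl, ⟨hj, Or.inr ⟨h1, e, rfl, h2⟩⟩, ?_⟩))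
      rintro ⟨-, h | ⟨-, e', h4, h5⟩⟩
      · simp at h
      · simp only [Nat.add_right_cancel_iff] at h4; exact h3 (h4 ▸ h5)

theorem cycleMove_swap {n : ℕ} {s t : GadgetState} {x y : ℕ × ℕ} :
    CycleMove n s t x y ↔ CycleMove n t s y x := by
  constructor <;>
  · rintro (⟨h1, h2, h3⟩ | ⟨h1, h2, h3⟩ | ⟨h1, h2, h3, h4⟩ | ⟨h1, h2, h3, h4⟩)
    · exact Or.inr (Or.inl ⟨h2, h1, h3⟩)
    · exact Or.inl ⟨h2, h1, h3⟩
    · exact Or.inr (Or.inr (Or.inr ⟨h1, h2, h3.symm, h4⟩))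
    · exact Or.inr (Or.inr (Or.inl ⟨h1, h2, h3.symm, h4⟩))

theorem occ_leaf {n : ℕ} {s : GadgetState} {j b : ℕ} : Occ n s (j, b + 1) ↔ 0 < j ∧ j < n ∧
    LeafOcc n s j b := by
  simp only [Occ]
  constructor
  · rintro ⟨h1, h | ⟨h2, e, h, h3⟩⟩
    · simp at h
    · simp only [Nat.add_right_cancel_iff] at h; exact ⟨h2, h1, h ▸ h3⟩
  · rintro ⟨h1, h2, h3⟩
    exact ⟨h2, Or.inr ⟨h1, b, rfl, h3⟩⟩

theorem occ_cyc {n : ℕ} {s : GadgetState} {j : ℕ} : Occ n s (j, 0) ↔ j < n ∧ CycOcc n s j := by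
  simp [Occ]

theorem cycleMove_lt {n : ℕ} (hn : 3 ≤ n) {s t : GadgetState} {x y : ℕ × ℕ}
    (h : CycleMove n s t x y) : x.1 < n := by
  rcases h with ⟨-, h1, h2, -⟩ | ⟨-, h1, h2, h3, -⟩ | ⟨-, h, -, ⟨h2, h3⟩, h4⟩ |
    ⟨-, h, h', ⟨h2, h3⟩, h4⟩
  · exact h2
  · rw [h3]; exact succIdx_lt hn h2
  · exact h2
  · rw [h']; exact h2

theorem cycleMove_from_leaf {n : ℕ} {s t : GadgetState} {j b : ℕ} (hj : j < n) {y : ℕ × ℕ} :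
    CycleMove n s t (j, b + 1) y ↔ y = (j, 0) ∧ LeafOut n s t j b := by
  unfold CycleMove LeafOut
  simp only [Nat.add_eq_zero_iff, one_ne_zero, and_false, false_and, false_or, or_false, ne_eq,
    not_false_eq_true, true_and, occ_leaf, Prod.ext_iff]
  constructor
  · rintro ⟨h1, h2, h3, h4⟩; exact ⟨⟨h2.symm, h1⟩, h3.1, h3.2.2, fun h => h4 ⟨h3.1, hj, h⟩⟩
  · rintro ⟨⟨h1, h2⟩, h3, h4, h5⟩; exact ⟨h2, h1.symm, ⟨h3, hj, h4⟩, fun h => h5 h.2.2⟩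

/-- Half of the conditions of `IsShift`; the other half follows by exchanging `s` and `t`. -/
theorem isShift_of_bal_aux {n : ℕ} (hn : 3 ≤ n) {s t : GadgetState} {o i : Bool}
    (hb : ∀ j < n, BalAt n s t o i j)
    (hl : ∀ j b b', LeafOut n t s j b → LeafOut n t s j b' → b = b') :
    (∀ x y, CycleMove n s t x y → OccExcept n s o x) ∧ (∀ x y z, CycleMove n s t x y →
      CycleMove n s t x z → y = z) ∧
    (∀ x, OccExcept n s o x → ¬ OccExcept n t i x → ∃ y, CycleMove n s t x y) ∧
    (∀ x y, CycleMove n s t x y → OccExcept n t i x → ∃ z, CycleMove n s t z x) := by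
  have key : ∀ j < n, (∃ y, CycleMove n s t (j, 0) y) ↔ (Flow n s t j) ∨
    (Flow n t s (predIdx n j)) ∨ (∃ b, LeafOut n t s j b) := by
    intro j hj
    constructor
    · rintro ⟨y, hy⟩
      rcases (cycleMove_from_cyc hn hj).1 hy with h | h | ⟨b, h⟩
      · exact Or.inl h.2
      · exact Or.inr (Or.inl h.2)
      · exact Or.inr (Or.inr ⟨b, h.2⟩)
    · rintro (h | h | ⟨b, h⟩)
      · exact ⟨_, (cycleMove_from_cyc hn hj).2 (Or.inl ⟨rfl, h⟩)⟩
      · exact ⟨_, (cycleMove_from_cyc hn hj).2 (Or.inr (Or.inl ⟨rfl, h⟩))⟩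
      · exact ⟨_, (cycleMove_from_cyc hn hj).2 (Or.inr (Or.inr ⟨b, rfl, h⟩))⟩
  have key' : ∀ j < n, (∃ y, CycleMove n s t y (j, 0)) ↔ (Flow n s t (predIdx n j)) ∨
    (Flow n t s j) ∨ (∃ b, LeafOut n s t j b) := by
    intro j hj
    constructor
    · rintro ⟨y, hy⟩
      rcases (cycleMove_from_cyc hn hj).1 (cycleMove_swap.1 hy) with h | h | ⟨b, h⟩
      · exact Or.inr (Or.inl h.2)
      · exact Or.inl h.2
      · exact Or.inr (Or.inr ⟨b, h.2⟩)
    · rintro (h | h | ⟨b, h⟩)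
      · exact ⟨_, cycleMove_swap.1 ((cycleMove_from_cyc hn hj).2 (Or.inr (Or.inl ⟨rfl, h⟩)))⟩
      · exact ⟨_, cycleMove_swap.1 ((cycleMove_from_cyc hn hj).2 (Or.inl ⟨rfl, h⟩))⟩
      · exact ⟨_, cycleMove_swap.1 ((cycleMove_from_cyc hn hj).2 (Or.inr (Or.inr ⟨b, rfl, h⟩)))⟩
  refine ⟨?_, ?_, ?_, ?_⟩
  · rintro ⟨j, b⟩ y h
    have hj := cycleMove_lt hn h
    rcases b with _ | b
    · exact (hb j hj).oa ((key j hj).1 ⟨y, h⟩)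
    · have := (cycleMove_from_leaf hj).1 h
      exact ⟨occ_leaf.2 ⟨this.2.1, hj, this.2.2.1⟩, fun _ => by simp⟩
  · rintro ⟨j, b⟩ y z h h'
    have hj : j < n := cycleMove_lt hn h
    rcases b with _ | b
    · have hB := hb j hj
      rcases (cycleMove_from_cyc hn hj).1 h with ⟨h1, h2⟩ | ⟨h1, h2⟩ | ⟨b, h1, h2⟩ <;>
      rcases (cycleMove_from_cyc hn hj).1 h' with ⟨h3, h4⟩ | ⟨h3, h4⟩ | ⟨b', h3, h4⟩
      · rw [h1, h3]
      · exact absurd ⟨h2, h4⟩ hB.o12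
      · exact absurd ⟨h2, _, h4⟩ hB.o13
      · exact absurd ⟨h4, h2⟩ hB.o12
      · rw [h1, h3]
      · exact absurd ⟨h2, _, h4⟩ hB.o23
      · exact absurd ⟨h4, _, h2⟩ hB.o13
      · exact absurd ⟨h4, _, h2⟩ hB.o23
      · rw [h1, h3, hl j b b' h2 h4]
    · rw [((cycleMove_from_leaf hj).1 h).1, ((cycleMove_from_leaf hj).1 h').1]
  · rintro ⟨j, b⟩ h h'
    have hj : j < n := h.1.1
    rcases b with _ | b
    · exact (key j hj).2 ((hb j hj).o h h')
    · refine ⟨_, (cycleMove_from_leaf hj).2 ⟨rfl, (occ_leaf.1 h.1).1, (occ_leaf.1 h.1).2.2,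
        fun h1 => h' ⟨occ_leaf.2 ⟨(occ_leaf.1 h.1).1, hj, h1⟩, fun _ => by simp⟩⟩⟩
  · rintro ⟨j, b⟩ y h h'
    have hj : j < n := cycleMove_lt hn h
    rcases b with _ | b
    · have h0 := (key j hj).1 ⟨y, h⟩
      exact (key' j hj).2 (((hb j hj).io ((hb j hj).oa h0) h').2 h0)
    · exact absurd (occ_leaf.1 h'.1).2.2 ((cycleMove_from_leaf hj).1 h).2.2.2

theorem BalAt.symm {n : ℕ} {s t : GadgetState} {o i : Bool} {j : ℕ} (h : BalAt n s t o i j) :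
    BalAt n t s i o j :=
  ⟨fun h' => h.o12 ⟨h'.2, h'.1⟩, fun h' => h.o23 ⟨h'.1, h'.2⟩, fun h' => h.o13 ⟨h'.1, h'.2⟩,
    fun h' => h.i12 ⟨h'.2, h'.1⟩, fun h' => h.i23 ⟨h'.1, h'.2⟩, fun h' => h.i13 ⟨h'.1, h'.2⟩,
   fun h' => h.oa (by tauto), fun h' => h.ia (by tauto), fun h1 h2 => by have := h.i h1 h2; tauto,
   fun h1 h2 => by have := h.o h1 h2; tauto, fun h1 h2 => by have := h.io h2 h1; tauto⟩

/-- Balance at all cycle vertices, together with at most one guard moving onto or off the leaves of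
each vertex, makes the moves of the gadget a bijection. -/
theorem isShift_of_bal {n : ℕ} (hn : 3 ≤ n) {s t : GadgetState} {o i : Bool}
    (hb : ∀ j < n, BalAt n s t o i j)
    (hl : ∀ j b b', LeafOut n t s j b → LeafOut n t s j b' → b = b')
    (hl' : ∀ j b b', LeafOut n s t j b → LeafOut n s t j b' → b = b') :
    IsShift (OccExcept n s o) (OccExcept n t i) (CycleMove n s t) := by
  obtain ⟨a1, a2, a3, a4⟩ := isShift_of_bal_aux hn hb hl
  obtain ⟨b1, b2, b3, b4⟩ := isShift_of_bal_aux hn (fun j hj => (hb j hj).symm) hl'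
  refine ⟨a1, fun x y h => b1 y x (cycleMove_swap.1 h), a2, fun x y z h h' =>
    b2 x y z (cycleMove_swap.1 h) (cycleMove_swap.1 h'), a3,
    fun x h h' => (b3 x h h').imp fun y hy => cycleMove_swap.1 hy, a4, fun x y h h' =>
      (b4 x y (cycleMove_swap.1 h) h').imp fun z hz => cycleMove_swap.1 hz⟩

/-! ### Balance without exceptional moves -/

/-- The red vertex `j` is the centre. -/
def IsCentre (s : GadgetState) (j : ℕ) : Prop := s.level ≠ 0 ∧ (j : ℤ) = s.centre

section
variable {n : ℕ} {d : ℕ → ℕ} {s t : GadgetState}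

theorem flow_iff_of_core (h : ¬ (n % 4 = 2 ∧ (s.level = 2 ∨ t.level = 2)))
    (h' : ¬ (n % 4 = 0 ∧ s.level = 1 ∧ t.level = 2)) (j : ℕ) :
    Flow n s t j ↔ Forward s t ∧
    ((j % 2 = 0 ∧ Token s j ∧ ¬ Token t j) ∨ (j % 2 = 1 ∧ ¬ Token s (j + 1) ∧
      Token t (j + 1))) := by
  have h1 : ¬ (n % 4 = 2 ∧ j + 1 = n ∧ (s.level = 2 ∨ t.level = 2)) := fun h1 => h ⟨h1.1, h1.2.2⟩
  have h2 : ¬ (n % 4 = 2 ∧ j + 1 = n ∧ (s.level = 2 ∨ t.level = 2) ∧ Forward s t ∧ Token s n ∧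
    ¬ Token t n) :=
    fun h1 => h ⟨h1.1, h1.2.2.1⟩
  have h3 : ¬ (n % 4 = 2 ∧ j + 1 = n ∧ s.level = 2 ∧ t.level = 1 ∧ s.centre = t.centre ∧
    s.centre % 4 = 3) :=
    fun h1 => h ⟨h1.1, Or.inl h1.2.2.1⟩
  have h4 : ¬ (n % 4 = 0 ∧ j = 0 ∧ s.level = 1 ∧ t.level = 2) := fun h1 => h' ⟨h1.1, h1.2.2⟩
  unfold Flow
  rw [or_iff_left (not_or.2 ⟨h2, not_or.2 ⟨h3, h4⟩⟩), and_iff_right h1]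

theorem leafOcc_odd (hs : HasOddCentre s) (hn : n % 2 = 0) {j b : ℕ} (h : LeafOcc n s j b) :
    j % 2 = 1 := by
  simp only [LeafOcc, HasOddCentre] at *; omega

/-- All facts about the tokens next to a red vertex `j` in two states on which balance at `j`
depends. -/
theorem token_centre_facts (hs : HasOddCentre s) (ht : HasOddCentre t) {j : ℕ} (hj : j % 2 = 1) :
   (Token s (j - 1) → ¬ Token s (j + 1)) ∧ (IsCentre s j ↔ ¬ Token s (j - 1) ∧ ¬ Token s (j + 1)) ∧
   (Token t (j - 1) → ¬ Token t (j + 1)) ∧ (IsCentre t j ↔ ¬ Token t (j - 1) ∧ ¬ Token t (j + 1)) ∧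
   (Forward s t → IsCentre t j → Token s (j - 1)) ∧ (Forward s t → IsCentre s j → Token t (j + 1)) ∧
   (Forward t s → IsCentre s j → Token t (j - 1)) ∧ (Forward t s → IsCentre t j → Token s (j + 1)) ∧
   (Forward s t → ¬ Forward t s) ∧ (¬ Forward s t → ¬ Forward t s →
     (Token s (j - 1) ↔ Token t (j - 1)) ∧ (Token s (j + 1) ↔ Token t (j + 1))) := by
  refine ⟨fun h h' => token_unique hj ⟨h, h'⟩, token_iff hs hj, fun h h' => token_unique hj ⟨h, h'⟩,
    token_iff ht hj,
    fun h h' => h.token_left hj h'.1 h'.2, fun h h' => h.token_right hj h'.1 h'.2,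
    fun h h' => h.token_left hj h'.1 h'.2, fun h h' => h.token_right hj h'.1 h'.2, fun h => h.asymm,
      ?_⟩
  intro h1 h2
  rcases forward_total hs ht with h | h | h
  · exact absurd h h1
  · exact absurd h h2
  · exact ⟨token_congr h.1 h.2 _, token_congr h.1 h.2 _⟩

theorem bal_red {f₁ f₂ f₃ f₄ l₁ l₂ A A' : Prop} (hs : HasOddCentre s) (ht : HasOddCentre t) {j : ℕ}
    (hj : j % 2 = 1)
    (h1 : f₁ ↔ Forward s t ∧ Token s (j - 1) ∧ ¬ Token t (j - 1))
    (h2 : f₂ ↔ Forward t s ∧ Token s (j + 1) ∧ ¬ Token t (j + 1))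
    (h3 : f₃ ↔ Forward s t ∧ Token t (j + 1) ∧ ¬ Token s (j + 1))
    (h4 : f₄ ↔ Forward t s ∧ Token t (j - 1) ∧ ¬ Token s (j - 1))
    (h5 : l₁ ↔ IsCentre s j ∧ (¬ IsCentre t j ∨ s.leaf ≠ t.leaf))
    (h6 : l₂ ↔ IsCentre t j ∧ (¬ IsCentre s j ∨ s.leaf ≠ t.leaf))
    (hA : A) (hA' : A') : Bal f₁ f₂ l₁ f₃ f₄ l₂ A A' := by
  have := token_centre_facts hs ht hj
  constructor <;> grind

theorem bal_white {f₁ f₂ f₃ f₄ l₁ l₂ A A' : Prop} (hs : HasOddCentre s) (ht : HasOddCentre t)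
    {j : ℕ}
    (h1 : f₁ ↔ Forward s t ∧ Token t j ∧ ¬ Token s j)
    (h2 : f₂ ↔ Forward t s ∧ Token t j ∧ ¬ Token s j)
    (h3 : f₃ ↔ Forward s t ∧ Token s j ∧ ¬ Token t j)
    (h4 : f₄ ↔ Forward t s ∧ Token s j ∧ ¬ Token t j)
    (h5 : ¬ l₁) (h6 : ¬ l₂)
    (hA : A ↔ Token s j) (hA' : A' ↔ Token t j) : Bal f₁ f₂ l₁ f₃ f₄ l₂ A A' := by
  have h7 : Forward s t → ¬ Forward t s := fun h => h.asymm
  have h8 : ¬ Forward s t → ¬ Forward t s → (Token s j ↔ Token t j) := by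
    intro h1 h2
    rcases forward_total hs ht with h | h | h
    · exact absurd h h1
    · exact absurd h h2
    · exact token_congr h.1 h.2 _
  constructor <;> grind

theorem occExcept_pos {o : Bool} {j : ℕ} (hj : 0 < j) (hjn : j < n) :
    OccExcept n s o (j, 0) ↔ CycOcc n s j := by
  have : (j, 0) ≠ (0, 0) := by simp; omega
  simp only [OccExcept, occ_cyc, hjn, true_and, this, ne_eq, not_false_eq_true, implies_true,
    and_true]

theorem cycOcc_odd {j : ℕ} (hj : j % 2 = 1) : CycOcc n s j := Or.inl hj

theorem cycOcc_even {j : ℕ} (hj : j % 2 = 0) (h : 0 < j) : CycOcc n s j ↔ Token s j := by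
  unfold CycOcc
  have h1 : ¬ j % 2 = 1 := by omega
  have h2 : ¬ j = 0 := by omega
  simp only [h2, hj, h, false_and, false_or, true_and, zero_ne_one]

theorem balAt_white (hn : n % 2 = 0) (hs : HasOddCentre s) (ht : HasOddCentre t) {o i : Bool}
    {j : ℕ} (hj : j % 2 = 0) (h0 : 0 < j) (hjn : j < n)
    (hf : ∀ j' < n, j' + 1 ≠ n → j' ≠ 0 → (Flow n s t j' ↔ Forward s t ∧
    ((j' % 2 = 0 ∧ Token s j' ∧ ¬ Token t j') ∨ (j' % 2 = 1 ∧ ¬ Token s (j' + 1) ∧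
      Token t (j' + 1)))))
    (hf' : ∀ j' < n, j' + 1 ≠ n → j' ≠ 0 → (Flow n t s j' ↔ Forward t s ∧
    ((j' % 2 = 0 ∧ Token t j' ∧ ¬ Token s j') ∨ (j' % 2 = 1 ∧ ¬ Token t (j' + 1) ∧
      Token s (j' + 1))))) :
    BalAt n s t o i j := by
  have hpr : predIdx n j = j - 1 := by unfold predIdx; rw [if_neg (by omega)]
  have e : j - 1 + 1 = j := by omega
  have e1 : ¬ (j - 1) % 2 = 0 := by omega
  have e2 : (j - 1) % 2 = 1 := by omega
  have e3 : ¬ j % 2 = 1 := by omega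
  unfold BalAt
  rw [hpr]
  have hl : ∀ (s t : GadgetState), HasOddCentre s → ¬ ∃ b, LeafOut n s t j b := by
    rintro s t hs ⟨b, hb⟩
    have := leafOcc_odd hs hn hb.2.1
    omega
  apply bal_white hs ht (j := j)
  · rw [hf _ (by omega) (by omega) (by omega), e]; tauto
  · rw [hf' _ (by omega) (by omega) (by omega)]; tauto
  · rw [hf _ (by omega) (by omega) (by omega)]; tauto
  · rw [hf' _ (by omega) (by omega) (by omega), e]; tauto
  · exact hl s t hs
  · exact hl t s ht
  · rw [occExcept_pos h0 hjn, cycOcc_even hj h0]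
  · rw [occExcept_pos h0 hjn, cycOcc_even hj h0]

theorem balAt_red (hs : HasOddCentre s) (ht : HasOddCentre t) {o i : Bool} {j : ℕ} (hj : j % 2 = 1)
    (hjn : j < n)
    (hf : ∀ j', j' = j ∨ j' + 1 = j → (Flow n s t j' ↔ Forward s t ∧
    ((j' % 2 = 0 ∧ Token s j' ∧ ¬ Token t j') ∨ (j' % 2 = 1 ∧ ¬ Token s (j' + 1) ∧
      Token t (j' + 1)))))
    (hf' : ∀ j', j' = j ∨ j' + 1 = j → (Flow n t s j' ↔ Forward t s ∧
    ((j' % 2 = 0 ∧ Token t j' ∧ ¬ Token s j') ∨ (j' % 2 = 1 ∧ ¬ Token t (j' + 1) ∧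
      Token s (j' + 1)))))
    (hl : (∃ b, LeafOut n s t j b) ↔ IsCentre s j ∧ (¬ IsCentre t j ∨ s.leaf ≠ t.leaf))
    (hl' : (∃ b, LeafOut n t s j b) ↔ IsCentre t j ∧ (¬ IsCentre s j ∨ s.leaf ≠ t.leaf)) :
    BalAt n s t o i j := by
  have hpr : predIdx n j = j - 1 := by unfold predIdx; rw [if_neg (by omega)]
  have e : j - 1 + 1 = j := by omega
  have e1 : (j - 1) % 2 = 0 := by omega
  have e2 : ¬ (j - 1) % 2 = 1 := by omega
  have e3 : ¬ j % 2 = 0 := by omega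
  unfold BalAt
  rw [hpr]
  apply bal_red hs ht hj
  · rw [hf _ (by omega)]; tauto
  · rw [hf' _ (by omega)]; tauto
  · rw [hf _ (by omega)]; tauto
  · rw [hf' _ (by omega)]; tauto
  · exact hl
  · exact hl'
  · rw [occExcept_pos (by omega) hjn]; exact cycOcc_odd hj
  · rw [occExcept_pos (by omega) hjn]; exact cycOcc_odd hj

/-- Balance at a vertex without leaves, with the ways in `a`, `b` and the ways out `c`, `d`. -/
structure BalU (a b c d A A' : Prop) : Prop where
  i : ¬ (a ∧ b)
  o : ¬ (c ∧ d)
  ia : a ∨ b → A'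
  oa : c ∨ d → A
  leave : A → ¬ A' → c ∨ d
  enter : A' → ¬ A → a ∨ b
  io : A → A' → (a ∨ b ↔ c ∨ d)

theorem BalU.bal {f₁ f₂ f₃ f₄ l₁ l₂ a b c d A A' : Prop} (h : BalU a b c d A A')
    (h1 : f₁ ↔ a) (h2 : f₂ ↔ b) (h3 : f₃ ↔ c) (h4 : f₄ ↔ d) (h5 : ¬ l₁) (h6 : ¬ l₂) :
    Bal f₁ f₂ l₁ f₃ f₄ l₂ A A' := by
  obtain ⟨p1, p2, p3, p4, p5, p6, p7⟩ := h
  rw [h1, h2, h3, h4]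
  rw [eq_false h5, eq_false h6]
  constructor <;> simpa only [and_false, or_false, not_false_eq_true]
end

section
variable {n : ℕ} {d : ℕ → ℕ} {s t : GadgetState}

theorem balAt_u (hn : n % 2 = 0) (h3 : 3 ≤ n) {o i : Bool}
    (hf : ∀ j', j' = 0 ∨ j' + 1 = n → (Flow n s t j' ↔ Forward s t ∧
    ((j' % 2 = 0 ∧ Token s j' ∧ ¬ Token t j') ∨ (j' % 2 = 1 ∧ ¬ Token s (j' + 1) ∧
      Token t (j' + 1)))))
    (hf' : ∀ j', j' = 0 ∨ j' + 1 = n → (Flow n t s j' ↔ Forward t s ∧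
    ((j' % 2 = 0 ∧ Token t j' ∧ ¬ Token s j') ∨ (j' % 2 = 1 ∧ ¬ Token t (j' + 1) ∧
      Token s (j' + 1)))))
    (hb : BalU (Forward s t ∧ Token t n ∧ ¬ Token s n) (Forward t s ∧ Token t 0 ∧ ¬ Token s 0)
      (Forward s t ∧ Token s 0 ∧ ¬ Token t 0) (Forward t s ∧ Token s n ∧ ¬ Token t n)
      (CycOcc n s 0 ∧ ¬ o = true) (CycOcc n t 0 ∧ ¬ i = true)) :
    BalAt n s t o i 0 := by
  have hpr : predIdx n 0 = n - 1 := by simp [predIdx]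
  have e : n - 1 + 1 = n := by omega
  have e1 : ¬ (n - 1) % 2 = 0 := by omega
  have e2 : (n - 1) % 2 = 1 := by omega
  unfold BalAt
  rw [hpr]
  have hl : ∀ (s t : GadgetState), ¬ ∃ b, LeafOut n s t 0 b := by
    rintro s t ⟨b, hb⟩; exact absurd hb.1 (by simp)
  have hO : ∀ (s : GadgetState) (o : Bool), OccExcept n s o (0, 0) ↔ CycOcc n s 0 ∧ ¬ o = true := by
    intro s o
    have : 0 < n := by omega
    simp [OccExcept, occ_cyc, this]
  rw [hO, hO]
  refine hb.bal ?_ ?_ ?_ ?_ (hl s t) (hl t s)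
  · rw [hf _ (by omega), e]; tauto
  · rw [hf' _ (by omega)]; tauto
  · rw [hf _ (by omega)]; tauto
  · rw [hf' _ (by omega), e]; tauto

theorem token_zero (h : s.level ≠ 0) (h1 : -1 ≤ s.centre) :
    Token s 0 ↔ 0 < s.centre ∧ s.centre % 4 = 3 := by
  simp only [Token]; omega

theorem token_last (hn : n % 2 = 0) (h : s.level ≠ 0) (h1 : s.centre ≤ n + 1) :
    Token s n ↔ s.centre < n ∧ ((n % 4 = 0 ∧ s.centre % 4 = 1) ∨
      (n % 4 = 2 ∧ s.centre % 4 = 3)) := by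
  simp only [Token]; omega

theorem forward_iff (h : s.level ≠ 0) (h' : t.level ≠ 0) : Forward s t ↔
    (s.centre < t.centre ∧ s.centre % 4 = t.centre % 4) ∨
    (t.centre < s.centre ∧ (s.centre - t.centre) % 4 = 2) := by
  simp only [Forward]; omega

theorem balU_core (hn : n % 2 = 0) (hs : IsGadgetState n d s) (ht : IsGadgetState n d t)
    (h : s.level = 1 ∧ t.level = 1 ∨ s.level = 2 ∧ t.level = 2 ∧ n % 4 = 0) :
   BalU (Forward s t ∧ Token t n ∧ ¬ Token s n) (Forward t s ∧ Token t 0 ∧ ¬ Token s 0)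
      (Forward s t ∧ Token s 0 ∧ ¬ Token t 0) (Forward t s ∧ Token s n ∧ ¬ Token t n)
      (CycOcc n s 0 ∧ ¬ false = true) (CycOcc n t 0 ∧ ¬ false = true) := by
  obtain ⟨-, p1, p2, p3, -⟩ := hs.resolve_left (by omega)
  obtain ⟨-, q1, q2, q3, -⟩ := ht.resolve_left (by omega)
  rw [token_zero (by omega) p2, token_zero (by omega) q2, token_last hn (by omega) p3,
    token_last hn (by omega) q3, forward_iff (by omega) (by omega),
    forward_iff (by omega) (by omega)]
  have e1 : s.level ≠ 1 ∨ n % 4 = 0 ∨ s.centre % 4 = 3 ↔ n % 4 = 0 ∨ s.centre % 4 = 3 := by omega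
  have e2 : t.level ≠ 1 ∨ n % 4 = 0 ∨ t.centre % 4 = 3 ↔ n % 4 = 0 ∨ t.centre % 4 = 3 := by omega
  simp only [CycOcc, e1, e2, ne_eq, not_false_iff, true_and, false_and, false_or, or_false,
    and_true, lt_irrefl, Nat.zero_mod, zero_ne_one, Bool.false_eq_true]
  generalize s.centre = r at *
  generalize t.centre = r' at *
  have c0 : n % 4 = 0 ∨ n % 4 = 2 := by omega
  have c : r % 4 = 1 ∨ r % 4 = 3 := by omega
  have c' : r' % 4 = 1 ∨ r' % 4 = 3 := by omega
  clear hs ht e1 e2 h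
  rcases c0 with c0 | c0 <;> rcases c with c | c <;> rcases c' with c' | c' <;>
    (constructor <;> simp [c0, c, c'] <;> intros <;> omega)

theorem leafOut_core (hs : IsGadgetState n d s) (ht : IsGadgetState n d t)
    (h : s.level ≤ 1 ∧ t.level ≤ 1 ∨ s.level = 2 ∧ t.level = 2 ∧ n % 4 = 0) {j : ℕ} (hj : 0 < j) :
    (∃ b, LeafOut n s t j b) ↔ IsCentre s j ∧ (¬ IsCentre t j ∨ s.leaf ≠ t.leaf) := by
  simp only [LeafOut, LeafOcc, IsCentre]
  rcases h with h | h
  · have e1 : ¬ s.level = 2 := by omega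
    have e2 : ¬ t.level = 2 := by omega
    simp only [e1, e2, false_and, or_false]
    constructor
    · rintro ⟨b, h1, ⟨h2, h3, rfl⟩, h4⟩
      exact ⟨⟨h2, h3⟩, by tauto⟩
    · rintro ⟨⟨h2, h3⟩, h4⟩
      exact ⟨s.leaf, hj, ⟨h2, h3, rfl⟩, by tauto⟩
  · have e1 : ¬ n % 4 = 2 := by omega
    have hs' : ¬ (s.centre = 1 ∧ s.leaf = 0) := by
      obtain ⟨-, -, -, -, -, -, h'⟩ := hs.resolve_left (by omega)
      exact ((h' h.1).resolve_left (fun h => e1 h.1)).2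
    have ht' : ¬ (t.centre = 1 ∧ t.leaf = 0) := by
      obtain ⟨-, -, -, -, -, -, h'⟩ := ht.resolve_left (by omega)
      exact ((h' h.2.1).resolve_left (fun h => e1 h.1)).2
    constructor
    · rintro ⟨b, h1, h2, h3⟩
      omega
    · rintro ⟨h1, h2⟩
      exact ⟨s.leaf, by omega⟩

theorem balAt_core (hn : n % 2 = 0) (h3 : 4 ≤ n) (hs : IsGadgetState n d s)
    (ht : IsGadgetState n d t)
    (h' : s.level = 1 ∧ t.level = 1 ∨ s.level = 2 ∧ t.level = 2 ∧ n % 4 = 0) (j : ℕ) (hj : j < n) :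
    BalAt n s t false false j := by
  have hf := flow_iff_of_core (n := n) (s := s) (t := t) (by omega) (by omega)
  have hf' := flow_iff_of_core (n := n) (s := t) (t := s) (by omega) (by omega)
  rcases Nat.mod_two_eq_zero_or_one j with h | h
  · rcases Nat.eq_zero_or_pos j with rfl | h0
    · exact balAt_u hn (by omega) (fun j' _ => hf j') (fun j' _ => hf' j') (balU_core hn hs ht h')
    · exact balAt_white hn hs.odd ht.odd h h0 hj (fun j' _ _ _ => hf j') (fun j' _ _ _ => hf' j')
  · refine balAt_red hs.odd ht.odd h hj (fun j' _ => hf j') (fun j' _ => hf' j')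
      (leafOut_core hs ht (by omega) (by omega)) ?_
    rw [leafOut_core ht hs (by omega) (by omega), ne_comm]

theorem balU_zero (hn : n % 2 = 0) (ht : IsGadgetState n d t) (h0 : s.level = 0) (h1 : t.level = 1)
    {i : Bool} (hi : i = true ↔ n % 4 = 0) :
    BalU (Forward s t ∧ Token t n ∧ ¬ Token s n) (Forward t s ∧ Token t 0 ∧ ¬ Token s 0)
      (Forward s t ∧ Token s 0 ∧ ¬ Token t 0) (Forward t s ∧ Token s n ∧ ¬ Token t n)
      (CycOcc n s 0 ∧ ¬ false = true) (CycOcc n t 0 ∧ ¬ i = true) := by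
  obtain ⟨-, q1, q2, q3, -⟩ := ht.resolve_left (by omega)
  rw [token_zero (by omega) q2, token_last hn (by omega) q3, hi]
  simp only [CycOcc, Forward, Token, h0, h1, one_ne_zero, ne_eq, not_true, not_false_iff, true_and,
    false_and, false_or, or_false, and_true, lt_irrefl, Nat.zero_mod, zero_ne_one,
    Bool.false_eq_true]
  generalize t.centre = r' at *
  have c0 : n % 4 = 0 ∨ n % 4 = 2 := by omega
  have c' : r' % 4 = 1 ∨ r' % 4 = 3 := by omega
  clear ht hi h1 h0
  rcases c0 with c0 | c0 <;> rcases c' with c' | c' <;>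
    (constructor <;> simp [c0, c'])

theorem balAt_zero (hn : n % 2 = 0) (h3 : 4 ≤ n) (hs : IsGadgetState n d s)
    (ht : IsGadgetState n d t)
    (h0 : s.level = 0) (h1 : t.level = 1) {i : Bool} (hi : i = true ↔ n % 4 = 0) (j : ℕ)
      (hj : j < n) :
    BalAt n s t false i j := by
  have hf := flow_iff_of_core (n := n) (s := s) (t := t) (by omega) (by omega)
  have hf' := flow_iff_of_core (n := n) (s := t) (t := s) (by omega) (by omega)
  rcases Nat.mod_two_eq_zero_or_one j with h | h
  · rcases Nat.eq_zero_or_pos j with rfl | h0'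
    · exact balAt_u hn (by omega) (fun j' _ => hf j') (fun j' _ => hf' j')
        (balU_zero hn ht h0 h1 hi)
    · exact balAt_white hn hs.odd ht.odd h h0' hj (fun j' _ _ _ => hf j') (fun j' _ _ _ => hf' j')
  · refine balAt_red hs.odd ht.odd h hj (fun j' _ => hf j') (fun j' _ => hf' j')
      (leafOut_core hs ht (by omega) (by omega)) ?_
    rw [leafOut_core ht hs (by omega) (by omega), ne_comm]

/-! ### Balance when a guard may be parked or released -/

theorem flow_iff_of_top (h2 : n % 4 = 2) (h : s.level = 2 ∨ t.level = 2)
    (h' : ¬ (s.level = 2 ∧ t.level = 1 ∧ s.centre = t.centre)) (j : ℕ) :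
    Flow n s t j ↔ Forward s t ∧ ((j + 1 ≠ n ∧ ((j % 2 = 0 ∧ Token s j ∧ ¬ Token t j) ∨
      (j % 2 = 1 ∧ ¬ Token s (j + 1) ∧ Token t (j + 1)))) ∨
      (j + 1 = n ∧ Token s n ∧ ¬ Token t n)) := by
  unfold Flow
  have h3 : ¬ (n % 4 = 2 ∧ j + 1 = n ∧ s.level = 2 ∧ t.level = 1 ∧ s.centre = t.centre ∧
    s.centre % 4 = 3) :=
    fun h1 => h' ⟨h1.2.2.1, h1.2.2.2.1, h1.2.2.2.2.1⟩
  have h4 : ¬ (n % 4 = 0 ∧ j = 0 ∧ s.level = 1 ∧ t.level = 2) := by omega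
  rw [eq_false h3, eq_false h4]
  by_cases hj : j + 1 = n
  · simp only [h2, h, hj, true_and, not_true, false_and, false_or, or_false, ne_eq]
  · simp only [h2, h, hj, true_and, false_and, not_false_iff, or_false, ne_eq]

theorem bal_red_top {f₁ f₂ f₃ f₄ l₁ l₂ A A' : Prop} (hs : HasOddCentre s) (ht : HasOddCentre t)
    {j : ℕ} (hj : j % 2 = 1)
    (h1 : f₁ ↔ Forward s t ∧ Token s (j - 1) ∧ ¬ Token t (j - 1))
    (h2 : f₂ ↔ Forward t s ∧ Token t (j + 1) ∧ ¬ Token s (j + 1))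
    (h3 : f₃ ↔ Forward s t ∧ Token s (j + 1) ∧ ¬ Token t (j + 1))
    (h4 : f₄ ↔ Forward t s ∧ Token t (j - 1) ∧ ¬ Token s (j - 1))
    (h5 : l₁ ↔ (IsCentre s j ∧ ¬ (IsCentre t j ∧ s.leaf = t.leaf) ∧
      ¬ (Token t (j + 1) ∧ s.leaf = 0)) ∨
      (Token s (j + 1) ∧ ¬ Token t (j + 1) ∧ ¬ (IsCentre t j ∧ t.leaf = 0)))
    (h6 : l₂ ↔ (IsCentre t j ∧ ¬ (IsCentre s j ∧ s.leaf = t.leaf) ∧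
      ¬ (Token s (j + 1) ∧ t.leaf = 0)) ∨
      (Token t (j + 1) ∧ ¬ Token s (j + 1) ∧ ¬ (IsCentre s j ∧ s.leaf = 0)))
    (hA : A) (hA' : A') : Bal f₁ f₂ l₁ f₃ f₄ l₂ A A' := by
  have := token_centre_facts hs ht hj
  constructor <;> grind
end

section
variable {n : ℕ} {d : ℕ → ℕ} {s t : GadgetState}

/-- For `n % 4 = 2`: the states of level `2`, and those of lower level from which level `2` can be
reached by a change of the centre. In all of them the token at `n` marks the parked guard. -/
def IsTopCompatible (n : ℕ) (s : GadgetState) : Prop :=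
  (s.level = 0 ∧ s.centre = 0) ∨ (s.level = 1 ∧ s.centre = n + 1) ∨
  (s.level = 2 ∧ s.centre % 2 = 1 ∧ -1 ≤ s.centre ∧ s.centre < n)

theorem IsTopCompatible.odd (h2 : n % 4 = 2) (h : IsTopCompatible n s) : HasOddCentre s := by
  unfold IsTopCompatible HasOddCentre at *; omega

theorem IsTopCompatible.token_last (h2 : n % 4 = 2) (h : IsTopCompatible n s) :
    Token s n ↔ s.level = 2 ∧ s.centre % 4 = 3 := by
  simp only [Token, IsTopCompatible] at *; omega

theorem leafOcc_top (h2 : n % 4 = 2) (h : IsTopCompatible n s) {j b : ℕ} :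
    LeafOcc n s j b ↔ (IsCentre s j ∧ b = s.leaf) ∨ (j + 1 = n ∧ Token s n ∧ b = 0) := by
  rw [h.token_last h2]
  unfold LeafOcc IsCentre
  have : ¬ n % 4 = 0 := by omega
  simp only [h2, true_and]
  tauto

theorem leafOut_top_ne (h2 : n % 4 = 2) (hs : IsTopCompatible n s) (ht : IsTopCompatible n t)
    {j : ℕ} (hj : 0 < j) (hjn : j + 1 ≠ n) :
    (∃ b, LeafOut n s t j b) ↔ IsCentre s j ∧ (¬ IsCentre t j ∨ s.leaf ≠ t.leaf) := by
  simp only [LeafOut, leafOcc_top h2 hs, leafOcc_top h2 ht, hjn, false_and, or_false]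
  constructor
  · rintro ⟨b, h1, ⟨h2, rfl⟩, h4⟩
    exact ⟨h2, by tauto⟩
  · rintro ⟨h2, h4⟩
    exact ⟨s.leaf, hj, ⟨h2, rfl⟩, by tauto⟩

theorem leafOut_top (h2 : n % 4 = 2) (hs : IsTopCompatible n s) (ht : IsTopCompatible n t) {j : ℕ}
    (hj : 0 < j) (hjn : j + 1 = n) :
    (∃ b, LeafOut n s t j b) ↔ (IsCentre s j ∧ ¬ (IsCentre t j ∧ s.leaf = t.leaf) ∧
      ¬ (Token t (j + 1) ∧ s.leaf = 0)) ∨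
      (Token s (j + 1) ∧ ¬ Token t (j + 1) ∧ ¬ (IsCentre t j ∧ t.leaf = 0)) := by
  simp only [LeafOut, leafOcc_top h2 hs, leafOcc_top h2 ht, hjn, true_and]
  constructor
  · rintro ⟨b, -, h | h, h'⟩
    · obtain ⟨h, rfl⟩ := h
      exact Or.inl ⟨h, fun h1 => h' (Or.inl h1), fun h1 => h' (Or.inr h1)⟩
    · obtain ⟨h, rfl⟩ := h
      exact Or.inr ⟨h, fun h1 => h' (Or.inr ⟨h1, rfl⟩), fun h1 => h' (Or.inl ⟨h1.1, h1.2.symm⟩)⟩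
  · rintro (⟨h, h1, h2⟩ | ⟨h, h1, h2⟩)
    · exact ⟨_, hj, Or.inl ⟨h, rfl⟩, fun h3 => h3.elim h1 h2⟩
    · exact ⟨0, hj, Or.inr ⟨h, rfl⟩, fun h3 => h3.elim (fun h => h2 ⟨h.1, h.2.symm⟩)
        (fun h => h1 h.1)⟩

theorem balAt_top (h2 : n % 4 = 2) (h4 : 4 ≤ n) (hs : IsTopCompatible n s)
    (ht : IsTopCompatible n t)
    (hl : s.level = 2 ∨ t.level = 2)
    (h' : ¬ (s.level = 2 ∧ t.level = 1 ∧ s.centre = t.centre))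
    (h'' : ¬ (t.level = 2 ∧ s.level = 1 ∧ t.centre = s.centre)) {o i : Bool}
    (hu : BalU (Forward s t ∧ Token s n ∧ ¬ Token t n) (Forward t s ∧ Token t 0 ∧ ¬ Token s 0)
      (Forward s t ∧ Token s 0 ∧ ¬ Token t 0) (Forward t s ∧ Token t n ∧ ¬ Token s n)
      (CycOcc n s 0 ∧ ¬ o = true) (CycOcc n t 0 ∧ ¬ i = true))
    (j : ℕ) (hj : j < n) : BalAt n s t o i j := by
  have hf := flow_iff_of_top h2 hl h'
  have hf' := flow_iff_of_top h2 hl.symm h''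
  have os := hs.odd h2
  have ot := ht.odd h2
  rcases Nat.mod_two_eq_zero_or_one j with h | h
  · rcases Nat.eq_zero_or_pos j with rfl | h0
    · have hpr : predIdx n 0 = n - 1 := by simp [predIdx]
      have e : n - 1 + 1 = n := by omega
      have e' : ¬ 0 + 1 = n := by omega
      have hl : ∀ (s t : GadgetState), ¬ ∃ b, LeafOut n s t 0 b := by
        rintro s t ⟨b, hb⟩; exact absurd hb.1 (by simp)
      have hO : ∀ (s : GadgetState) (o : Bool), OccExcept n s o (0, 0) ↔ CycOcc n s 0 ∧
        ¬ o = true := by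
        intro s o
        have : 0 < n := by omega
        simp [OccExcept, occ_cyc, this]
      unfold BalAt
      rw [hO, hO]
      refine hu.bal ?_ ?_ ?_ ?_ (hl s t) (hl t s)
      · rw [hf, hpr, e]; simp
      · rw [hf']; simp [e']
      · rw [hf]; simp [e']
      · rw [hf', hpr, e]; simp
    · exact balAt_white (by omega) os ot h h0 hj
        (fun j' _ h1 _ => by
          rw [hf]
          simp only [h1, ne_eq, not_false_iff, true_and, false_and, or_false])
        (fun j' _ h1 _ => by
          rw [hf']
          simp only [h1, ne_eq, not_false_iff, true_and, false_and, or_false])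
  · by_cases hjn : j + 1 = n
    · have hpr : predIdx n j = j - 1 := by unfold predIdx; rw [if_neg (by omega)]
      have e : ¬ j - 1 + 1 = n := by omega
      have e1 : (j - 1) % 2 = 0 := by omega
      unfold BalAt
      rw [hpr]
      apply bal_red_top os ot h
      · rw [hf]; simp [e, e1]
      · rw [hf', hjn]; simp
      · rw [hf, hjn]; simp
      · rw [hf']; simp [e, e1]
      · exact leafOut_top h2 hs ht (by omega) hjn
      · rw [leafOut_top h2 ht hs (by omega) hjn, eq_comm]
      · rw [occExcept_pos (by omega) hj]; exact cycOcc_odd h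
      · rw [occExcept_pos (by omega) hj]; exact cycOcc_odd h
    · refine balAt_red os ot h hj ?_ ?_ (leafOut_top_ne h2 hs ht (by omega) hjn) ?_
      · intro j' hj'
        have : j' + 1 ≠ n := by omega
        rw [hf]; simp only [this, ne_eq, not_false_iff, true_and, false_and, or_false]
      · intro j' hj'
        have : j' + 1 ≠ n := by omega
        rw [hf']; simp only [this, ne_eq, not_false_iff, true_and, false_and, or_false]
      · rw [leafOut_top_ne h2 ht hs (by omega) hjn, ne_comm]

theorem balU_top (h2 : n % 4 = 2) (hs : IsTopCompatible n s) (ht : IsTopCompatible n t)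
    (h1 : s.level = 2) (h1' : t.level = 2) :
    BalU (Forward s t ∧ Token s n ∧ ¬ Token t n) (Forward t s ∧ Token t 0 ∧ ¬ Token s 0)
      (Forward s t ∧ Token s 0 ∧ ¬ Token t 0) (Forward t s ∧ Token t n ∧ ¬ Token s n)
      (CycOcc n s 0 ∧ ¬ false = true) (CycOcc n t 0 ∧ ¬ false = true) := by
  rw [hs.token_last h2, ht.token_last h2]
  obtain ⟨-, p1, p2, p3⟩ := (hs.resolve_left (by omega)).resolve_left (by omega)
  obtain ⟨-, q1, q2, q3⟩ := (ht.resolve_left (by omega)).resolve_left (by omega)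
  rw [token_zero (by omega) p2, token_zero (by omega) q2, forward_iff (by omega) (by omega),
    forward_iff (by omega) (by omega)]
  simp only [CycOcc, h1, h1', ne_eq, not_false_iff, true_and, false_and, false_or, or_false,
    and_true, lt_irrefl, Nat.zero_mod, zero_ne_one, Bool.false_eq_true]
  generalize s.centre = r at *
  generalize t.centre = r' at *
  have c : r % 4 = 1 ∨ r % 4 = 3 := by omega
  have c' : r' % 4 = 1 ∨ r' % 4 = 3 := by omega
  clear hs ht h1 h1'
  rcases c with c | c <;> rcases c' with c' | c' <;>
    (constructor <;> simp [c, c'] <;> intros <;> omega)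

theorem balU_zero_top (h2 : n % 4 = 2) (hs : IsTopCompatible n s) (ht : IsTopCompatible n t)
    (h1 : s.level = 0 ∨ s.level = 1 ∧ t.centre = 1) (h1' : t.level = 2) :
    BalU (Forward s t ∧ Token s n ∧ ¬ Token t n) (Forward t s ∧ Token t 0 ∧ ¬ Token s 0)
      (Forward s t ∧ Token s 0 ∧ ¬ Token t 0) (Forward t s ∧ Token t n ∧ ¬ Token s n)
      (CycOcc n s 0 ∧ ¬ false = true) (CycOcc n t 0 ∧ ¬ true = true) := by
  rw [hs.token_last h2, ht.token_last h2]
  obtain ⟨-, q1, q2, q3⟩ := (ht.resolve_left (by omega)).resolve_left (by omega)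
  rw [token_zero (by omega) q2]
  rcases h1 with h1 | ⟨h1, h3⟩
  · simp only [CycOcc, Forward, Token, h1, h1', ne_eq, not_true, not_false_iff, true_and, false_and,
      false_or, or_false, and_true, lt_irrefl, Nat.zero_mod, zero_ne_one, Bool.false_eq_true]
    generalize t.centre = r' at *
    have c' : r' % 4 = 1 ∨ r' % 4 = 3 := by omega
    clear hs ht h1 h1'
    rcases c' with c' | c' <;>
      (constructor <;> simp [c'])
  · obtain ⟨-, p⟩ := (hs.resolve_left (by omega)).resolve_right (by omega)
    have d1 : Forward s t := by rw [forward_iff (by omega) (by omega)]; omega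
    have d2 := d1.asymm
    have d3 : Token s 0 := by rw [token_zero (by omega) (by omega)]; omega
    have d4 : CycOcc n s 0 := by unfold CycOcc; omega
    constructor <;> simp [d1, d2, d3, h1, h3, d4]

theorem balAt_up_top (h2 : n % 4 = 2) (h4 : 4 ≤ n) (hs : IsGadgetState n d s)
    (h1 : s.level = 1) (h1' : t.level = 2) (hc : s.centre = t.centre) (hl : s.leaf = t.leaf) (j : ℕ)
      (hj : j < n) :
    BalAt n s t false true j := by
  have hd : ¬ Forward s t := by rw [forward_iff (by omega) (by omega)]; omega
  have hd' : ¬ Forward t s := by rw [forward_iff (by omega) (by omega)]; omega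
  have hT := token_congr (s := s) (t := t) hc (by omega)
  obtain ⟨-, q1, q2, -, q3, -⟩ := hs.resolve_left (by omega)
  have hf : ∀ j, ¬ Flow n s t j := by
    intro j; unfold Flow; rw [eq_false hd]; simp only [false_and, and_false, false_or]; omega
  have hf' : ∀ j, Flow n t s j ↔ j + 1 = n ∧ t.centre % 4 = 3 := by
    intro j; unfold Flow; rw [eq_false hd']; simp only [false_and, and_false, false_or]; omega
  have hl1 : ∀ j, ¬ ∃ b, LeafOut n s t j b := by
    rintro j ⟨b, h1, h2, h3⟩; unfold LeafOcc at *; omega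
  have hl2 : ∀ j, 0 < j → ((∃ b, LeafOut n t s j b) ↔ j + 1 = n ∧ t.centre % 4 = 3) := by
    intro j hj
    constructor
    · rintro ⟨b, h1, h2, h3⟩; unfold LeafOcc at *; omega
    · intro h; exact ⟨0, hj, by unfold LeafOcc; omega, by unfold LeafOcc; omega⟩
  have hl3 : ¬ ∃ b, LeafOut n t s 0 b := by
    rintro ⟨b, hb⟩; exact absurd hb.1 (by simp)
  unfold BalAt
  simp only [hf, hf', eq_false (hl1 j)]
  rcases Nat.eq_zero_or_pos j with rfl | h0
  · have hO : ∀ (s : GadgetState) (o : Bool), OccExcept n s o (0, 0) ↔ CycOcc n s 0 ∧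
      ¬ o = true := by
      intro s o
      have : 0 < n := by omega
      simp [OccExcept, occ_cyc, this]
    have e : ¬ 0 + 1 = n := by omega
    have e' : n - 1 + 1 = n := by omega
    have e2 : CycOcc n s 0 ↔ t.centre % 4 = 3 := by unfold CycOcc; omega
    simp only [eq_false hl3, hO, predIdx, e, e2]
    constructor <;> simp [e']
  · have e1 : ¬ predIdx n j + 1 = n := by unfold predIdx; split_ifs <;> omega
    rw [hl2 j h0, occExcept_pos h0 hj, occExcept_pos h0 hj]
    rcases Nat.mod_two_eq_zero_or_one j with h | h
    · rw [cycOcc_even h h0, cycOcc_even h h0, hT]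
      have e2 : ¬ j + 1 = n := by omega
      constructor <;> simp [e1, e2]
    · rw [eq_true (cycOcc_odd h), eq_true (cycOcc_odd h)]
      constructor <;> simp [e1]

/-- For `n % 4 = 0`, the guard that comes to the connecting vertex sends its guard to vertex `1`,
whose guard goes on to a leaf. -/
theorem balAt_up_zero (h2 : n % 4 = 0) (h4 : 4 ≤ n) (ht : IsGadgetState n d t)
    (h1 : s.level = 1) (h1' : t.level = 2) (hc : s.centre = t.centre)
    (hl : s.leaf = t.leaf ∨ s.centre = 1 ∧ s.leaf = 0) (j : ℕ) (hj : j < n) :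
    BalAt n s t false true j := by
  have hd : ¬ Forward s t := by rw [forward_iff (by omega) (by omega)]; omega
  have hd' : ¬ Forward t s := by rw [forward_iff (by omega) (by omega)]; omega
  have hT := token_congr (s := s) (t := t) hc (by omega)
  have ht' : ¬ (t.centre = 1 ∧ t.leaf = 0) := by
    obtain ⟨-, -, -, -, -, -, h'⟩ := ht.resolve_left (by omega)
    exact ((h' h1').resolve_left (fun h => by omega)).2
  have hf : ∀ j, Flow n s t j ↔ j = 0 := by
    intro j; unfold Flow; rw [eq_false hd]; simp only [false_and, and_false, false_or]; omega
  have hf' : ∀ j, ¬ Flow n t s j := by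
    intro j; unfold Flow; rw [eq_false hd']; simp only [false_and, and_false, false_or]; omega
  have hl1 : ∀ j, ¬ ∃ b, LeafOut n s t j b := by
    rintro j ⟨b, h1, h2, h3⟩; unfold LeafOcc at *; omega
  have hl2 : ∀ j, ((∃ b, LeafOut n t s j b) ↔ j = 1) := by
    intro j
    constructor
    · rintro ⟨b, h1, h2, h3⟩; unfold LeafOcc at *; omega
    · rintro rfl
      by_cases h : s.centre = 1 ∧ s.leaf = 0
      · exact ⟨t.leaf, by simp, by unfold LeafOcc; omega, by unfold LeafOcc; omega⟩
      · exact ⟨0, by simp, by unfold LeafOcc; omega, by unfold LeafOcc; omega⟩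
  unfold BalAt
  simp only [hf, hf', eq_false (hl1 j), hl2]
  rcases Nat.eq_zero_or_pos j with rfl | h0
  · have hO : ∀ (s : GadgetState) (o : Bool), OccExcept n s o (0, 0) ↔ CycOcc n s 0 ∧
      ¬ o = true := by
      intro s o
      have : 0 < n := by omega
      simp [OccExcept, occ_cyc, this]
    have e' : ¬ n - 1 = 0 := by omega
    have e2 : CycOcc n s 0 := by unfold CycOcc; omega
    simp only [hO, predIdx, e2]
    constructor <;> simp [e']
  · rw [occExcept_pos h0 hj, occExcept_pos h0 hj]
    have e2 : ¬ j = 0 := by omega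
    have e1 : predIdx n j = 0 ↔ j = 1 := by unfold predIdx; rw [if_neg e2]; omega
    rcases Nat.mod_two_eq_zero_or_one j with h | h
    · rw [cycOcc_even h h0, cycOcc_even h h0, hT]
      have e3 : ¬ j = 1 := by omega
      constructor <;> simp [e1, e2, e3]
    · rw [eq_true (cycOcc_odd h), eq_true (cycOcc_odd h)]
      constructor <;> simp [e1, e2]
end

/-! ### Transitions between gadget states -/

/-- The transitions during which the given strategy moves a guard into the connecting vertex from
outside the star and none back. The centre is kept between the levels `1` and `2`, except that there
is no centre `n + 1` on level `2` for `n % 4 = 2`. -/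
def UpRel (n : ℕ) (s t : GadgetState) : Prop :=
  (s.level = 0 ∧ ((n % 4 = 0 ∧ t.level = 1) ∨ (n % 4 = 2 ∧ t.level = 2))) ∨
  (s.level = 1 ∧ t.level = 2 ∧
    ((n % 4 = 0 ∧ s.centre = t.centre ∧ (s.leaf = t.leaf ∨ s.centre = 1 ∧ s.leaf = 0)) ∨
     (n % 4 = 2 ∧ (s.centre = t.centre ∧ s.leaf = t.leaf ∨ s.centre = n + 1 ∧ t.centre = 1))))

/-- The transitions between gadget states when the given strategy moves a guard out of the
connecting vertex (first flag) and into it (second flag), from and to the outside of the star. -/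
def FlagRel (n : ℕ) : Bool → Bool → GadgetState → GadgetState → Prop
  | false, false, s, t => s.level = t.level ∨ (n % 4 = 2 ∧ s.level + t.level = 1)
  | false, true, s, t => UpRel n s t
  | true, false, s, t => UpRel n t s
  | true, true, s, t => s = t ∧ (s.level ≠ 1 ∨ n % 4 = 0)

/-- The pairs of valid states joined by a transition with the given flags. -/
def Rel (n : ℕ) (d : ℕ → ℕ) (o i : Bool) (s t : GadgetState) : Prop :=
  IsGadgetState n d s ∧ IsGadgetState n d t ∧ FlagRel n o i s t

section
variable {n : ℕ} {d : ℕ → ℕ} {s t : GadgetState}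

theorem Rel.symm {o i : Bool} (h : Rel n d o i s t) : Rel n d i o t s := by
  obtain ⟨h1, h2, h3⟩ := h
  refine ⟨h2, h1, ?_⟩
  cases o <;> cases i <;> simp only [FlagRel] at *
  · omega
  · exact h3
  · exact h3
  · exact ⟨h3.1.symm, h3.1 ▸ h3.2⟩

theorem IsGadgetState.isTopCompatible (h2 : n % 4 = 2) (h : IsGadgetState n d s)
    (h' : s.level = 1 → s.centre = n + 1) : IsTopCompatible n s := by
  rcases h with h | ⟨h1, h3, h4, h5, h6, h7, h8⟩
  · exact Or.inl ⟨h.1, h.2.1⟩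
  · unfold IsTopCompatible
    have e : ¬ n % 4 = 0 := by omega
    simp only [h2, true_and] at h8
    omega

theorem eq_of_level_zero (hs : IsGadgetState n d s) (ht : IsGadgetState n d t) (h : s.level = 0)
    (h' : t.level = 0) : s = t := by
  have h1 := hs.resolve_right (by omega)
  have h2 := ht.resolve_right (by omega)
  cases s; cases t; simp_all

theorem not_flow_self (j : ℕ) : ¬ Flow n s s j := by
  have : ¬ Forward s s := fun h => h.asymm h
  unfold Flow; simp only [this, false_and, and_false, false_or]; omega

theorem balAt_self {o : Bool} (j : ℕ) : BalAt n s s o o j := by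
  have h : ∀ j, ¬ ∃ b, LeafOut n s s j b := by rintro j ⟨b, -, h, h'⟩; exact h' h
  unfold BalAt
  simp only [eq_false (not_flow_self _), eq_false (h j)]
  constructor <;> simp

theorem BalAt.of_symm {o i : Bool} (h : ∀ j < n, BalAt n s t o i j) : ∀ j < n, BalAt n t s i o j :=
  fun j hj => (h j hj).symm

theorem balAt_of_upRel (hn : n % 2 = 0) (h4 : 4 ≤ n) (hs : IsGadgetState n d s)
    (ht : IsGadgetState n d t) (h : UpRel n s t) :
    ∀ j < n, BalAt n s t false true j := by
  rcases h with ⟨h0, ⟨h1, h2⟩ | ⟨h1, h2⟩⟩ | ⟨h0, h1, ⟨h2, h3, h5⟩ | ⟨h2, h3⟩⟩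
  · exact balAt_zero hn h4 hs ht h0 h2 (by simp [h1])
  · have e1 := hs.isTopCompatible h1 (by omega)
    have e2 := ht.isTopCompatible h1 (by omega)
    exact balAt_top h1 h4 e1 e2 (Or.inr h2) (by omega) (by omega)
      (balU_zero_top h1 e1 e2 (Or.inl h0) h2)
  · exact balAt_up_zero h2 h4 ht h0 h1 h3 h5
  · rcases h3 with h3 | h3
    · exact balAt_up_top h2 h4 hs h0 h1 h3.1 h3.2
    · have e1 := hs.isTopCompatible h2 (by omega)
      have e2 := ht.isTopCompatible h2 (by omega)
      exact balAt_top h2 h4 e1 e2 (Or.inr h1) (by omega) (by omega)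
        (balU_zero_top h2 e1 e2 (Or.inr ⟨h0, h3.2⟩) h1)

theorem balAt_of_rel (hn : n % 2 = 0) (h4 : 4 ≤ n) {o i : Bool} (h : Rel n d o i s t) :
    ∀ j < n, BalAt n s t o i j := by
  obtain ⟨hs, ht, h⟩ := h
  cases o <;> cases i <;> simp only [FlagRel] at h
  · rcases h with h | ⟨h, h'⟩
    · by_cases h0 : s.level = 0
      · rw [eq_of_level_zero hs ht h0 (by omega)]
        exact fun j _ => balAt_self j
      · by_cases h1 : n % 4 = 2 ∧ s.level = 2
        · have e1 := hs.isTopCompatible h1.1 (by omega)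
          have e2 := ht.isTopCompatible h1.1 (by omega)
          exact balAt_top h1.1 h4 e1 e2 (by omega) (by omega) (by omega)
            (balU_top h1.1 e1 e2 h1.2 (by omega))
        · refine balAt_core hn h4 hs ht ?_
          have := hs.resolve_left (by omega)
          omega
    · by_cases h0 : s.level = 0
      · exact balAt_zero hn h4 hs ht h0 (by omega) (by simp; omega)
      · exact BalAt.of_symm (balAt_zero hn h4 ht hs (by omega) (by omega) (by simp; omega))
  · exact balAt_of_upRel hn h4 hs ht h
  · exact BalAt.of_symm (balAt_of_upRel hn h4 ht hs h)
  · rw [h.1]; exact fun j _ => balAt_self j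

theorem leafOut_unique (hn : n % 2 = 0) (hs : IsGadgetState n d s) (ht : IsGadgetState n d t)
    {o i : Bool} (h : FlagRel n o i s t) (j b b' : ℕ)
    (h1 : LeafOut n s t j b) (h2 : LeafOut n s t j b') : b = b' := by
  obtain ⟨a0, a1, a2⟩ := h1
  obtain ⟨-, b1, b2⟩ := h2
  have hst : s ≠ t := by rintro rfl; exact a2 a1
  rcases a1 with a1 | a1 <;> rcases b1 with b1 | b1
  · omega
  · exfalso
    rcases b1 with ⟨c1, c2, ⟨c3, c4, c5⟩ | ⟨c3, c4⟩⟩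
    · omega
    · have hs' : ¬ (s.centre = 1 ∧ s.leaf = 0) := by
        obtain ⟨-, -, -, -, -, -, h'⟩ := hs.resolve_left (by omega)
        exact ((h' c1).resolve_left (fun h => by omega)).2
      unfold LeafOcc at a2 b2
      cases o <;> cases i <;> simp only [FlagRel, UpRel, hst, false_and] at h <;> omega
  · exfalso
    rcases a1 with ⟨c1, c2, ⟨c3, c4, c5⟩ | ⟨c3, c4⟩⟩
    · omega
    · have hs' : ¬ (s.centre = 1 ∧ s.leaf = 0) := by
        obtain ⟨-, -, -, -, -, -, h'⟩ := hs.resolve_left (by omega)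
        exact ((h' c1).resolve_left (fun h => by omega)).2
      unfold LeafOcc at a2 b2
      cases o <;> cases i <;> simp only [FlagRel, UpRel, hst, false_and] at h <;> omega
  · omega

theorem isShift_of_rel (hn : n % 2 = 0) (h4 : 4 ≤ n) {o i : Bool} (h : Rel n d o i s t) :
    IsShift (OccExcept n s o) (OccExcept n t i) (CycleMove n s t) :=
  isShift_of_bal (by omega) (balAt_of_rel hn h4 h)
    (leafOut_unique hn h.2.1 h.1 h.symm.2.2) (leafOut_unique hn h.1 h.2.1 h.2.2)

theorem flagged_occ {o i : Bool} (h : Rel n d o i s t) (h4 : 4 ≤ n) (hn : n % 2 = 0)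
    (ho : o = true) : Occ n s (0, 0) := by
  rw [occ_cyc]
  refine ⟨by omega, ?_⟩
  obtain ⟨hs, ht, h⟩ := h
  unfold CycOcc
  cases ho
  cases i <;> simp only [FlagRel, UpRel] at h
  · omega
  · omega

theorem occ_leaf_valid (hd : ∀ j, j % 2 = 1 → 2 ≤ d j) (hn : n % 2 = 0) (hs : IsGadgetState n d s)
    {j b : ℕ}
    (h : Occ n s (j, b + 1)) : j % 2 = 1 ∧ j < n ∧ b < d j := by
  obtain ⟨h0, h1, h2⟩ := occ_leaf.1 h
  have h3 := leafOcc_odd hs.odd hn h2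
  refine ⟨h3, h1, ?_⟩
  rcases h2 with ⟨h2, h4, rfl⟩ | ⟨h2, rfl, -⟩
  · obtain ⟨-, -, -, -, h5, -⟩ := hs.resolve_left (by omega)
    have := h5 (by omega) (by omega)
    rwa [show s.centre.toNat = j by omega] at this
  · have := hd j h3; omega

/-! ### The direction in which an edge can be traversed -/

/-- `Side n s j`: in state `s` the edge `j` may only be traversed towards the smaller index. -/
def Side (n : ℕ) (s : GadgetState) (j : ℕ) : Prop :=
  (j = 0 ∧ s.level ≠ 0 ∧ s.centre % 4 = 1) ∨
  (0 < j ∧ j % 2 = 0 ∧ ¬ Token s j) ∨ (j % 2 = 1 ∧ j + 1 ≠ n ∧ Token s (j + 1)) ∨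
  (j + 1 = n ∧ (s.level = 0 ∨ (s.level = 1 ∧ (s.centre + n) % 4 = 1) ∨
    (s.level = 2 ∧ s.centre % 4 = 1)))

theorem FlagRel.centre_eq {o i : Bool} (h : FlagRel n o i s t) (h2 : n % 4 = 2) (hs : s.level = 1)
    (ht : t.level = 2) :
    s.centre = t.centre ∨ s.centre = n + 1 ∧ t.centre = 1 := by
  have hst : s ≠ t := by rintro rfl; omega
  cases o <;> cases i <;> simp only [FlagRel, UpRel, hst, false_and] at h <;> omega

theorem FlagRel.symm {o i : Bool} (h : FlagRel n o i s t) : FlagRel n i o t s := by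
  cases o <;> cases i <;> simp only [FlagRel] at *
  · omega
  · exact h
  · exact h
  · exact ⟨h.1.symm, h.1 ▸ h.2⟩

/-- As `Side` separates the states before and after a passage of the edge `j`, no state allows
passages of it in both directions. -/
theorem Flow.side (hn : n % 2 = 0) (h4 : 4 ≤ n) {o i : Bool} (h : Rel n d o i s t)
    (h0 : n % 4 = 0 → s.level ≠ 2 ∧ t.level ≠ 2) {j : ℕ} (hj : j < n) (hf : Flow n s t j) :
    ¬ Side n s j ∧ Side n t j := by
  obtain ⟨hs, ht, h⟩ := h
  have hl : s.level ≤ 2 ∧ t.level ≤ 2 := by unfold IsGadgetState at hs ht; omega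
  have os := hs.odd
  have ot := ht.odd
  have bs : s.level ≠ 0 → -1 ≤ s.centre ∧ s.centre ≤ n + 1 := by
    intro h; obtain ⟨-, -, h1, h2, -⟩ := hs.resolve_left (by omega); exact ⟨h1, h2⟩
  have bt : t.level ≠ 0 → -1 ≤ t.centre ∧ t.centre ≤ n + 1 := by
    intro h; obtain ⟨-, -, h1, h2, -⟩ := ht.resolve_left (by omega); exact ⟨h1, h2⟩
  have ct : t.level = 2 → n % 4 = 2 → t.centre < n := by
    intro h h'; obtain ⟨-, -, -, -, -, -, h2⟩ := ht.resolve_left (by omega)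
    exact ((h2 h).resolve_right (by omega)).2
  clear hs ht
  by_cases hj1 : j + 1 = n
  · have e0 : ¬ j = 0 := by omega
    have e1 : ¬ j % 2 = 0 := by omega
    have e2 : j % 2 = 1 := by omega
    simp only [Side, e0, e1, hj1, ne_eq, not_true, false_and, and_false, false_or, true_and]
    unfold Flow at hf
    simp only [hj1, true_and, e2, one_ne_zero, false_and, false_or, e0, and_false, or_false] at hf
    rcases hf with ⟨f1, f2, f3, f4⟩ | ⟨f1, f2, f3, f4, f5⟩ | ⟨f1, f2, f3, f4, f5⟩
    · have hls : s.level = 0 ∨ s.level = 1 := by omega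
      have hlt : t.level = 0 ∨ t.level = 1 := by omega
      clear h
      rcases hls with ls | ls <;> rcases hlt with lt | lt
      · simp only [Forward, ls, lt, ne_eq, not_true, false_and, false_or, and_false] at f2
      · rw [token_last hn (by omega) (bt (by omega)).2] at f4
        simp only [Token, ls, ne_eq, not_true, true_and, false_and, or_false] at f3
        have := bt (by omega)
        simp only [Forward] at f2
        omega
      · rw [token_last hn (by omega) (bs (by omega)).2] at f3
        simp only [Token, lt, ne_eq, not_true, true_and, false_and, or_false] at f4
        have := bs (by omega)
        simp only [Forward] at f2
        omega
      · rw [token_last hn (by omega) (bs (by omega)).2] at f3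
        rw [token_last hn (by omega) (bt (by omega)).2] at f4
        rw [forward_iff (by omega) (by omega)] at f2
        have := bs (by omega)
        have := bt (by omega)
        unfold HasOddCentre at os ot
        omega
    · have hx1 := fun h1 h2 => h.centre_eq f1 h1 h2
      have hx2 := fun h1 h2 => h.symm.centre_eq f1 h1 h2
      clear h
      rcases Nat.eq_zero_or_pos s.level with ls | ls
      · simp only [Token, ls, ne_eq, not_true, true_and, false_and, or_false] at f4
        omega
      · rw [token_last hn (by omega) (bs (by omega)).2] at f4
        rcases Nat.eq_zero_or_pos t.level with lt | lt
        · omega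
        · rw [token_last hn (by omega) (bt (by omega)).2] at f5
          rw [forward_iff (by omega) (by omega)] at f3
          unfold HasOddCentre at os ot
          omega
    · omega
  · by_cases e0 : j = 0
    · subst e0
      simp only [Side, hj1, ne_eq, false_and, true_and, Nat.zero_mod, zero_ne_one, or_false,
        lt_irrefl]
      unfold Flow at hf
      simp only [hj1, true_and, false_and, and_false, false_or, Nat.zero_mod, zero_ne_one, or_false,
        not_false_iff] at hf
      rcases hf with ⟨f2, f3, f4⟩ | ⟨f1, f2, f3⟩
      · by_cases lt : t.level = 0
        · exact absurd (Or.inl ⟨lt, rfl⟩) f4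
        · rw [token_zero lt (bt lt).1] at f4
          by_cases ls : s.level = 0
          · simp only [Forward] at f2
            omega
          · rw [token_zero ls (bs ls).1] at f3
            rw [forward_iff ls lt] at f2
            have := bs ls
            unfold HasOddCentre at ot os
            omega
      · exact absurd f3 (h0 f1).2
    · unfold Flow at hf
      simp only [hj1, e0, false_and, and_false, or_false, not_false_iff, true_and] at hf
      simp only [Side, hj1, e0, ne_eq, false_and, false_or, or_false, not_false_iff, true_and]
      have h5 : 0 < j := by omega
      rcases hf.2 with ⟨f1, f2, f3⟩ | ⟨f1, f2, f3⟩
      · have f4 : ¬ j % 2 = 1 := by omega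
        simp [f1, f2, f3, h5]
      · have f4 : ¬ j % 2 = 0 := by omega
        simp [f1, f2, f3]
end

/-! ### Traversed edges, idle edges and occupied vertices -/

section
variable {n : ℕ} {d : ℕ → ℕ} {s t : GadgetState}

theorem isGadgetState_mk (hd : ∀ j, j % 2 = 1 → 2 ≤ d j) {l : ℕ} (hl : l = 1 ∨ l = 2) {r : ℤ}
    (hr : r % 2 = 1)
    (h1 : -1 ≤ r) (h2 : r ≤ n + 1) (h3 : l = 2 → (n % 4 = 2 ∧ r < n) ∨ (n % 4 = 0 ∧ r ≠ 1)) :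
    IsGadgetState n d ⟨l, r, 0⟩ := by
  refine Or.inr ⟨hl, hr, h1, h2, fun h h' => ?_, fun _ => rfl, fun h => ?_⟩
  · simp only at h h' ⊢
    have := hd r.toNat (by omega)
    omega
  · simp only; rcases h3 h with h | h
    · exact Or.inl h
    · exact Or.inr ⟨h.1, fun h' => h.2 h'.1⟩

theorem flow_even {l : ℕ} {r r' : ℤ} {j : ℕ} (hj : j % 2 = 0) (hn : n % 2 = 0)
    (hd : Forward ⟨l, r, 0⟩ ⟨l, r', 0⟩) (h1 : Token ⟨l, r, 0⟩ j)
      (h2 : ¬ Token ⟨l, r', 0⟩ j) : Flow n ⟨l, r, 0⟩ ⟨l, r', 0⟩ j :=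
  Or.inl ⟨by omega, hd, Or.inl ⟨hj, h1, h2⟩⟩

theorem flow_odd {l : ℕ} {r r' : ℤ} {j : ℕ} (hj : j % 2 = 1) (h : j + 1 ≠ n ∨ l = 1)
    (hd : Forward ⟨l, r, 0⟩ ⟨l, r', 0⟩) (h1 : ¬ Token ⟨l, r, 0⟩ (j + 1))
      (h2 : Token ⟨l, r', 0⟩ (j + 1)) : Flow n ⟨l, r, 0⟩ ⟨l, r', 0⟩ j :=
  Or.inl ⟨by simp only; omega, hd, Or.inr ⟨hj, h1, h2⟩⟩

theorem forward_mk {l : ℕ} (hl : l ≠ 0) {r r' : ℤ} (h : (r < r' ∧ (r' - r) % 4 = 0) ∨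
    (r' < r ∧ (r - r') % 4 = 2)) :
    Forward ⟨l, r, 0⟩ ⟨l, r', 0⟩ := Or.inr (Or.inr ⟨hl, hl, h⟩)

theorem token_mk {l : ℕ} (hl : l ≠ 0) {r : ℤ} {w : ℕ} :
    Token ⟨l, r, 0⟩ w ↔ ((w : ℤ) < r ∧ (r - w) % 4 = 3) ∨ (r < w ∧ ((w : ℤ) - r) % 4 = 3) := by
  simp [Token, hl]

/-- On each of the levels that occur, every edge of the cycle is traversed forwards by some
transition. -/
theorem exists_flow (hd : ∀ j, j % 2 = 1 → 2 ≤ d j) (hn : n % 2 = 0) (h4 : 4 ≤ n) {l : ℕ}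
    (hl : l = 1 ∨ (l = 2 ∧ n % 4 = 2)) {j : ℕ} (hj : j < n) :
    ∃ s t, IsGadgetState n d s ∧ IsGadgetState n d t ∧ s.level = l ∧ t.level = l ∧
      Flow n s t j := by
  have l0 : l ≠ 0 := by omega
  have key : ∃ r r' : ℤ, r % 2 = 1 ∧ r' % 2 = 1 ∧ -1 ≤ r ∧ -1 ≤ r' ∧
    (if l = 2 then r < n ∧ r' < n else r ≤ n + 1 ∧ r' ≤ n + 1) ∧
      Flow n ⟨l, r, 0⟩ ⟨l, r', 0⟩ j := by
    by_cases e0 : j = 0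
    · refine ⟨3, 1, by omega, by omega, by omega, by omega, by split_ifs <;> omega, ?_⟩
      apply flow_even (by omega) hn (forward_mk l0 (by omega)) <;> rw [token_mk l0] <;> omega
    · by_cases e1 : j + 1 = n
      · by_cases el : l = 2
        · refine ⟨3, 1, by omega, by omega, by omega, by omega, by split_ifs; omega, ?_⟩
          refine Or.inr (Or.inl ⟨by omega, e1, Or.inl el, forward_mk l0 (by omega), ?_, ?_⟩) <;>
            rw [token_mk l0] <;> omega
        · have l1 : l = 1 := by omega
          by_cases e2 : n % 4 = 0
          · refine ⟨3, 1, by omega, by omega, by omega, by omega, by split_ifs; omega, ?_⟩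
            apply flow_odd (by omega) (Or.inr l1) (forward_mk l0 (by omega)) <;>
              rw [token_mk l0] <;> omega
          · refine ⟨5, 3, by omega, by omega, by omega, by omega, by split_ifs; omega, ?_⟩
            apply flow_odd (by omega) (Or.inr l1) (forward_mk l0 (by omega)) <;>
              rw [token_mk l0] <;> omega
      · by_cases e2 : j % 2 = 0
        · by_cases e3 : j % 4 = 2
          · refine ⟨-1, j + 1, by omega, by omega, by omega, by omega, by split_ifs <;> omega, ?_⟩
            apply flow_even (by omega) hn (forward_mk l0 (by omega)) <;> rw [token_mk l0] <;> omega
          · refine ⟨1, j + 1, by omega, by omega, by omega, by omega, by split_ifs <;> omega, ?_⟩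
            apply flow_even (by omega) hn (forward_mk l0 (by omega)) <;> rw [token_mk l0] <;> omega
        · by_cases e3 : j % 4 = 1
          · refine ⟨j, -1, by omega, by omega, by omega, by omega, by split_ifs <;> omega, ?_⟩
            apply flow_odd (by omega) (Or.inl e1) (forward_mk l0 (by omega)) <;>
              rw [token_mk l0] <;> omega
          · refine ⟨j, 1, by omega, by omega, by omega, by omega, by split_ifs <;> omega, ?_⟩
            apply flow_odd (by omega) (Or.inl e1) (forward_mk l0 (by omega)) <;>
              rw [token_mk l0] <;> omega
  obtain ⟨r, r', h1, h2, h3, h5, h6, h7⟩ := key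
  refine ⟨_, _, isGadgetState_mk hd (by omega) h1 h3 ?_ ?_, isGadgetState_mk hd
    (by omega) h2 h5 ?_ ?_, rfl, rfl, h7⟩ <;> split_ifs at h6 <;> omega

/-- Each node of the gadget but the connecting vertex is occupied in some state of level `1` and in
some state of level `2`. -/
theorem exists_occ (hd : ∀ j, j % 2 = 1 → 2 ≤ d j) (hn : n % 2 = 0) (h4 : 4 ≤ n) {l : ℕ}
    (hl : l = 1 ∨ l = 2) {x : ℕ × ℕ} (hx : x.1 < n) (hx' : x.2 = 0 ∧ 0 < x.1 ∨ x.1 % 2 = 1 ∧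
      x.2 ≤ d x.1) :
    ∃ s, IsGadgetState n d s ∧ s.level = l ∧ Occ n s x := by
  have l0 : l ≠ 0 := by omega
  obtain ⟨j, b⟩ := x
  simp only at hx hx'
  have v1 : IsGadgetState n d ⟨l, -1, 0⟩ := isGadgetState_mk hd hl (by omega) (by omega) (by omega)
    (by omega)
  rcases b with _ | b
  · have h1 : 0 < j := by omega
    by_cases e : j % 4 = 0
    · have v2 : IsGadgetState n d ⟨l, 1, 1⟩ := by
        refine Or.inr ⟨hl, rfl, by simp, by simp, fun _ _ => hd 1 rfl, fun h => ?_, fun h => ?_⟩ <;>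
          simp only at h ⊢ <;> omega
      refine ⟨_, v2, rfl, occ_cyc.2 ⟨hx, Or.inr (Or.inr ⟨by omega, h1, ?_⟩)⟩⟩
      refine Or.inr ⟨l0, ?_⟩
      simp only; omega
    · refine ⟨_, v1, rfl, occ_cyc.2 ⟨hx, ?_⟩⟩
      by_cases e1 : j % 2 = 1
      · exact Or.inl e1
      · refine Or.inr (Or.inr ⟨by omega, h1, ?_⟩)
        rw [token_mk l0]; omega
  · have hx1 : j % 2 = 1 ∧ b < d j := by omega
    by_cases e : l = 2 ∧ n % 4 = 0 ∧ j = 1 ∧ b = 0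
    · exact ⟨_, v1, rfl, occ_leaf.2 ⟨by omega, hx, Or.inr ⟨e.1, e.2.2.2, Or.inr ⟨e.2.1, e.2.2.1⟩⟩⟩⟩
    · refine ⟨⟨l, j, b⟩, ?_, rfl, occ_leaf.2 ⟨by omega, hx, Or.inl ⟨l0, rfl, rfl⟩⟩⟩
      refine Or.inr ⟨hl, by simp only; omega, by simp only; omega, by simp only; omega,
        fun _ _ => by simpa using hx1.2, fun h => ?_, fun h => ?_⟩ <;> simp only at h ⊢ <;> omega

theorem Rel.level_le_two {o i : Bool} (h : Rel n d o i s t) : s.level ≤ 2 ∧ t.level ≤ 2 := by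
  obtain ⟨h1, h2, -⟩ := h
  unfold IsGadgetState at h1 h2; omega

/-- On each of the levels that occur, every edge of the cycle has a state from which no transition
traverses it. -/
theorem exists_idle (hd : ∀ j, j % 2 = 1 → 2 ≤ d j) (hn : n % 2 = 0) (h4 : 4 ≤ n) {l : ℕ}
    (hl : l = 1 ∨ (l = 2 ∧ n % 4 = 2)) {j : ℕ} (hj : j < n) :
    ∃ s, IsGadgetState n d s ∧ s.level = l ∧ ∀ o i t, Rel n d o i s t → (n % 4 = 0 → t.level ≠ 2) →
      ¬ Flow n s t j ∧ ¬ Flow n t s j := by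
  have l0 : l ≠ 0 := by omega
  by_cases e : l = 2 ∧ j + 1 = n
  · refine ⟨⟨l, n - 1, 0⟩, isGadgetState_mk hd (by omega) (by omega) (by omega) (by omega)
      (by omega), rfl, ?_⟩
    intro o i t hr ht
    have h2 : n % 4 = 2 := by omega
    have hx := fun h => hr.2.2.symm.centre_eq h2 h e.1
    have hl' := hr.level_le_two.2
    have ot := hr.2.1.odd
    clear hr
    have ts : ¬ Token ⟨l, n - 1, 0⟩ n := by rw [token_mk l0]; omega
    obtain ⟨rfl, e⟩ := e
    unfold Flow
    simp only [h2, e, ts, true_and, true_or, or_true, not_true, false_and, and_false, false_or,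
      or_false, not_false_iff, and_true]
    refine ⟨by omega, ?_⟩
    rintro (⟨h5, h6⟩ | h5)
    · simp only at hx
      rcases Nat.eq_zero_or_pos t.level with lt | lt
      · simp only [Token, lt, ne_eq, not_true, false_and, or_false] at h6; omega
      · rw [forward_iff (by omega) (by simp)] at h5
        simp only [Token] at h5 h6
        unfold HasOddCentre at ot
        omega
    · omega
  · by_cases e1 : j % 2 = 0
    · refine ⟨⟨l, j - 1, 0⟩, isGadgetState_mk hd (by omega) (by omega) (by omega) (by omega)
        (by omega), rfl, ?_⟩
      intro o i t hr ht
      have ts : ¬ Token ⟨l, j - 1, 0⟩ j := by rw [token_mk l0]; omega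
      have e2 : ¬ j + 1 = n := by omega
      have e3 : ¬ j % 2 = 1 := by omega
      have ot := hr.2.1.odd
      unfold Flow
      simp only [e1, e2, ts, zero_ne_one, true_and, false_and, and_false, false_or, or_false,
        not_false_iff, and_true]
      refine ⟨fun h => ht h.1 h.2.2.2, ?_⟩
      rintro (⟨h5, h6⟩ | h5)
      · rcases Nat.eq_zero_or_pos t.level with lt | lt
        · simp only [Token, lt, ne_eq, not_true, false_and, or_false] at h6
          simp only [Forward] at h5; omega
        · rw [forward_iff (by omega) (by simpa using l0)] at h5
          simp only [Token] at h5 h6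
          omega
      · omega
    · refine ⟨⟨l, j + 2, 0⟩, isGadgetState_mk hd (by omega) (by omega) (by omega) (by omega)
        (by omega), rfl, ?_⟩
      intro o i t hr ht
      have ts : ¬ Token ⟨l, j + 2, 0⟩ (j + 1) := by rw [token_mk l0]; omega
      have e3 : j % 2 = 1 := by omega
      have e4 : ¬ j = 0 := by omega
      have ot := hr.2.1.odd
      have hl' := hr.level_le_two.2
      have hx := fun h2 => hr.2.2.centre_eq h2
      have ct : t.level = 2 → n % 4 = 2 → t.centre < n := by
        intro h h'; obtain ⟨-, -, -, -, -, -, h2⟩ := hr.2.1.resolve_left (by omega)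
        exact ((h2 h).resolve_right (by omega)).2
      clear hr
      have ts' : j + 1 = n → ¬ Token ⟨l, j + 2, 0⟩ n := fun h => h ▸ ts
      unfold Flow
      simp only [e3, e4, ts, one_ne_zero, true_and, false_and, and_false, false_or, or_false,
        not_false_iff]
      have key : ∀ h : n % 4 = 2 ∧ j + 1 = n ∧ (l = 2 ∨ t.level = 2), l = 1 ∧ t.level = 2 ∧
        t.centre = 1 := by
        intro h
        simp only at hx
        omega
      constructor
      · rintro (⟨-, h5, h6⟩ | ⟨-, h5, -, -, h6, -⟩ | h5)
        · rcases Nat.eq_zero_or_pos t.level with lt | lt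
          · simp only [Token, lt, ne_eq, not_true, false_and, or_false] at h6
            simp only [Forward] at h5; omega
          · rw [forward_iff (by simpa using l0) (by omega)] at h5
            simp only [Token] at h5 h6
            omega
        · exact ts' h5 h6
        · omega
      · rintro (⟨h1, h5, h3, h6, h7⟩ | h5)
        · have := key ⟨h1, h5, h3.symm⟩
          simp only [Token] at h7
          omega
        · have := ct (by omega) (by omega)
          omega
end

/-! ### Levels -/

section
variable {n : ℕ} {d : ℕ → ℕ} {s t : GadgetState}

/-- The pairs of levels that occur in `UpRel`. -/
def UpLev (n a b : ℕ) : Prop :=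
  (a = 0 ∧ ((n % 4 = 0 ∧ b = 1) ∨ (n % 4 = 2 ∧ b = 2))) ∨ (a = 1 ∧ b = 2)

/-- The pairs of levels between which a transition with given flags is possible. -/
def LevRel (n : ℕ) : Bool → Bool → ℕ → ℕ → Prop
  | false, false, a, b => a = b ∨ (n % 4 = 2 ∧ a + b = 1)
  | false, true, a, b => UpLev n a b
  | true, false, a, b => UpLev n b a
  | true, true, a, b => a = b ∧ (a ≠ 1 ∨ n % 4 = 0)

theorem exists_isGadgetState (hd : ∀ j, j % 2 = 1 → 2 ≤ d j) (hn : n % 2 = 0) (h4 : 4 ≤ n) {l : ℕ}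
    (hl : l ≤ 2) :
    ∃ s, IsGadgetState n d s ∧ s.level = l := by
  by_cases h : l = 0
  · exact ⟨⟨0, 0, 0⟩, Or.inl ⟨rfl, rfl, rfl⟩, h.symm⟩
  · exact ⟨⟨l, -1, 0⟩, isGadgetState_mk hd (by omega) (by omega) (by omega) (by omega) (by omega),
      rfl⟩

theorem IsGadgetState.lower (hs : IsGadgetState n d s) (h2 : s.level = 2) :
    IsGadgetState n d ⟨1, s.centre, s.leaf⟩ := by
  obtain ⟨-, a1, a2, a3, a4, a5, a6⟩ := hs.resolve_left (by omega)
  exact Or.inr ⟨Or.inl rfl, a1, a2, a3, a4, a5, fun h => by simp at h⟩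

/-- Every state has a transition to each level to which its level is related. -/
theorem LevRel.exists_rel (hd : ∀ j, j % 2 = 1 → 2 ≤ d j) (hn : n % 2 = 0) (h4 : 4 ≤ n)
    (hs : IsGadgetState n d s)
    {o i : Bool} {l : ℕ} (hl : l ≤ 2) (h : LevRel n o i s.level l) : ∃ t, t.level = l ∧
      Rel n d o i s t := by
  cases o <;> cases i <;> simp only [LevRel] at h
  · obtain ⟨t, h1, h2⟩ := exists_isGadgetState hd hn h4 hl
    exact ⟨t, h2, hs, h1, by simp only [FlagRel]; omega⟩
  · rcases h with h | h
    · obtain ⟨t, h1, h2⟩ := exists_isGadgetState hd hn h4 hl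
      exact ⟨t, h2, hs, h1, Or.inl (by omega)⟩
    · obtain ⟨-, a1, a2, a3, a4, a5, a6⟩ := hs.resolve_left (by omega)
      by_cases e : n % 4 = 0
      · by_cases e1 : s.centre = 1 ∧ s.leaf = 0
        · refine ⟨⟨2, 1, 1⟩, h.2.symm, hs, Or.inr ⟨Or.inr rfl, rfl, by
            simp, by simp, fun _ _ => hd 1 rfl, fun h => ?_, fun h => ?_⟩,
            Or.inr ⟨h.1, rfl, Or.inl ⟨e, e1.1, Or.inr e1⟩⟩⟩ <;> simp only at h ⊢ <;> omega
        · exact ⟨⟨2, s.centre, s.leaf⟩, h.2.symm, hs, Or.inr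
            ⟨Or.inr rfl, a1, a2, a3, a4, a5, fun _ => Or.inr ⟨e, e1⟩⟩,
            Or.inr ⟨h.1, rfl, Or.inl ⟨e, rfl, Or.inl rfl⟩⟩⟩
      · by_cases e1 : s.centre = n + 1
        · exact ⟨⟨2, 1, 0⟩, h.2.symm, hs, isGadgetState_mk hd (by omega) (by omega) (by omega)
            (by omega) (by omega), Or.inr ⟨h.1, rfl, Or.inr ⟨by omega, Or.inr ⟨e1, rfl⟩⟩⟩⟩
        · exact ⟨⟨2, s.centre, s.leaf⟩, h.2.symm, hs, Or.inr
            ⟨Or.inr rfl, a1, a2, a3, a4, a5, fun _ => Or.inl ⟨by omega, by simp only; omega⟩⟩,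
            Or.inr ⟨h.1, rfl, Or.inr ⟨by omega, Or.inl ⟨rfl, rfl⟩⟩⟩⟩
  · rcases h with h | h
    · obtain ⟨t, h1, h2⟩ := exists_isGadgetState hd hn h4 hl
      exact ⟨t, h2, hs, h1, Or.inl (by omega)⟩
    · refine ⟨⟨1, s.centre, s.leaf⟩, h.1.symm, hs, hs.lower h.2, Or.inr ⟨rfl, h.2, ?_⟩⟩
      simp only [true_or, and_true]; omega
  · exact ⟨s, h.1, hs, hs, rfl, h.2⟩

/-- The gadget never occupies two leaves of one vertex, except on level `2` for `n % 4 = 0`. -/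
theorem occ_leaf_unique (h : n % 4 = 2 ∨ s.level ≠ 2) {j b b' : ℕ}
    (h1 : Occ n s (j, b + 1)) (h2 : Occ n s (j, b' + 1)) : b = b' := by
  have h1 := (occ_leaf.1 h1).2.2
  have h2 := (occ_leaf.1 h2).2.2
  simp only [LeafOcc] at h1 h2
  omega

/-! ### The number of guards of the gadget -/

theorem IsShift.ncard_eq {X : Type*} {P Q : X → Prop} {M : X → X → Prop} (h : IsShift P Q M) :
    {x | P x}.ncard = {x | Q x}.ncard := by
  classical
  let f : X → X := fun x => if hx : ∃ y, M x y then hx.choose else x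
  have hf : ∀ x, (∃ y, M x y) → M x (f x) := by
    intro x hx; simp only [f, dif_pos hx]; exact hx.choose_spec
  have hf' : ∀ x, ¬ (∃ y, M x y) → f x = x := by
    intro x hx; simp only [f, dif_neg hx]
  refine Set.ncard_congr (fun x _ => f x) ?_ ?_ ?_
  · intro x hx
    by_cases e : ∃ y, M x y
    · exact h.tgt _ _ (hf x e)
    · show Q (f x)
      rw [hf' x e]
      by_contra hq
      exact e (h.leave x hx hq)
  · intro x y hx hy hxy
    by_cases e : ∃ z, M x z <;> by_cases e' : ∃ z, M y z
    · have h1 := hf x e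
      rw [hxy] at h1
      exact h.inj _ _ _ h1 (hf y e')
    · have h1 := hf x e
      rw [hxy, hf' y e'] at h1
      exact absurd (h.drain _ _ h1 hy) e'
    · have h1 := hf y e'
      rw [← hxy, hf' x e] at h1
      exact absurd (h.drain _ _ h1 hx) e
    · rwa [hf' x e, hf' y e'] at hxy
  · intro y hy
    by_cases e : ∃ x, M x y
    · obtain ⟨x, hx⟩ := e
      exact ⟨x, h.src _ _ hx, h.func _ _ _ (hf x ⟨y, hx⟩) hx⟩
    · have hp : P y := by
        by_contra hp; exact e (h.enter y hy hp)
      refine ⟨y, hp, hf' y fun e' => ?_⟩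
      obtain ⟨z, hz⟩ := e'
      exact e (h.fill _ _ hz hy)

theorem finite_occ (hd : ∀ j, j % 2 = 1 → 2 ≤ d j) (hn : n % 2 = 0) (hs : IsGadgetState n d s) :
    {x | Occ n s x}.Finite := by
  refine Set.Finite.subset (s := ↑(Finset.range n ×ˢ Finset.range ((Finset.range n).sum d + 1)))
    (Finset.finite_toSet _) ?_
  rintro ⟨j, b⟩ h
  have h1 : j < n := h.1
  simp only [Finset.coe_product, Finset.coe_range, Set.mem_prod, Set.mem_Iio]
  refine ⟨h1, ?_⟩
  rcases b with _ | b
  · omega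
  · have := (occ_leaf_valid hd hn hs h).2.2
    have h2 : _ ≤ (Finset.range n).sum d := Finset.single_le_sum (f := d) (fun i _ => Nat.zero_le _)
      (Finset.mem_range.2 h1)
    omega

theorem ncard_occExcept_true (hs : {x | Occ n s x}.Finite) (h : Occ n s (0, 0)) :
    {x | OccExcept n s true x}.ncard + 1 = {x | Occ n s x}.ncard := by
  have : {x | OccExcept n s true x} = {x | Occ n s x} \ {(0, 0)} := by ext x; simp [OccExcept]
  rw [this]
  exact Set.ncard_sdiff_singleton_add_one (s := {x | Occ n s x}) h hs

theorem occExcept_false : OccExcept n s false = Occ n s := by ext x; simp [OccExcept]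

theorem Rel.ncard_occ (hd : ∀ j, j % 2 = 1 → 2 ≤ d j) (hn : n % 2 = 0) (h4 : 4 ≤ n) {o i : Bool}
    (h : Rel n d o i s t) :
    {x | Occ n s x}.ncard + (if i then 1 else 0) = {x | Occ n t x}.ncard +
      (if o then 1 else 0) := by
  have f1 := finite_occ hd hn h.1
  have f2 := finite_occ hd hn h.2.1
  have h1 := (isShift_of_rel hn h4 h).ncard_eq
  have h2 : o = true → _ := fun e => ncard_occExcept_true f1 (flagged_occ h h4 hn e)
  have h3 : i = true → _ := fun e => ncard_occExcept_true f2 (flagged_occ h.symm h4 hn e)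
  cases o <;> cases i <;> simp only [occExcept_false, if_true, if_false, Bool.false_eq_true,
    forall_const, false_imp_iff] at * <;> omega

/-- On level `0` the guards stand on the red vertices and on the multiples of `4`. -/
theorem ncard_occ_zero (h : s.level = 0) :
    {x | Occ n s x}.ncard = ((Finset.range n).filter fun j => j % 2 = 1 ∨ j % 4 = 0).card := by
  have : {x | Occ n s x} = (fun j => (j, 0)) '' ↑((Finset.range n).filter fun j => j % 2 = 1 ∨
    j % 4 = 0) := by
    ext ⟨j, b⟩
    simp only [Set.mem_ofPred_eq, Finset.coe_filter, Finset.mem_range, Set.mem_image, Prod.mk.injEq]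
    rcases b with _ | b
    · rw [occ_cyc]
      simp only [and_true, exists_eq_right]
      have hc : CycOcc n s j ↔ j % 2 = 1 ∨ j % 4 = 0 := by
        simp only [CycOcc, Token, h, ne_eq, not_true, false_and, or_false, true_and, zero_ne_one,
          not_false_iff, true_or, and_true]
        omega
      rw [hc]
    · simp only [occ_leaf, LeafOcc, h]
      simp
  rw [this, Set.ncard_image_of_injective _ (fun a b h => by simpa using h), Set.ncard_coe_finset]

/-- The number of guards on level `0` for the two lengths of the cycle. -/
theorem card_level_zero (k : ℕ) : ((Finset.range (4 * k + 2)).filter fun j => j % 2 = 1 ∨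
    j % 4 = 0).card = 3 * k + 2 ∧
    ((Finset.range (4 * k + 4)).filter fun j => j % 2 = 1 ∨ j % 4 = 0).card = 3 * k + 3 := by
  induction k with
  | zero => decide
  | succ k ih =>
    have e1 : 4 * (k + 1) + 2 = 4 * k + 4 + 1 + 1 := by ring
    have e2 : 4 * (k + 1) + 4 = 4 * k + 4 + 1 + 1 + 1 + 1 := by ring
    rw [e1, e2]
    have a1 : (4 * k + 4) % 2 = 1 ∨ (4 * k + 4) % 4 = 0 := by omega
    have a2 : (4 * k + 4 + 1) % 2 = 1 ∨ (4 * k + 4 + 1) % 4 = 0 := by omega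
    have a3 : ¬ ((4 * k + 4 + 1 + 1) % 2 = 1 ∨ (4 * k + 4 + 1 + 1) % 4 = 0) := by omega
    have a4 : (4 * k + 4 + 1 + 1 + 1) % 2 = 1 ∨ (4 * k + 4 + 1 + 1 + 1) % 4 = 0 := by omega
    have e3 : ((Finset.range (4 * k + 4 + 1 + 1)).filter fun j => j % 2 = 1 ∨
      j % 4 = 0).card = 3 * k + 5 := by
      rw [Finset.range_add_one, Finset.filter_insert, if_pos a2,
        Finset.card_insert_of_notMem (by simp),
        Finset.range_add_one, Finset.filter_insert, if_pos a1,
          Finset.card_insert_of_notMem (by simp), ih.2]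
    refine ⟨by omega, ?_⟩
    rw [Finset.range_add_one, Finset.filter_insert, if_pos a4,
      Finset.card_insert_of_notMem (by simp),
        Finset.range_add_one, Finset.filter_insert, if_neg a3, e3]
    omega

/-- The number of guards of the gadget. It exceeds the cost `3 * k + 1` or `3 * k + 2` of the
replacement by the number of guards on the star in a state of that level. All levels are linked to
level `0` by transitions, so that counting in one state of level `0` suffices. -/
theorem ncard_occ (hd : ∀ j, j % 2 = 1 → 2 ≤ d j) (h4 : 4 ≤ n) {k : ℕ} (hs : IsGadgetState n d s) :
    (n = 4 * k + 2 → {x | Occ n s x}.ncard = 3 * k + 1 + (if s.level = 2 then 2 else 1)) ∧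
    (n = 4 * k + 4 → {x | Occ n s x}.ncard = 3 * k + 2 + (s.level + 1)) := by
  have hl : s.level ≤ 2 := by unfold IsGadgetState at hs; omega
  have v0 : IsGadgetState n d ⟨0, 0, 0⟩ := Or.inl ⟨rfl, rfl, rfl⟩
  have c0 := ncard_occ_zero (n := n) (s := ⟨0, 0, 0⟩) rfl
  constructor
  · intro h
    have hn : n % 2 = 0 := by omega
    rw [h, (card_level_zero k).1, ← h] at c0
    by_cases e : s.level = 2
    · have hr : Rel n d false true ⟨0, 0, 0⟩ s := ⟨v0, hs, Or.inl ⟨rfl, Or.inr ⟨by omega, e⟩⟩⟩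
      have := hr.ncard_occ hd hn h4
      simp only [if_true, if_false, Bool.false_eq_true, e] at *
      omega
    · by_cases e0 : s.level = 0
      · rw [eq_of_level_zero hs v0 e0 rfl, c0]; simp
      · have hr : Rel n d false false ⟨0, 0, 0⟩ s := ⟨v0, hs,
          Or.inr ⟨by omega, by simp only; omega⟩⟩
        have := hr.ncard_occ hd hn h4
        simp only [if_false, Bool.false_eq_true, e] at *
        omega
  · intro h
    have hn : n % 2 = 0 := by omega
    rw [h, (card_level_zero k).2, ← h] at c0
    have c1 : ∀ s, IsGadgetState n d s → s.level = 1 → {x | Occ n s x}.ncard = 3 * k + 4 := by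
      intro s hs e
      have hr : Rel n d false true ⟨0, 0, 0⟩ s := ⟨v0, hs, Or.inl ⟨rfl, Or.inl ⟨by omega, e⟩⟩⟩
      have := hr.ncard_occ hd hn h4
      simp only [if_true, if_false, Bool.false_eq_true, e] at *
      omega
    by_cases e : s.level = 2
    · have hr : Rel n d false true ⟨1, s.centre, s.leaf⟩ s :=
        ⟨hs.lower e, hs, Or.inr ⟨rfl, e, Or.inl ⟨by omega, rfl, Or.inl rfl⟩⟩⟩
      have := hr.ncard_occ hd hn h4
      have := c1 _ hr.1 rfl
      simp only [if_true, if_false, Bool.false_eq_true, e] at *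
      omega
    · by_cases e0 : s.level = 0
      · rw [eq_of_level_zero hs v0 e0 rfl, c0]; rfl
      · rw [c1 s hs (by omega)]; omega

theorem finite_isGadgetState (hn : n % 2 = 0) (d : ℕ → ℕ) : {s | IsGadgetState n d s}.Finite := by
  have : {s | IsGadgetState n d s} ⊆ (fun p : ℕ × ℤ × ℕ => GadgetState.mk p.1 p.2.1 p.2.2) ''
      ↑(Finset.range 3 ×ˢ (Finset.Icc (-1 : ℤ) (n + 1) ×ˢ Finset.range
        ((Finset.range n).sum d + 1))) := by
    rintro ⟨l, r, a⟩ h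
    refine ⟨(l, r, a), ?_, rfl⟩
    simp only [Finset.coe_product, Finset.coe_range, Set.mem_prod, Set.mem_Iio, Finset.coe_Icc,
      Set.mem_Icc]
    rcases h with ⟨h1, h2, h3⟩ | ⟨h1, h2, h3, h4, h5, h6, -⟩
    · simp only at h1 h2 h3; omega
    · simp only at h1 h2 h3 h4 h5 h6
      refine ⟨by omega, ⟨h3, h4⟩, ?_⟩
      by_cases e : 0 < r ∧ r < n
      · have := h5 e.1 e.2
        have h2 : _ ≤ (Finset.range n).sum d := Finset.single_le_sum (f := d)
          (fun i _ => Nat.zero_le _) (Finset.mem_range.2 (show r.toNat < n by omega))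
        omega
      · by_cases e : r < 0 ∨ n < r
        · have := h6 e; omega
        · omega
  exact (Set.Finite.image _ (Finset.finite_toSet _)).subset this
end

/-! ### Embedding the gadget into a graph -/

/-- The nodes of the gadget when the red vertex `j` has `d j` leaves. -/
def Node (n : ℕ) (d : ℕ → ℕ) (x : ℕ × ℕ) : Prop := x.1 < n ∧ (x.2 = 0 ∨ (x.1 % 2 = 1 ∧ x.2 ≤ d x.1))

theorem occ_node {n : ℕ} {d : ℕ → ℕ} {s : GadgetState} (hd : ∀ j, j % 2 = 1 → 2 ≤ d j)
    (hn : n % 2 = 0) (hs : IsGadgetState n d s) {x : ℕ × ℕ} (h : Occ n s x) : Node n d x := by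
  obtain ⟨j, b⟩ := x
  refine ⟨h.1, ?_⟩
  rcases b with _ | b
  · exact Or.inl rfl
  · have := occ_leaf_valid hd hn hs h
    exact Or.inr ⟨this.1, this.2.2⟩

/-- The moves of a shift completed by the guards that stay in place. -/
def FullMove {X : Type*} (P Q : X → Prop) (M : X → X → Prop) (x y : X) : Prop :=
  M x y ∨ (x = y ∧ P x ∧ Q x ∧ ¬ ∃ z, M x z)

section
variable {X : Type*} {P Q : X → Prop} {M : X → X → Prop}

theorem IsShift.full_src (h : IsShift P Q M) {x y : X} (hxy : FullMove P Q M x y) : P x := by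
  rcases hxy with h1 | h1
  · exact h.src _ _ h1
  · exact h1.2.1

theorem IsShift.full_tgt (h : IsShift P Q M) {x y : X} (hxy : FullMove P Q M x y) : Q y := by
  rcases hxy with h1 | h1
  · exact h.tgt _ _ h1
  · exact h1.1 ▸ h1.2.2.1

theorem IsShift.full_exists (h : IsShift P Q M) {x : X} (hx : P x) : ∃ y, FullMove P Q M x y := by
  by_cases e : ∃ y, M x y
  · exact e.imp fun y => Or.inl
  · exact ⟨x, Or.inr ⟨rfl, hx, by_contra fun h' => e (h.leave x hx h'), e⟩⟩

theorem IsShift.full_unique (h : IsShift P Q M) {x y z : X} (h1 : FullMove P Q M x y)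
    (h2 : FullMove P Q M x z) : y = z := by
  rcases h1 with h1 | h1 <;> rcases h2 with h2 | h2
  · exact h.func _ _ _ h1 h2
  · exact absurd ⟨_, h1⟩ h2.2.2.2
  · exact absurd ⟨_, h2⟩ h1.2.2.2
  · exact h1.1.symm.trans h2.1

theorem IsShift.full_symm (h : IsShift P Q M) {M' : X → X → Prop} (hM : ∀ x y, M x y ↔ M' y x)
    {x y : X} (h1 : FullMove P Q M x y) :
    FullMove Q P M' y x := by
  rcases h1 with h1 | ⟨rfl, h1, h2, h3⟩
  · exact Or.inl ((hM _ _).1 h1)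
  · refine Or.inr ⟨rfl, h2, h1, ?_⟩
    rintro ⟨z, hz⟩
    exact h3 (h.drain _ _ ((hM _ _).2 hz) h1)
end

/-- The states of the lifted strategy: a state of the given strategy together with a state of the
gadget on the level assigned to it. -/
abbrev LiftState {Ω : Type} (n : ℕ) (d : ℕ → ℕ) (lev : Ω → ℕ) : Type :=
    {p : Ω × GadgetState // IsGadgetState n d p.2 ∧ p.2.level = lev p.1}

theorem finite_liftState {Ω : Type} {n : ℕ} {d : ℕ → ℕ} {lev : Ω → ℕ} (hn : n % 2 = 0) [Finite Ω] :
    Finite (LiftState n d lev) := by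
  have := (finite_isGadgetState hn d).to_subtype
  refine Finite.of_injective (β := Ω × {s | IsGadgetState n d s})
    (fun p => (p.1.1, ⟨p.1.2, p.2.1⟩)) ?_
  rintro ⟨⟨a, b⟩, h⟩ ⟨⟨a', b'⟩, h'⟩ e
  simpa using e

/-- An embedding `φ` of the gadget nodes into `G`, onto `u` and the set `Part`. -/
structure Embeds {V : Type u} (G : SimpleGraph V) (u : V) (Part : Set V) (n : ℕ) (d : ℕ → ℕ)
    (φ : ℕ × ℕ → V) : Prop where
  even : n % 2 = 0
  four_le : 4 ≤ n
  two_le : ∀ j, j % 2 = 1 → 2 ≤ d j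
  zero : φ (0, 0) = u
  inj : ∀ x y, Node n d x → Node n d y → φ x = φ y → x = y
  part : ∀ v, v ∈ Part ↔ ∃ x, Node n d x ∧ x ≠ (0, 0) ∧ φ x = v
  adj_cyc : ∀ j, j < n → G.Adj (φ (j, 0)) (φ (succIdx n j, 0))
  adj_leaf : ∀ j b, Node n d (j, b + 1) → G.Adj (φ (j, 0)) (φ (j, b + 1))

/-! ### The lifted strategy -/

section
variable {V : Type u} {G : SimpleGraph V} {n : ℕ} [NeZero n] {c : Fin n → V} {l : ℕ} {Ω : Type}

/-- The occupied vertices outside the cycle. The connecting vertex is left to the gadget. -/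
def outerPos (B : LabelledStrategy (replaceCycle G c l) Ω) (α : Ω) : Set V :=
  {v | v ≠ c 0 ∧ ∃ h : v ∉ cyclePart G c, Sum.inl ⟨v, h⟩ ∈ B.pos α}

/-- The transition moves a guard from `a` to `b`, or keeps it in place, outside the removed part. -/
def KeptMove (B : LabelledStrategy (replaceCycle G c l) Ω) (α β : Ω) (a b : V) : Prop :=
  ∃ (ha : a ∉ cyclePart G c) (hb : b ∉ cyclePart G c), (Sum.inl ⟨a, ha⟩,
    Sum.inl ⟨b, hb⟩) ∈ B.move α β

/-- The moves that the lifted strategy takes over from the given one: those between kept vertices,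
except that the gadget governs the guard that stays on the connecting vertex. If `α = β`, only the
gadget changes and all outer guards stay. -/
def OuterMove (B : LabelledStrategy (replaceCycle G c l) Ω) (α β : Ω) (a b : V) : Prop :=
  (α = β ∧ a = b ∧ a ∈ outerPos B α) ∨ (α ≠ β ∧ ¬ (a = c 0 ∧ b = c 0) ∧ KeptMove B α β a b)

open Classical in
/-- The transition moves a guard from the connecting vertex out of the star. -/
noncomputable def flag (B : LabelledStrategy (replaceCycle G c l) Ω) (α β : Ω) : Bool :=
  decide (∃ v, α ≠ β ∧ v ≠ c 0 ∧ KeptMove B α β (c 0) v)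

variable {B : LabelledStrategy (replaceCycle G c l) Ω} {α β : Ω}

theorem flag_iff : flag B α β = true ↔ ∃ v, OuterMove B α β (c 0) v := by
  unfold flag OuterMove outerPos
  simp only [decide_eq_true_eq]
  refine exists_congr fun v => ?_
  simp only [Set.mem_ofPred_eq, ne_eq, not_true, false_and, and_false, false_or, true_and]

theorem flag_self : flag B α α = false := by
  simp [flag]

theorem OuterMove.symm (h : α = β ∨ B.graph.Adj α β) {a b : V} (hm : OuterMove B α β a b) :
    OuterMove B β α b a := by
  rcases hm with ⟨rfl, rfl, h1⟩ | ⟨h1, h2, h3, h4, h5⟩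
  · exact Or.inl ⟨rfl, rfl, h1⟩
  · exact Or.inr ⟨Ne.symm h1, fun h => h2 h.symm, h4, h3, B.move_symm _ _
      (h.resolve_left h1) _ _ h5⟩

theorem OuterMove.src (h : α = β ∨ B.graph.Adj α β) {a b : V} (hm : OuterMove B α β a b) :
    a ∈ outerPos B α ∨ (a = c 0 ∧ flag B α β = true) := by
  by_cases e : a = c 0
  · exact Or.inr ⟨e, flag_iff.2 ⟨b, e ▸ hm⟩⟩
  · refine Or.inl ?_
    rcases hm with ⟨rfl, rfl, h1⟩ | ⟨h1, h2, h3, h4, h5⟩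
    · exact h1
    · exact ⟨e, h3, (B.move_valid _ _ (h.resolve_left h1) _ _ h5).1⟩

theorem OuterMove.adj (h : α = β ∨ B.graph.Adj α β) {a b : V} (hm : OuterMove B α β a b) :
    G.Adj a b ∨ a = b := by
  rcases hm with ⟨rfl, rfl, h1⟩ | ⟨h1, h2, h3, h4, h5⟩
  · exact Or.inr rfl
  · rcases (B.move_valid _ _ (h.resolve_left h1) _ _ h5).2.2 with h6 | h6
    · exact Or.inl h6
    · simp only [Sum.inl.injEq, Subtype.mk.injEq] at h6
      exact Or.inr h6

theorem OuterMove.unique (h : α = β ∨ B.graph.Adj α β) {a b b' : V} (hm : OuterMove B α β a b)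
    (hm' : OuterMove B α β a b') : b = b' := by
  rcases hm with ⟨rfl, rfl, h1⟩ | ⟨h1, h2, h3, h4, h5⟩ <;> rcases hm' with ⟨g0, g1, -⟩ |
    ⟨g1, g2, g3, g4, g5⟩
  · exact g1
  · exact absurd rfl g1
  · exact absurd g0 h1
  · have hA := h.resolve_left h1
    have := (B.move_left _ _ hA _ (B.move_valid _ _ hA _ _ h5).1).unique h5 g5
    simpa using this

theorem OuterMove.exists (h : α = β ∨ B.graph.Adj α β) {a : V} (ha : a ∈ outerPos B α) :
    ∃ b, OuterMove B α β a b := by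
  by_cases e : α = β
  · exact ⟨a, Or.inl ⟨e, rfl, ha⟩⟩
  · have hA := h.resolve_left e
    obtain ⟨h0, h1, h2⟩ := ha
    obtain ⟨w, hw, -⟩ := B.move_left _ _ hA _ h2
    rcases w with ⟨w, hw'⟩ | i
    · exact ⟨w, Or.inr ⟨e, fun h => h0 h.1, h1, hw', hw⟩⟩
    · rcases (B.move_valid _ _ hA _ _ hw).2.2 with h3 | h3
      · exact absurd h3 h0
      · simp at h3

/-- A level for each state of the given strategy such that its transitions can be followed in the
gadget. If the connecting vertex is occupied then it is so in all gadget states of the level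
(`centre`), and the states of level `0` have a neighbour on level `1` or `2` to all of whose gadget
states there is a transition (`hub`). -/
structure IsLevelling (B : LabelledStrategy (replaceCycle G c l) Ω) (lev : Ω → ℕ) : Prop where
  le_two : ∀ α, lev α ≤ 2
  rel : ∀ α β, B.graph.Adj α β → LevRel n (flag B α β) (flag B β α) (lev α) (lev β)
  centre : ∀ α h, Sum.inl ⟨c 0, h⟩ ∈ B.pos α → lev α ≠ 1 ∨ n % 4 = 0
  hub : ∀ α, lev α = 0 → ∃ β, B.graph.Adj α β ∧ flag B α β = false ∧
    ((flag B β α = true ∧ UpLev n 0 (lev β)) ∨ (flag B β α = false ∧ n % 4 = 2 ∧ lev β = 1))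

variable {u : V} {d : ℕ → ℕ} {φ : ℕ × ℕ → V} {lev : Ω → ℕ}

theorem Embeds.not_part (hφ : Embeds G (c 0) (cyclePart G c) n d φ) : c 0 ∉ cyclePart G c := by
  intro h
  obtain ⟨x, h1, h2, h3⟩ := (hφ.part _).1 h
  exact h2 (hφ.inj x (0, 0) h1 ⟨by have := hφ.four_le; omega, Or.inl rfl⟩ (h3.trans hφ.zero.symm))

theorem Embeds.eq_zero (hφ : Embeds G (c 0) (cyclePart G c) n d φ) {x : ℕ × ℕ} (hx : Node n d x)
    (h : φ x ∉ cyclePart G c) : x = (0, 0) := by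
  by_contra h'
  exact h ((hφ.part _).2 ⟨x, hx, h', rfl⟩)

/-- Two states of the lifted strategy can follow each other: the given strategy stays or makes a
transition, and the gadget follows it. -/
def LiftRel (n : ℕ) (d : ℕ → ℕ) (B : LabelledStrategy (replaceCycle G c l) Ω) (lev : Ω → ℕ)
    (p q : LiftState n d lev) : Prop :=
  (p.1.1 = q.1.1 ∨ B.graph.Adj p.1.1 q.1.1) ∧ Rel n d (flag B p.1.1 q.1.1)
    (flag B q.1.1 p.1.1) p.1.2 q.1.2

theorem LiftRel.symm {p q : LiftState n d lev} (h : LiftRel n d B lev p q) :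
    LiftRel n d B lev q p :=
  ⟨h.1.imp Eq.symm fun h => h.symm, h.2.symm⟩

/-- The moves inside the gadget during a transition of the lifted strategy, with the guards that
stay in place. -/
def GadgetMove (n : ℕ) (d : ℕ → ℕ) (B : LabelledStrategy (replaceCycle G c l) Ω) (lev : Ω → ℕ)
    (p q : LiftState n d lev) : ℕ × ℕ → ℕ × ℕ → Prop :=
  FullMove (OccExcept n p.1.2 (flag B p.1.1 q.1.1)) (OccExcept n q.1.2 (flag B q.1.1 p.1.1))
    (CycleMove n p.1.2 q.1.2)

/-- The moves of a transition of the lifted strategy in `G`. -/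
def LiftMove (φ : ℕ × ℕ → V) (B : LabelledStrategy (replaceCycle G c l) Ω) (p q : LiftState n d lev)
    (a b : V) : Prop :=
  OuterMove B p.1.1 q.1.1 a b ∨ ∃ x y, GadgetMove n d B lev p q x y ∧ φ x = a ∧ φ y = b

theorem LiftRel.isShift (hφ : Embeds G (c 0) (cyclePart G c) n d φ) {p q : LiftState n d lev}
    (h : LiftRel n d B lev p q) :
    IsShift (OccExcept n p.1.2 (flag B p.1.1 q.1.1)) (OccExcept n q.1.2 (flag B q.1.1 p.1.1))
      (CycleMove n p.1.2 q.1.2) :=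
  isShift_of_rel hφ.even hφ.four_le h.2

theorem LiftMove.symm (hφ : Embeds G (c 0) (cyclePart G c) n d φ) {p q : LiftState n d lev}
    (h : LiftRel n d B lev p q) {a b : V}
    (hm : LiftMove φ B p q a b) : LiftMove φ B q p b a := by
  rcases hm with hm | ⟨x, y, h1, h2, h3⟩
  · exact Or.inl (hm.symm h.1)
  · exact Or.inr ⟨y, x, (h.isShift hφ).full_symm (fun x y => cycleMove_swap) h1, h3, h2⟩

/-- The vertices of `G` that are occupied in a state of the lifted strategy. -/
def liftPos (φ : ℕ × ℕ → V) (B : LabelledStrategy (replaceCycle G c l) Ω) (p : LiftState n d lev) :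
    Set V :=
  outerPos B p.1.1 ∪ φ '' {x | Occ n p.1.2 x}

theorem LiftMove.src (hφ : Embeds G (c 0) (cyclePart G c) n d φ) {p q : LiftState n d lev}
    (h : LiftRel n d B lev p q) {a b : V}
    (hm : LiftMove φ B p q a b) : a ∈ liftPos φ B p := by
  rcases hm with hm | ⟨x, y, h1, rfl, h3⟩
  · rcases hm.src h.1 with h1 | ⟨rfl, h1⟩
    · exact Or.inl h1
    · exact Or.inr ⟨_, flagged_occ h.2 hφ.four_le hφ.even h1, hφ.zero⟩
  · exact Or.inr ⟨x, ((h.isShift hφ).full_src h1).1, rfl⟩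

theorem LiftMove.adj (hφ : Embeds G (c 0) (cyclePart G c) n d φ) {p q : LiftState n d lev}
    (h : LiftRel n d B lev p q) {a b : V}
    (hm : LiftMove φ B p q a b) : G.Adj a b ∨ a = b := by
  rcases hm with hm | ⟨x, y, h1 | h1, rfl, rfl⟩
  · exact hm.adj h.1
  · left
    obtain ⟨j, a⟩ := x
    obtain ⟨j', a'⟩ := y
    rcases h1 with ⟨h1, h2, h3, h4, -⟩ | ⟨h1, h2, h3, h4, -⟩ | ⟨h1, h2, h3, h4, -⟩ |
      ⟨h1, h2, h3, h4, -⟩ <;> simp only at h1 h2 h3 h4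
    · rw [h1, h2, h4]; exact hφ.adj_cyc _ h3
    · rw [h1, h2, h4]; exact (hφ.adj_cyc _ h3).symm
    · obtain ⟨a, rfl⟩ := Nat.exists_eq_succ_of_ne_zero h2
      rw [h1, ← h3]
      exact (hφ.adj_leaf _ _ (occ_node hφ.two_le hφ.even p.2.1 h4)).symm
    · obtain ⟨a', rfl⟩ := Nat.exists_eq_succ_of_ne_zero h2
      rw [h1, h3]
      exact hφ.adj_leaf _ _ (occ_node hφ.two_le hφ.even q.2.1 h4)
  · exact Or.inr (by rw [h1.1])

/-- The guard on the connecting vertex moves with the given strategy if the flag is set and inside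
the gadget otherwise; this makes its move unique. -/
theorem LiftMove.existsUnique (hφ : Embeds G (c 0) (cyclePart G c) n d φ) {p q : LiftState n d lev}
    (h : LiftRel n d B lev p q) {a : V}
    (ha : a ∈ liftPos φ B p) : ∃! b, LiftMove φ B p q a b := by
  have hs := h.isShift hφ
  have hne : ∀ x y b, GadgetMove n d B lev p q x y → ¬ OuterMove B p.1.1 q.1.1 (φ x) b := by
    intro x y b h1 h2
    have h3 := hs.full_src h1
    have h4 := occ_node hφ.two_le hφ.even p.2.1 h3.1
    rcases h2.src h.1 with ⟨h5, h6, h7⟩ | ⟨h5, h6⟩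
    · rw [hφ.eq_zero h4 h6] at h5
      exact h5 hφ.zero
    · exact h3.2 h6 (hφ.inj _ _ h4 ⟨by have := hφ.four_le; omega, Or.inl rfl⟩
        (h5.trans hφ.zero.symm))
  have hex : ∃ b, LiftMove φ B p q a b := by
    rcases ha with ha | ⟨x, hx, rfl⟩
    · obtain ⟨b, hb⟩ := OuterMove.exists h.1 ha
      exact ⟨b, Or.inl hb⟩
    · by_cases e : flag B p.1.1 q.1.1 = true ∧ x = (0, 0)
      · obtain ⟨b, hb⟩ := flag_iff.1 e.1
        exact ⟨b, Or.inl (by rw [e.2, hφ.zero]; exact hb)⟩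
      · obtain ⟨y, hy⟩ := hs.full_exists (x := x) ⟨hx, fun h1 h2 => e ⟨h1, h2⟩⟩
        exact ⟨φ y, Or.inr ⟨x, y, hy, rfl, rfl⟩⟩
  obtain ⟨b, hb⟩ := hex
  refine ⟨b, hb, fun b' hb' => ?_⟩
  rcases hb with hb | ⟨x, y, h1, h2, h3⟩ <;> rcases hb' with hb' | ⟨x', y', h1', h2', h3'⟩
  · exact hb'.unique h.1 hb
  · exact absurd (h2'.symm ▸ hb) (hne _ _ _ h1')
  · exact absurd (h2.symm ▸ hb') (hne _ _ _ h1)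
  · have := hφ.inj _ _ (occ_node hφ.two_le hφ.even p.2.1 (hs.full_src h1).1)
      (occ_node hφ.two_le hφ.even p.2.1 (hs.full_src h1').1) (h2.trans h2'.symm)
    subst this
    rw [← h3, ← h3', hs.full_unique h1 h1']

/-- The strategy of `G` that plays the given strategy outside the cycle and the gadget on it. -/
def liftStrategy (hφ : Embeds G (c 0) (cyclePart G c) n d φ)
    (B : LabelledStrategy (replaceCycle G c l) Ω) (lev : Ω → ℕ) :
    LabelledStrategy G (LiftState n d lev) where
  graph :=
    { Adj := fun p q => p ≠ q ∧ LiftRel n d B lev p q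
      symm := ⟨fun p q h => ⟨h.1.symm, h.2.symm⟩⟩
      loopless := ⟨fun p h => h.1 rfl⟩ }
  pos := liftPos φ B
  move p q := {x | LiftMove φ B p q x.1 x.2}
  move_valid p q h a b hm := ⟨hm.src hφ h.2, (hm.symm hφ h.2).src hφ h.2.symm, hm.adj hφ h.2⟩
  move_left p q h a ha := LiftMove.existsUnique hφ h.2 ha
  move_right p q h b hb := by
    obtain ⟨a, ha, hu⟩ := LiftMove.existsUnique hφ h.2.symm hb
    exact ⟨a, ha.symm hφ h.2.symm, fun a' ha' => hu a' (LiftMove.symm hφ h.2 ha')⟩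
  move_symm p q h a b hm := hm.symm hφ h.2

/-! ### The lifted strategy defends the graph -/

theorem IsLevelling.exists_next (hφ : Embeds G (c 0) (cyclePart G c) n d φ) (hl : IsLevelling B lev)
    (p : LiftState n d lev) {β : Ω}
    (h : B.graph.Adj p.1.1 β) : ∃ q : LiftState n d lev, q.1.1 = β ∧
      (liftStrategy hφ B lev).graph.Adj p q := by
  have h1 := hl.rel _ _ h
  rw [← p.2.2] at h1
  obtain ⟨t, h2, h3⟩ := h1.exists_rel hφ.two_le hφ.even hφ.four_le p.2.1 (hl.le_two β)
  refine ⟨⟨(β, t), h3.2.1, h2⟩, rfl, ?_, Or.inr h, h3⟩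
  intro e
  exact h.ne (congrArg (fun q : LiftState n d lev => q.1.1) e)

/-- Each state of the lifted strategy is joined, or equal, to all states above some state `β` of the
given strategy that has level `1` or `2`. A set of states that meets the states above each such `β`
is therefore dominating. -/
theorem IsLevelling.exists_hub (hl : IsLevelling B lev) (p : LiftState n d lev) :
    ∃ β, (lev β = 1 ∨ lev β = 2) ∧ ∀ q : LiftState n d lev, q.1.1 = β → LiftRel n d B lev p q := by
  by_cases e : lev p.1.1 = 0
  · obtain ⟨β, h1, h2, h3⟩ := hl.hub _ e
    refine ⟨β, ?_, ?_⟩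
    · unfold UpLev at h3; omega
    · rintro q rfl
      refine ⟨Or.inr h1, p.2.1, q.2.1, ?_⟩
      have h4 := p.2.2
      have h5 := q.2.2
      rw [h2]
      rcases h3 with ⟨h3, h6⟩ | ⟨h3, h6⟩
      · rw [h3]
        refine Or.inl ⟨by omega, ?_⟩
        unfold UpLev at h6; omega
      · rw [h3]
        exact Or.inr ⟨h6.1, by omega⟩
  · refine ⟨p.1.1, by have := hl.le_two p.1.1; omega,
      fun q hq => ⟨Or.inl hq.symm, p.2.1, q.2.1, ?_⟩⟩
    rw [hq, flag_self]
    exact Or.inl (by rw [p.2.2, q.2.2, hq])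

theorem IsLevelling.lift_defends (hφ : Embeds G (c 0) (cyclePart G c) n d φ)
    (hl : IsLevelling B lev) {m : ℕ} (hB : B.IsDefending m) (p : LiftState n d lev) (v : V) :
    v ∈ liftPos φ B p ∨ ∃ q, (liftStrategy hφ B lev).graph.Adj p q ∧ v ∈ liftPos φ B q := by
  by_cases hv : v ∈ cyclePart G c
  · obtain ⟨x, h1, h2, rfl⟩ := (hφ.part _).1 hv
    obtain ⟨β, h3, h4⟩ := hl.exists_hub p
    obtain ⟨s, h5, h6, h7⟩ := exists_occ hφ.two_le hφ.even hφ.four_le h3 (x := x) h1.1 (by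
      obtain ⟨j, b⟩ := x
      rcases h1.2 with h | h
      · refine Or.inl ⟨h, Nat.pos_of_ne_zero ?_⟩
        rintro h'
        exact h2 (Prod.ext h' h)
      · exact Or.inr h)
    have h8 := h4 ⟨(β, s), h5, h6⟩ rfl
    have h9 : φ x ∈ liftPos φ B (⟨(β, s), h5, h6⟩ : LiftState n d lev) := Or.inr ⟨x, h7, rfl⟩
    by_cases e : p = ⟨(β, s), h5, h6⟩
    · exact Or.inl (e ▸ h9)
    · exact Or.inr ⟨_, ⟨e, h8⟩, h9⟩
  · have key : ∀ q : LiftState n d lev, Sum.inl ⟨v, hv⟩ ∈ B.pos q.1.1 → v ∈ liftPos φ B q := by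
      intro q hq
      by_cases e : v = c 0
      · refine Or.inr ⟨(0, 0), ?_, hφ.zero.trans e.symm⟩
        refine occ_cyc.2 ⟨by have := hφ.four_le; omega, Or.inr (Or.inl ⟨rfl, ?_⟩)⟩
        subst e
        have := hl.centre _ _ hq
        rw [← q.2.2] at this
        tauto
      · exact Or.inl ⟨e, hv, hq⟩
    rcases hB.2.2 p.1.1 (Sum.inl ⟨v, hv⟩) with h | ⟨β, h1, h2⟩
    · exact Or.inl (key p h)
    · obtain ⟨q, rfl, h3⟩ := hl.exists_next hφ p h1
      exact Or.inr ⟨q, h3, key q h2⟩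

theorem ncard_liftPos [Finite V] (hφ : Embeds G (c 0) (cyclePart G c) n d φ)
    (p : LiftState n d lev) :
    (liftPos φ B p).ncard = (outerPos B p.1.1).ncard + {x | Occ n p.1.2 x}.ncard := by
  unfold liftPos
  rw [Set.ncard_union_eq, Set.InjOn.ncard_image]
  · exact fun x hx y hy h => hφ.inj x y (occ_node hφ.two_le hφ.even p.2.1 hx)
      (occ_node hφ.two_le hφ.even p.2.1 hy) h
  · rw [Set.disjoint_left]
    rintro v ⟨h1, h2, h3⟩ ⟨x, hx, rfl⟩
    rw [hφ.eq_zero (occ_node hφ.two_le hφ.even p.2.1 hx) h2] at h1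
    exact h1 hφ.zero

theorem lift_isDefending [Finite V] (hφ : Embeds G (c 0) (cyclePart G c) n d φ)
    (hl : IsLevelling B lev) {m m' : ℕ} (hB : B.IsDefending m)
    (hm : ∀ α s, IsGadgetState n d s → s.level = lev α → (outerPos B α).ncard +
      {x | Occ n s x}.ncard = m') :
    (liftStrategy hφ B lev).IsDefending m' := by
  obtain ⟨⟨α⟩, -⟩ := id hB
  obtain ⟨s, h1, h2⟩ := exists_isGadgetState hφ.two_le hφ.even hφ.four_le (hl.le_two α)
  refine ⟨⟨⟨(α, s), h1, h2⟩⟩, fun p => ⟨Set.toFinite _, ?_⟩, hl.lift_defends hφ hB⟩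
  exact (ncard_liftPos hφ p).trans (hm _ _ p.2.1 p.2.2)

/-! ### Edge states of the lifted strategy -/

theorem liftMove_kept_iff (hφ : Embeds G (c 0) (cyclePart G c) n d φ) {p q : LiftState n d lev}
    {x y : V}
    (hx : x ∉ cyclePart G c) (hy : y ∉ cyclePart G c) (hxy : x ≠ y) (h : LiftRel n d B lev p q) :
    LiftMove φ B p q x y ↔ p.1.1 ≠ q.1.1 ∧ (Sum.inl ⟨x, hx⟩,
      Sum.inl ⟨y, hy⟩) ∈ B.move p.1.1 q.1.1 := by
  constructor
  · rintro ((⟨-, h1, -⟩ | ⟨h1, -, h2, h3, h4⟩) | ⟨a, b, h1, rfl, rfl⟩)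
    · exact absurd h1 hxy
    · exact ⟨h1, h4⟩
    · have hs := h.isShift hφ
      rw [hφ.eq_zero (occ_node hφ.two_le hφ.even p.2.1 (hs.full_src h1).1) hx,
        hφ.eq_zero (occ_node hφ.two_le hφ.even q.2.1 (hs.full_tgt h1).1) hy] at hxy
      exact absurd rfl hxy
  · rintro ⟨h1, h2⟩
    exact Or.inl (Or.inr ⟨h1, fun h => hxy (h.1.trans h.2.symm), hx, hy, h2⟩)

/-- Whether a guard can pass a kept edge depends only on the state of the given strategy. -/
theorem IsLevelling.mem_leftStates_lift_iff (hφ : Embeds G (c 0) (cyclePart G c) n d φ)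
    (hl : IsLevelling B lev) {x y : V}
    (hx : x ∉ cyclePart G c) (hy : y ∉ cyclePart G c) (hxy : x ≠ y) (p : LiftState n d lev) :
    p ∈ (liftStrategy hφ B lev).leftStates x y ↔ p.1.1 ∈ B.leftStates (Sum.inl ⟨x, hx⟩)
      (Sum.inl ⟨y, hy⟩) := by
  constructor
  · rintro ⟨q, h1, h2⟩
    obtain ⟨h3, h4⟩ := (liftMove_kept_iff hφ hx hy hxy h1.2).1 h2
    exact ⟨q.1.1, h1.2.1.resolve_left h3, h4⟩
  · rintro ⟨β, h1, h2⟩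
    obtain ⟨q, rfl, h3⟩ := hl.exists_next hφ p h1
    exact ⟨q, h3, (liftMove_kept_iff hφ hx hy hxy h3.2).2 ⟨h1.ne, h2⟩⟩

/-- The states above a dominating set of the given strategy form a dominating set. -/
theorem IsLevelling.lift_dominating (hφ : Embeds G (c 0) (cyclePart G c) n d φ)
    (hl : IsLevelling B lev) {S : Set Ω} {S' : Set (LiftState n d lev)}
    (hS : ∀ p : LiftState n d lev, p ∈ S' ↔ p.1.1 ∈ S) (h : S.Nonempty ∧
      B.IsDominating S) : S'.Nonempty ∧ (liftStrategy hφ B lev).IsDominating S' := by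
  constructor
  · obtain ⟨α, hα⟩ := h.1
    obtain ⟨s, h1, h2⟩ := exists_isGadgetState hφ.two_le hφ.even hφ.four_le (hl.le_two α)
    exact ⟨⟨(α, s), h1, h2⟩, (hS _).2 hα⟩
  · intro p
    rcases h.2 p.1.1 with h1 | ⟨β, h1, h2⟩
    · exact Or.inl ((hS _).2 h1)
    · obtain ⟨q, rfl, h3⟩ := hl.exists_next hφ p h2
      exact Or.inr ⟨q, (hS _).2 h1, h3⟩

/-- Edges between vertices that are kept preserve their proper edge states. -/
theorem IsLevelling.lift_proper_kept (hφ : Embeds G (c 0) (cyclePart G c) n d φ)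
    (hl : IsLevelling B lev) {x y : V}
    (hx : x ∉ cyclePart G c) (hy : y ∉ cyclePart G c) (hxy : x ≠ y)
      (h : B.HasProperEdgeStates (Sum.inl ⟨x, hx⟩) (Sum.inl ⟨y, hy⟩)) :
    (liftStrategy hφ B lev).HasProperEdgeStates x y := by
  obtain ⟨h1, h2, h3, h4, h5, h6, h7⟩ := h
  have kL := hl.mem_leftStates_lift_iff hφ hx hy hxy
  have kR := hl.mem_leftStates_lift_iff hφ hy hx hxy.symm
  have kN : ∀ p, p ∈ (liftStrategy hφ B lev).idleStates x y ↔
    p.1.1 ∈ B.idleStates (Sum.inl ⟨x, hx⟩) (Sum.inl ⟨y, hy⟩) := by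
    intro p
    simp only [LabelledStrategy.idleStates, Set.mem_compl_iff, Set.mem_union, kL, kR]
  have dL := hl.lift_dominating hφ kL ⟨h1, h5⟩
  have dR := hl.lift_dominating hφ kR ⟨h2, h6⟩
  have dN := hl.lift_dominating hφ kN ⟨h3, h7⟩
  refine ⟨dL.1, dR.1, dN.1, ?_, dL.2, dR.2, dN.2⟩
  rw [Set.disjoint_left] at h4 ⊢
  exact fun p hp hp' => h4 ((kL p).1 hp) ((kR p).1 hp')

theorem IsLevelling.liftMove_succ_iff (hφ : Embeds G (c 0) (cyclePart G c) n d φ) {j : ℕ}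
    (hj : j < n) {p q : LiftState n d lev} (h : LiftRel n d B lev p q) :
    LiftMove φ B p q (φ (j, 0)) (φ (succIdx n j, 0)) ↔ Flow n p.1.2 q.1.2 j := by
  have h3 : 3 ≤ n := by have := hφ.four_le; omega
  have hs := h.isShift hφ
  have n1 : Node n d (j, 0) := ⟨hj, Or.inl rfl⟩
  have n2 : Node n d (succIdx n j, 0) := ⟨succIdx_lt h3 hj, Or.inl rfl⟩
  have hne : φ (j, 0) ≠ φ (succIdx n j, 0) := (hφ.adj_cyc j hj).ne
  constructor
  · rintro (hm | ⟨x, y, hm, h1, h2⟩)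
    · exfalso
      have e1 : φ (j, 0) ∉ cyclePart G c := by
        rcases hm.src h.1 with h1 | h1
        · exact h1.2.1
        · rw [h1.1]; exact hφ.not_part
      have e2 : φ (succIdx n j, 0) ∉ cyclePart G c := by
        rcases (hm.symm h.1).src h.symm.1 with h1 | h1
        · exact h1.2.1
        · rw [h1.1]; exact hφ.not_part
      rw [hφ.eq_zero n1 e1, hφ.eq_zero n2 e2] at hne
      exact hne rfl
    · have e1 := hφ.inj _ _ (occ_node hφ.two_le hφ.even p.2.1 (hs.full_src hm).1) n1 h1
      have e2 := hφ.inj _ _ (occ_node hφ.two_le hφ.even q.2.1 (hs.full_tgt hm).1) n2 h2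
      subst e1 e2
      rcases hm with hm | hm
      · rcases (cycleMove_from_cyc h3 hj).1 hm with h4 | h4 | ⟨b, h4, -⟩
        · exact h4.2
        · simp only [Prod.mk.injEq, and_true] at h4
          exact absurd h4.1.symm (predIdx_ne_succIdx h3)
        · simp at h4
      · exact absurd (by rw [hm.1]) hne
  · intro hf
    exact Or.inr ⟨_, _, Or.inl ((cycleMove_from_cyc h3 hj).2 (Or.inl ⟨rfl, hf⟩)), rfl, rfl⟩

theorem IsLevelling.liftMove_pred_iff (hφ : Embeds G (c 0) (cyclePart G c) n d φ) {j : ℕ}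
    (hj : j < n) {p q : LiftState n d lev} (h : LiftRel n d B lev p q) :
    LiftMove φ B p q (φ (succIdx n j, 0)) (φ (j, 0)) ↔ Flow n q.1.2 p.1.2 j :=
  ⟨fun hm => (liftMove_succ_iff hφ hj h.symm).1 (hm.symm hφ h), fun hf =>
    LiftMove.symm hφ h.symm ((liftMove_succ_iff hφ hj h.symm).2 hf)⟩

/-- All edges of the cycle have proper edge states in the lifted strategy. -/
theorem IsLevelling.lift_proper_cycle (hφ : Embeds G (c 0) (cyclePart G c) n d φ)
    (hl : IsLevelling B lev) (hΩ : Nonempty Ω)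
    (h0 : n % 4 = 0 → ∀ α, lev α ≠ 2) {j : ℕ} (hj : j < n) :
    (liftStrategy hφ B lev).HasProperEdgeStates (φ (j, 0)) (φ (succIdx n j, 0)) := by
  set S := liftStrategy hφ B lev
  have lL : ∀ p, p ∈ S.leftStates (φ (j, 0)) (φ (succIdx n j, 0)) ↔ ∃ q, S.graph.Adj p q ∧
    Flow n p.1.2 q.1.2 j := fun p =>
    exists_congr fun q => and_congr_right fun h => liftMove_succ_iff hφ hj h.2
  have lR : ∀ p, p ∈ S.leftStates (φ (succIdx n j, 0)) (φ (j, 0)) ↔ ∃ q, S.graph.Adj p q ∧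
    Flow n q.1.2 p.1.2 j := fun p =>
    exists_congr fun q => and_congr_right fun h => liftMove_pred_iff hφ hj h.2
  have hlev : ∀ p : LiftState n d lev, n % 4 = 0 → p.1.2.level ≠ 2 := fun p h => p.2.2 ▸ h0 h _
  -- above each state of level one or two there are states of each of the three kinds
  have core : ∀ β, (lev β = 1 ∨ lev β = 2) → (∃ q : LiftState n d lev, q.1.1 = β ∧
    q ∈ S.leftStates (φ (j, 0)) (φ (succIdx n j, 0))) ∧
      (∃ q : LiftState n d lev, q.1.1 = β ∧ q ∈ S.leftStates (φ (succIdx n j, 0)) (φ (j, 0))) ∧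
      (∃ q : LiftState n d lev, q.1.1 = β ∧ q ∈ S.idleStates (φ (j, 0)) (φ (succIdx n j, 0))) := by
    intro β hβ
    have hβ' : lev β = 1 ∨ lev β = 2 ∧ n % 4 = 2 := by
      have := h0; have := hφ.even
      by_cases e : n % 4 = 0
      · have := h0 e β; omega
      · omega
    obtain ⟨s, t, h1, h2, h3, h4, h5⟩ := exists_flow hφ.two_le hφ.even hφ.four_le hβ' hj
    have hst : s ≠ t := by rintro rfl; exact not_flow_self _ h5
    have hadj : S.graph.Adj (⟨(β, s), h1, h3⟩ : LiftState n d lev) ⟨(β, t), h2, h4⟩ := by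
      refine ⟨?_, Or.inl rfl, h1, h2, ?_⟩
      · intro h; simp only [Subtype.mk.injEq, Prod.mk.injEq, true_and] at h; exact hst h
      · rw [flag_self]; exact Or.inl (h3.trans h4.symm)
    refine ⟨⟨⟨(β, s), h1, h3⟩, rfl, (lL _).2 ⟨_, hadj, h5⟩⟩,
      ⟨⟨(β, t), h2, h4⟩, rfl, (lR _).2 ⟨_, hadj.symm, h5⟩⟩, ?_⟩
    obtain ⟨s, h1, h2, h3⟩ := exists_idle hφ.two_le hφ.even hφ.four_le hβ' hj
    refine ⟨⟨(β, s), h1, h2⟩, rfl, ?_⟩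
    rintro (h | h)
    · obtain ⟨q, h4, h5⟩ := (lL _).1 h
      exact (h3 _ _ _ h4.2.2 (hlev q)).1 h5
    · obtain ⟨q, h4, h5⟩ := (lR _).1 h
      exact (h3 _ _ _ h4.2.2 (hlev q)).2 h5
  have dom : ∀ T : Set (LiftState n d lev), (∀ β, (lev β = 1 ∨ lev β = 2) → ∃ q : LiftState n d lev,
    q.1.1 = β ∧ q ∈ T) → T.Nonempty ∧ S.IsDominating T := by
    intro T hT
    have hD : S.IsDominating T := by
      intro p
      obtain ⟨β, h1, h2⟩ := hl.exists_hub p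
      obtain ⟨q, h3, h4⟩ := hT β h1
      by_cases e : p = q
      · exact Or.inl (e ▸ h4)
      · exact Or.inr ⟨q, h4, e, h2 q h3⟩
    refine ⟨?_, hD⟩
    obtain ⟨α⟩ := hΩ
    obtain ⟨s, h1, h2⟩ := exists_isGadgetState hφ.two_le hφ.even hφ.four_le (hl.le_two α)
    rcases hD ⟨(α, s), h1, h2⟩ with h | ⟨q, h, -⟩
    · exact ⟨_, h⟩
    · exact ⟨_, h⟩
  have dL := dom _ fun β h => (core β h).1
  have dR := dom _ fun β h => (core β h).2.1
  have dN := dom _ fun β h => (core β h).2.2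
  refine ⟨dL.1, dR.1, dN.1, ?_, dL.2, dR.2, dN.2⟩
  rw [Set.disjoint_left]
  intro p hp hp'
  obtain ⟨q, h1, h2⟩ := (lL p).1 hp
  obtain ⟨q', h3, h4⟩ := (lR p).1 hp'
  exact (h2.side hφ.even hφ.four_le h1.2.2 (fun h => ⟨hlev p h, hlev q h⟩) hj).1
    (h4.side hφ.even hφ.four_le h3.2.symm.2 (fun h => ⟨hlev q' h, hlev p h⟩) hj).2
end

/-! ### Levels from the number of guards on the star -/

section
variable {V : Type u} {G : SimpleGraph V} {n : ℕ} [NeZero n] {c : Fin n → V} {l : ℕ} {Ω : Type}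

/-- The new leaves and the connecting vertex they are attached to. -/
def star (c : Fin n → V) (G : SimpleGraph V) (l : ℕ) : Set ({v : V // v ∉ cyclePart G c} ⊕ Fin l) :=
  {x | (∃ i, x = Sum.inr i) ∨ ∃ h, x = Sum.inl ⟨c 0, h⟩}

variable {B : LabelledStrategy (replaceCycle G c l) Ω} {α β : Ω}

/-- The number of guards on the star. -/
noncomputable def starCount (B : LabelledStrategy (replaceCycle G c l) Ω) (α : Ω) : ℕ :=
    (B.pos α ∩ star c G l).ncard

theorem ncard_move [Finite V] (h : B.graph.Adj α β) (S : Set _) : (B.pos α ∩ S).ncard =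
    {x | x ∈ B.move α β ∧ x.1 ∈ S}.ncard := by
  symm
  refine Set.ncard_congr (fun x _ => x.1) ?_ ?_ ?_
  · intro x hx; exact ⟨(B.move_valid _ _ h _ _ hx.1).1, hx.2⟩
  · rintro ⟨a, b⟩ ⟨a', b'⟩ hx hy (rfl : a = a')
    rw [(B.move_left _ _ h _ (B.move_valid _ _ h _ _ hx.1).1).unique hx.1 hy.1]
  · intro a ha
    obtain ⟨b, hb, -⟩ := B.move_left _ _ h _ ha.1
    exact ⟨(a, b), ⟨hb, ha.2⟩, rfl⟩

/-- Guards leave the star only from its centre, at most one at a time. -/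
theorem ncard_move_out [Finite V] (h : B.graph.Adj α β) :
    {x | x ∈ B.move α β ∧ x.1 ∈ star c G l ∧
      x.2 ∉ star c G l}.ncard = if flag B α β then 1 else 0 := by
  have key : ∀ x, (x ∈ B.move α β ∧ x.1 ∈ star c G l ∧ x.2 ∉ star c G l) →
      ∃ hu v hv, v ≠ c 0 ∧ x = (Sum.inl ⟨c 0, hu⟩, Sum.inl ⟨v, hv⟩) := by
    rintro ⟨a, b⟩ ⟨h1, h2, h3⟩
    have h4 := (B.move_valid _ _ h _ _ h1).2.2
    rcases b with ⟨v, hv⟩ | j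
    · have hne : v ≠ c 0 := by rintro rfl; exact h3 (Or.inr ⟨hv, rfl⟩)
      rcases h2 with ⟨i, h2⟩ | ⟨hu, h2⟩
      · simp only at h2; subst h2
        rcases h4 with h4 | h4
        · exact absurd h4 hne
        · simp at h4
      · simp only at h2; subst h2
        exact ⟨hu, v, hv, hne, rfl⟩
    · exact absurd (Or.inl ⟨j, rfl⟩) h3
  by_cases e : flag B α β = true
  · rw [if_pos e, Set.ncard_eq_one]
    obtain ⟨v, h1⟩ := flag_iff.1 e
    rcases h1 with ⟨h1, -⟩ | ⟨-, h2, h3, h4, h5⟩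
    · exact absurd h1 h.ne
    refine ⟨(Sum.inl ⟨c 0, h3⟩, Sum.inl ⟨v, h4⟩), ?_⟩
    ext x
    simp only [Set.mem_ofPred_eq, Set.mem_singleton_iff]
    constructor
    · intro hx
      obtain ⟨hu, w, hw, h6, rfl⟩ := key x hx
      have := (B.move_left _ _ h _ (B.move_valid _ _ h _ _ h5).1).unique h5 hx.1
      rw [← this]
    · rintro rfl
      refine ⟨h5, Or.inr ⟨h3, rfl⟩, ?_⟩
      rintro (⟨i, hi⟩ | ⟨hu, hi⟩)
      · simp at hi
      · simp only [Sum.inl.injEq, Subtype.mk.injEq] at hi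
        exact h2 ⟨rfl, hi⟩
  · rw [if_neg e, Set.ncard_eq_zero]
    refine Set.eq_empty_of_forall_notMem fun x hx => e ?_
    obtain ⟨hu, w, hw, h6, rfl⟩ := key x hx
    exact flag_iff.2 ⟨w, Or.inr ⟨h.ne, fun h => h6 h.2, hu, hw, hx.1⟩⟩

theorem starCount_eq [Finite V] (h : B.graph.Adj α β) : starCount B α =
    {x | x ∈ B.move α β ∧ x.1 ∈ star c G l ∧
      x.2 ∈ star c G l}.ncard + if flag B α β then 1 else 0 := by
  rw [starCount, ncard_move h, ← ncard_move_out h, ← Set.ncard_union_eq]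
  · congr 1; ext x
    simp only [Set.mem_ofPred_eq, Set.mem_union]; tauto
  · rw [Set.disjoint_left]
    exact fun x hx hx' => hx'.2.2 hx.2.2

/-- The number of guards on the star changes only by the guards that pass its centre. -/
theorem starCount_flag [Finite V] (h : B.graph.Adj α β) : starCount B α +
    (if flag B β α then 1 else 0) = starCount B β + if flag B α β then 1 else 0 := by
  have h1 := starCount_eq h
  have h2 := starCount_eq h.symm
  have h3 : {x | x ∈ B.move α β ∧ x.1 ∈ star c G l ∧ x.2 ∈ star c G l}.ncard =
    {x | x ∈ B.move β α ∧ x.1 ∈ star c G l ∧ x.2 ∈ star c G l}.ncard := by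
    refine Set.ncard_congr (fun x _ => x.swap) ?_ ?_ ?_
    · rintro ⟨a, b⟩ ⟨h1, h2, h3⟩; exact ⟨B.move_symm _ _ h _ _ h1, h3, h2⟩
    · intro a b _ _ hab; exact Prod.swap_injective hab
    · rintro ⟨a, b⟩ ⟨h1, h2, h3⟩; exact ⟨(b, a), ⟨B.move_symm _ _ h.symm _ _ h1, h3, h2⟩, rfl⟩
  omega

theorem flag_centre (hu : c 0 ∉ cyclePart G c) (h : B.graph.Adj α β) (hf : flag B α β = true) :
    Sum.inl ⟨c 0, hu⟩ ∈ B.pos α := by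
  obtain ⟨v, h1⟩ := flag_iff.1 hf
  rcases h1 with ⟨h1, -⟩ | ⟨-, h2, h3, h4, h5⟩
  · exact absurd h1 h.ne
  · exact (B.move_valid _ _ h _ _ h5).1

theorem leaf_or_centre (hu : c 0 ∉ cyclePart G c) {m : ℕ} (hB : B.IsDefending m) (α : Ω)
    (i : Fin l) :
    Sum.inr i ∈ B.pos α ∨ Sum.inl ⟨c 0, hu⟩ ∈ B.pos α := by
  rcases hB.2.2 α (Sum.inr i) with h | ⟨β, h1, h2⟩
  · exact Or.inl h
  · obtain ⟨a, ha, -⟩ := B.move_right _ _ h1 _ h2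
    have h3 := B.move_valid _ _ h1 _ _ ha
    rcases a with ⟨a, ha'⟩ | j
    · rcases h3.2.2 with h4 | h4
      · have h5 : a = c 0 := h4
        subst h5; exact Or.inr h3.1
      · simp at h4
    · rcases h3.2.2 with h4 | h4
      · exact absurd h4 id
      · exact Or.inl (h4 ▸ h3.1)

theorem ncard_outerPos [Finite V] (B : LabelledStrategy (replaceCycle G c l) Ω) (α : Ω) :
    (outerPos B α).ncard + starCount B α = (B.pos α).ncard := by
  have h1 : (outerPos B α).ncard = (B.pos α \ star c G l).ncard := by
    refine Set.ncard_congr (fun v hv => Sum.inl ⟨v, hv.2.1⟩) ?_ ?_ ?_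
    · rintro v ⟨h1, h2, h3⟩
      refine ⟨h3, ?_⟩
      rintro (⟨i, hi⟩ | ⟨hu, hi⟩)
      · simp at hi
      · simp only [Sum.inl.injEq, Subtype.mk.injEq] at hi
        exact h1 hi
    · intro v w _ _ h
      simpa using h
    · rintro (⟨v, hv⟩ | i) ⟨h1, h2⟩
      · exact ⟨v, ⟨fun h => h2 (Or.inr ⟨h ▸ hv, by simp [h]⟩), hv, h1⟩, rfl⟩
      · exact absurd (Or.inl ⟨i, rfl⟩) h2
  rw [h1, starCount, add_comm, Set.ncard_inter_add_ncard_sdiff_eq_ncard]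

open Classical in
/-- The level for one new leaf: `0` if only the connecting vertex holds a guard, `1` if only the
leaf does, and `2` if both do. -/
noncomputable def levOne (hu : c 0 ∉ cyclePart G c) (B : LabelledStrategy (replaceCycle G c 1) Ω)
    (α : Ω) : ℕ :=
  if Sum.inl ⟨c 0, hu⟩ ∈ B.pos α then (if Sum.inr 0 ∈ B.pos α then 2 else 0) else 1

open Classical in
theorem starCount_one (hu : c 0 ∉ cyclePart G c) (B : LabelledStrategy (replaceCycle G c 1) Ω)
    (α : Ω) :
    starCount B α = (if Sum.inl ⟨c 0, hu⟩ ∈ B.pos α then 1 else 0) +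
      (if Sum.inr 0 ∈ B.pos α then 1 else 0) := by
  have hs : star c G 1 = {Sum.inl ⟨c 0, hu⟩, Sum.inr 0} := by
    ext x
    simp only [star, Set.mem_ofPred_eq, Set.mem_insert_iff, Set.mem_singleton_iff]
    constructor
    · rintro (⟨i, rfl⟩ | ⟨h, rfl⟩)
      · exact Or.inr (by rw [Subsingleton.elim i 0])
      · exact Or.inl rfl
    · rintro (h | h)
      · exact Or.inr ⟨hu, h⟩
      · exact Or.inl ⟨0, h⟩
  unfold starCount
  rw [hs]
  split_ifs with h1 h2 h2
  · rw [Set.inter_eq_right.2 (by rintro x (rfl | rfl) <;> assumption), Set.ncard_pair (by simp)]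
  · rw [show B.pos α ∩ {Sum.inl ⟨c 0, hu⟩, Sum.inr 0} = {Sum.inl ⟨c 0, hu⟩} by
      ext x; simp only [Set.mem_inter_iff, Set.mem_insert_iff, Set.mem_singleton_iff]
      constructor
      · rintro ⟨h3, rfl | rfl⟩
        · rfl
        · exact absurd h3 h2
      · rintro rfl; exact ⟨h1, Or.inl rfl⟩]
    simp
  · rw [show B.pos α ∩ {Sum.inl ⟨c 0, hu⟩, Sum.inr 0} = {Sum.inr 0} by
      ext x; simp only [Set.mem_inter_iff, Set.mem_insert_iff, Set.mem_singleton_iff]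
      constructor
      · rintro ⟨h3, rfl | rfl⟩
        · exact absurd h3 h1
        · rfl
      · rintro rfl; exact ⟨h2, Or.inr rfl⟩]
    simp
  · rw [Set.ncard_eq_zero]
    refine Set.eq_empty_of_forall_notMem ?_
    rintro x ⟨h3, rfl | rfl⟩
    · exact h1 h3
    · exact h2 h3

theorem starCount_levOne (hu : c 0 ∉ cyclePart G c) {B : LabelledStrategy (replaceCycle G c 1) Ω}
    {m : ℕ} (hB : B.IsDefending m) (α : Ω) :
    starCount B α = if levOne hu B α = 2 then 2 else 1 := by
  rw [starCount_one hu, levOne]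
  have := leaf_or_centre hu hB α 0
  split_ifs <;> first | rfl | tauto

theorem isLevelling_levOne [Finite V] (hu : c 0 ∉ cyclePart G c) (h2 : n % 4 = 2)
    {B : LabelledStrategy (replaceCycle G c 1) Ω} {m : ℕ}
    (hB : B.IsDefending m) : IsLevelling B (levOne hu B) := by
  have hc : ∀ α, Sum.inl ⟨c 0, hu⟩ ∈ B.pos α ↔ levOne hu B α ≠ 1 := by
    intro α; unfold levOne; split_ifs <;> simp_all
  have hle : ∀ α, levOne hu B α ≤ 2 := by intro α; unfold levOne; split_ifs <;> omega
  have hrel : ∀ α β, B.graph.Adj α β → LevRel n (flag B α β) (flag B β α) (levOne hu B α)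
    (levOne hu B β) := by
    intro α β h
    have h3 := starCount_flag h
    rw [starCount_levOne hu hB, starCount_levOne hu hB] at h3
    have h4 := fun e => (hc α).1 (flag_centre hu h e)
    have h5 := fun e => (hc β).1 (flag_centre hu h.symm e)
    have h6 := hle α
    have h7 := hle β
    cases e1 : flag B α β <;> cases e2 : flag B β α <;> simp only
      [e1, e2, forall_const, LevRel, UpLev, if_true, Bool.false_eq_true, if_false] at * <;>
      split_ifs at h3 <;> omega
  refine ⟨hle, hrel, fun α h h' => Or.inl ((hc α).1 h'), fun α hα => ?_⟩
  have hn : Sum.inr 0 ∉ B.pos α := by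
    intro h
    have := (hc α).2 (by omega)
    simp only [levOne, this, h, if_true] at hα
    omega
  obtain ⟨β, h1, h3⟩ := (hB.2.2 α (Sum.inr 0)).resolve_left hn
  refine ⟨β, h1, ?_⟩
  have hβ : levOne hu B β ≠ 0 := by
    unfold levOne; rw [if_pos h3]; split_ifs <;> omega
  have h4 := hrel _ _ h1
  have h5 := starCount_flag h1
  rw [starCount_levOne hu hB, starCount_levOne hu hB] at h5
  have h6 := fun e => (hc β).1 (flag_centre hu h1.symm e)
  have := hle β
  cases e1 : flag B α β <;> cases e2 : flag B β α <;> simp only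
    [e1, e2, hα, forall_const, LevRel, UpLev, if_true, Bool.false_eq_true, if_false] at * <;>
      split_ifs at h5 <;> first | omega | (simp; omega)

theorem starCount_two_le (hu : c 0 ∉ cyclePart G c) [Finite V]
    (B : LabelledStrategy (replaceCycle G c 2) Ω) (α : Ω) :
    starCount B α ≤ 3 ∧ (starCount B α = 3 → Sum.inr 0 ∈ B.pos α ∧ Sum.inr 1 ∈ B.pos α) := by
  have hs : star c G 2 = {Sum.inl ⟨c 0, hu⟩, Sum.inr 0, Sum.inr 1} := by
    ext x
    simp only [star, Set.mem_ofPred_eq, Set.mem_insert_iff, Set.mem_singleton_iff]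
    constructor
    · rintro (⟨i, rfl⟩ | ⟨h, rfl⟩)
      · fin_cases i <;> simp
      · exact Or.inl rfl
    · rintro (h | h | h)
      · exact Or.inr ⟨hu, h⟩
      · exact Or.inl ⟨0, h⟩
      · exact Or.inl ⟨1, h⟩
  have h3 : (star c G 2).ncard = 3 := by
    rw [hs]; rw [Set.ncard_eq_three]; exact ⟨_, _, _, by simp, by simp, by simp, rfl⟩
  refine ⟨h3 ▸ Set.ncard_le_ncard Set.inter_subset_right, fun h => ?_⟩
  have h4 : B.pos α ∩ star c G 2 = star c G 2 := Set.eq_of_subset_of_ncard_le Set.inter_subset_right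
    (by rw [h3]; exact h.ge)
  exact ⟨(h4.ge (Or.inl ⟨0, rfl⟩)).1, (h4.ge (Or.inl ⟨1, rfl⟩)).1⟩

theorem two_le_starCount [Finite V] {B : LabelledStrategy (replaceCycle G c l) Ω} {α : Ω} {x y}
    (hx : x ∈ B.pos α ∩ star c G l) (hy : y ∈ B.pos α ∩ star c G l)
      (h : x ≠ y) : 2 ≤ starCount B α := by
  rw [← Set.ncard_pair h]
  exact Set.ncard_le_ncard (by rintro z (rfl | rfl) <;> assumption)

theorem one_le_starCount_two [Finite V] (hu : c 0 ∉ cyclePart G c)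
    {B : LabelledStrategy (replaceCycle G c 2) Ω} {m : ℕ} (hB : B.IsDefending m) (α : Ω) :
    1 ≤ starCount B α := by
  refine (Set.ncard_pos (Set.toFinite _)).2 ?_
  rcases leaf_or_centre hu hB α 0 with h | h
  · exact ⟨_, h, Or.inl ⟨0, rfl⟩⟩
  · exact ⟨_, h, Or.inr ⟨hu, rfl⟩⟩

/-- For two new leaves the level is one less than the number of guards on the star. -/
theorem isLevelling_two [Finite V] (hu : c 0 ∉ cyclePart G c) (h0 : n % 4 = 0)
    {B : LabelledStrategy (replaceCycle G c 2) Ω} {m : ℕ}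
    (hB : B.IsDefending m) : IsLevelling B (fun α => starCount B α - 1) := by
  have hle := fun α => (starCount_two_le hu B α).1
  have hge := one_le_starCount_two hu hB
  refine ⟨fun α => by have := hle α; omega, fun α β h => ?_, fun _ _ _ => Or.inr h0, fun α hα => ?_⟩
  · have h1 := starCount_flag h
    have := hle α; have := hle β; have := hge α; have := hge β
    cases e1 : flag B α β <;> cases e2 : flag B β α <;> simp only
      [e1, e2, LevRel, UpLev, if_true, Bool.false_eq_true, if_false] at * <;>
      omega
  · have ha := hge α
    have key : ∀ α, Sum.inr 0 ∈ B.pos α → 2 ≤ starCount B α := by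
      intro α h
      rcases leaf_or_centre hu hB α 1 with h1 | h1
      · exact two_le_starCount ⟨h, Or.inl ⟨_, rfl⟩⟩ ⟨h1, Or.inl ⟨_, rfl⟩⟩ (by simp)
      · exact two_le_starCount ⟨h, Or.inl ⟨_, rfl⟩⟩ ⟨h1, Or.inr ⟨_, rfl⟩⟩ (by simp)
    have hn : Sum.inr 0 ∉ B.pos α := fun h => by have := key α h; omega
    obtain ⟨β, h1, h3⟩ := (hB.2.2 α (Sum.inr 0)).resolve_left hn
    have h4 := starCount_flag h1
    have h5 := key β h3
    refine ⟨β, h1, ?_⟩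
    cases e1 : flag B α β <;> cases e2 : flag B β α <;> simp only
      [e1, e2, UpLev, if_true, Bool.false_eq_true, if_false] at * <;>
      first | omega | (simp; omega)

theorem lift_isDefending_one [Finite V] {d : ℕ → ℕ} {φ : ℕ × ℕ → V}
    (hφ : Embeds G (c 0) (cyclePart G c) n d φ) {k : ℕ} (hn : n = 4 * k + 2)
    {B : LabelledStrategy (replaceCycle G c 1) Ω} {m : ℕ} (hB : B.IsDefending m) :
    (liftStrategy hφ B (levOne hφ.not_part B)).IsDefending (m + (3 * k + 1)) := by
  refine lift_isDefending hφ (isLevelling_levOne hφ.not_part (by omega) hB) hB fun α s h1 h2 => ?_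
  rw [(ncard_occ hφ.two_le hφ.four_le h1).1 hn, h2, ← starCount_levOne hφ.not_part hB,
    ← (hB.2.1 α).2, ← ncard_outerPos]
  omega

theorem lift_isDefending_two [Finite V] {d : ℕ → ℕ} {φ : ℕ × ℕ → V}
    (hφ : Embeds G (c 0) (cyclePart G c) n d φ) {k : ℕ} (hn : n = 4 * k + 4)
    {B : LabelledStrategy (replaceCycle G c 2) Ω} {m : ℕ} (hB : B.IsDefending m) :
    (liftStrategy hφ B (fun α => starCount B α - 1)).IsDefending (m + (3 * k + 2)) := by
  refine lift_isDefending hφ (isLevelling_two hφ.not_part (by omega) hB) hB fun α s h1 h2 => ?_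
  have := one_le_starCount_two hφ.not_part hB α
  rw [(ncard_occ hφ.two_le hφ.four_le h1).2 hn, h2, ← (hB.2.1 α).2, ← ncard_outerPos]
  omega
end

/-! ### Leaf cycles with alternating colours -/

section
variable {V : Type u} {G : SimpleGraph V} {n : ℕ} [NeZero n] {c : Fin n → V}

/-- The vertex with cyclic index `j` on the cycle. -/
def cyc (c : Fin n → V) (j : ℕ) : V := c (Fin.ofNat n j)

theorem cyc_val (c : Fin n → V) (i : Fin n) : cyc c i.val = c i := by
  unfold cyc; congr 1; ext; simp

theorem cyc_zero (c : Fin n → V) : cyc c 0 = c 0 := by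
  unfold cyc; congr 1

theorem cyc_mod (c : Fin n → V) (j : ℕ) : cyc c (j % n) = cyc c j := by
  unfold cyc; congr 1; ext; simp

theorem cyc_add (c : Fin n → V) (j : ℕ) : cyc c (j + n) = cyc c j := by
  rw [← cyc_mod, Nat.add_mod_right, cyc_mod]

theorem cyc_succ (c : Fin n → V) (j : ℕ) : cyc c (j + 1) = c (Fin.ofNat n j + 1) := by
  unfold cyc; congr 1; ext; simp [Fin.val_add]

theorem cyc_val_succ (c : Fin n → V) (i : Fin n) : cyc c (i.val + 1) = c (i + 1) := by
  rw [cyc_succ]; congr 2; ext; simp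

theorem cyc_succIdx (c : Fin n → V) {j : ℕ} : cyc c (succIdx n j) = cyc c (j + 1) := by
  unfold succIdx; split_ifs with h
  · rw [h]; simpa using (cyc_add c 0).symm
  · rfl

theorem cyc_adj (hc : IsLeafCycle G c) (j : ℕ) : G.Adj (cyc c j) (cyc c (j + 1)) := by
  rw [cyc_succ]; exact hc.adj _

theorem cyc_inj (hc : IsLeafCycle G c) {i j : ℕ} (h : cyc c i = cyc c j) : i % n = j % n := by
  have := congrArg Fin.val (hc.injective h)
  simpa using this

theorem range_cyc (c : Fin n → V) (v : V) : v ∈ Set.range c ↔ ∃ j < n, v = cyc c j := by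
  constructor
  · rintro ⟨i, rfl⟩; exact ⟨i, i.2, (cyc_val c i).symm⟩
  · rintro ⟨j, -, rfl⟩; exact ⟨_, rfl⟩

theorem IsLeaf.unique {v a b : V} (h : IsLeaf G v) (ha : G.Adj v a) (hb : G.Adj v b) : a = b :=
    ExistsUnique.unique h ha hb

theorem cyc_not_leaf (hc : IsLeafCycle G c) (j : ℕ) : ¬ IsLeaf G (cyc c j) := by
  intro h
  have h1 := cyc_adj hc j
  have h2 := cyc_adj hc (j + n - 1)
  have h3 := hc.three_le
  rw [show j + n - 1 + 1 = j + n by omega, cyc_add] at h2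
  have h4 := cyc_inj hc (h.unique h1 h2.symm)
  rw [show j + n - 1 = j + 1 + (n - 2) by omega] at h4
  have h5 : (n - 2) % n = 0 := by
    have h6 : (j + 1) + 0 ≡ (j + 1) + (n - 2) [MOD n] := h4
    exact (show (n - 2) % n = 0 % n from (Nat.ModEq.add_left_cancel' _ h6).symm).trans
      (Nat.zero_mod n)
  rw [Nat.mod_eq_of_lt (by omega)] at h5
  omega

theorem mem_cyclePart_iff (v : V) : v ∈ cyclePart G c ↔ ∃ j, 0 < j ∧ j < n ∧
    (v = cyc c j ∨ (G.Adj (cyc c j) v ∧ IsLeaf G v)) := by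
  constructor
  · rintro ⟨i, h1, h2⟩
    refine ⟨i.val, Nat.pos_of_ne_zero fun h => h1 (by ext; simpa using h), i.2, ?_⟩
    rwa [cyc_val]
  · rintro ⟨j, h1, h2, h3⟩
    refine ⟨⟨j, h2⟩, fun h => by simp [Fin.ext_iff] at h; omega, ?_⟩
    rwa [← cyc_val c ⟨j, h2⟩]

theorem flatten_rw (j i : ℕ) (hi : i < 2 * j) :
    (List.replicate j [Color.white, Color.red]).flatten[i]? = some
      (if i % 2 = 0 then Color.white else Color.red) := by
  induction j generalizing i with
  | zero => omega
  | succ j ih =>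
    rw [List.replicate_succ, List.flatten_cons]
    rcases i with _ | _ | i
    · rfl
    · rfl
    · simp only [List.cons_append, List.nil_append, List.getElem?_cons_succ]
      rw [ih i (by omega)]
      congr 2
      simp only [eq_iff_iff]; omega

theorem length_flatten_rw (j : ℕ) : (List.replicate j [Color.white,
    Color.red]).flatten.length = 2 * j := by
  simp [mul_comm]

theorem length_of_leafSequence {j : ℕ} (h : leafSequence G c = rwSequence j) : n = 2 * j + 2 := by
  have := congrArg List.length h
  simp only [leafSequence, rwSequence, List.length_append, List.length_ofFn, length_flatten_rw,
    List.length_cons, List.length_nil] at this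
  omega

theorem color_of_leafSequence {j : ℕ} (h : leafSequence G c = rwSequence j) {i : ℕ} (h0 : 0 < i)
    (hi : i < n) :
    color G c ⟨i, hi⟩ = if i % 2 = 0 then .white else .red := by
  have hn := length_of_leafSequence h
  have h1 : (leafSequence G c)[i]? = some (color G c ⟨i, hi⟩) := by
    unfold leafSequence
    rw [List.getElem?_append_left (by simpa using hi)]
    simp [hi]
  rw [h] at h1
  have h2 : (rwSequence j)[i]? = some (if i % 2 = 0 then .white else .red) := by
    unfold rwSequence
    rcases i with _ | _ | i
    · omega
    · rfl
    · simp only [List.cons_append, List.nil_append, List.getElem?_cons_succ]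
      rw [List.getElem?_append_left (by rw [length_flatten_rw]; omega), flatten_rw _ _ (by omega)]
      congr 2
      simp only [eq_iff_iff]; omega
  rw [h2] at h1
  exact (Option.some.inj h1).symm

theorem leafCount_of_leafSequence {j : ℕ} (h : leafSequence G c = rwSequence j) {i : ℕ} :
    (i % 2 = 1 → 2 ≤ leafCount G (cyc c i)) ∧ (0 < i → i < n → i % 2 = 0 →
      leafCount G (cyc c i) = 0) := by
  have hn := length_of_leafSequence h
  have key : ∀ i, 0 < i → ∀ hi : i < n, (i % 2 = 1 → 2 ≤ leafCount G (cyc c i)) ∧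
    (i % 2 = 0 → leafCount G (cyc c i) = 0) := by
    intro i h0 hi
    have h1 := color_of_leafSequence h h0 hi
    have h2 : cyc c i = c ⟨i, hi⟩ := by rw [← cyc_val c ⟨i, hi⟩]
    rw [h2]
    unfold color at h1
    rw [if_neg (by simp [Fin.ext_iff]; omega)] at h1
    constructor <;> intro h3
    · rw [if_neg (by omega : ¬ i % 2 = 0)] at h1
      by_contra h4
      split_ifs at h1
      omega
    · rw [if_pos h3] at h1
      split_ifs at h1
      assumption
  refine ⟨fun hi => ?_, fun h0 h1 => (key i h0 h1).2⟩
  rw [← cyc_mod]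
  have h3 : i % n % 2 = 1 := by rw [Nat.mod_mod_of_dvd _ ⟨j + 1, by omega⟩]; exact hi
  exact (key (i % n) (by omega) (Nat.mod_lt _ (by omega))).1 h3

/-- An enumeration of a finite set by natural numbers; the values from `S.ncard` on are
arbitrary. -/
theorem exists_enum [Finite V] (v₀ : V) (S : Set V) : ∃ f : ℕ → V, (∀ b < S.ncard, f b ∈ S) ∧
    (∀ a < S.ncard, ∀ b < S.ncard, f a = f b → a = b) ∧ ∀ v ∈ S, ∃ b < S.ncard, f b = v := by
  have hS : S.Finite := Set.toFinite S
  have := hS.to_subtype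
  let e : S ≃ Fin S.ncard := Finite.equivFinOfCardEq (by rfl)
  refine ⟨fun b => if h : b < S.ncard then (e.symm ⟨b, h⟩).1 else v₀, ?_, ?_, ?_⟩
  · intro b hb; simp only [dif_pos hb]; exact (e.symm ⟨b, hb⟩).2
  · intro a ha b hb h
    simp only [dif_pos ha, dif_pos hb] at h
    have := e.symm.injective (Subtype.ext h)
    simpa using this
  · intro v hv
    refine ⟨(e ⟨v, hv⟩).1, (e ⟨v, hv⟩).2, ?_⟩
    simp

/-- A cycle whose odd vertices are red and whose even vertices are white carries the gadget. -/
theorem exists_embeds [Finite V] (hc : IsLeafCycle G c) {j : ℕ}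
    (h : leafSequence G c = rwSequence j) (hj : 1 ≤ j) :
    ∃ φ : ℕ × ℕ → V, Embeds G (c 0) (cyclePart G c) n (fun i => leafCount G (cyc c i)) φ ∧
      ∀ i, φ (i, 0) = cyc c i := by
  have hn := length_of_leafSequence h
  choose f hf1 hf2 hf3 using fun i : ℕ => exists_enum (c 0) {w | G.Adj (cyc c i) w ∧ IsLeaf G w}
  let φ : ℕ × ℕ → V := fun x => match x with
    | (i, 0) => cyc c i
    | (i, b + 1) => f i b
  have hl : ∀ i b, Node n (fun i => leafCount G (cyc c i)) (i, b + 1) → G.Adj (cyc c i) (f i b) ∧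
    IsLeaf G (f i b) := by
    intro i b hb
    exact hf1 i b (hb.2.resolve_left (by simp)).2
  have hcl : ∀ i j b, Node n (fun i => leafCount G (cyc c i)) (j, b + 1) → cyc c i ≠ f j b := by
    intro i j b hb e
    exact cyc_not_leaf hc i (e ▸ (hl j b hb).2)
  have hci : ∀ i j, i < n → j < n → cyc c i = cyc c j → i = j := by
    intro i j h1 h2 h3
    have := cyc_inj hc h3
    rwa [Nat.mod_eq_of_lt h1, Nat.mod_eq_of_lt h2] at this
  refine ⟨φ, ⟨by omega, by omega, fun i => (leafCount_of_leafSequence h).1, cyc_zero c,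
    ?_, ?_, ?_, ?_⟩, fun i => rfl⟩
  · rintro ⟨i, _ | a⟩ ⟨i', _ | a'⟩ h1 h2 h3
    · rw [hci i i' h1.1 h2.1 h3]
    · exact absurd h3 (hcl _ _ _ h2)
    · exact absurd h3.symm (hcl _ _ _ h1)
    · have e1 := hl i a h1
      have e2 := hl i' a' h2
      have h3 : f i a = f i' a' := h3
      rw [← h3] at e2
      have e3 := hci _ _ h1.1 h2.1 (e1.2.unique e1.1.symm e2.1.symm)
      subst e3
      rw [hf2 i a (h1.2.resolve_left (by simp)).2 a' (h2.2.resolve_left (by simp)).2 h3]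
  · intro v
    rw [mem_cyclePart_iff]
    constructor
    · rintro ⟨i, h1, h2, rfl | h3⟩
      · exact ⟨(i, 0), ⟨h2, Or.inl rfl⟩, by simp; omega, rfl⟩
      · obtain ⟨b, hb, rfl⟩ := hf3 i v h3
        have hb' : b < leafCount G (cyc c i) := hb
        refine ⟨(i, b + 1), ⟨h2, Or.inr ⟨?_, hb'⟩⟩, by simp, rfl⟩
        by_contra hi
        rw [(leafCount_of_leafSequence h).2 h1 h2 (by omega)] at hb'
        omega
    · rintro ⟨⟨i, _ | b⟩, h1, h2, rfl⟩
      · exact ⟨i, Nat.pos_of_ne_zero fun h => h2 (by rw [h]), h1.1, Or.inl rfl⟩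
      · have := (h1.2.resolve_left (by simp)).1
        simp only at this
        exact ⟨i, by omega, h1.1, Or.inr (hl i b h1)⟩
  · intro i hi
    show G.Adj (cyc c i) (cyc c (succIdx n i))
    rw [cyc_succIdx]; exact cyc_adj hc i
  · intro i b hb
    exact (hl i b hb).1
end

/-! ### Cycles of a cactus -/

section
variable {V : Type u} {G : SimpleGraph V}

theorem exists_path_of_seq (m : ℕ) (g : ℕ → V) (hg : ∀ k < m, G.Adj (g k) (g (k + 1)))
    (hi : ∀ k ≤ m, ∀ k' ≤ m, g k = g k' → k = k') :
    ∃ p : G.Walk (g 0) (g m), p.IsPath ∧ (∀ v, v ∈ p.support ↔ ∃ k ≤ m, v = g k) ∧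
      ∀ e, e ∈ p.edges ↔ ∃ k < m, e = s(g k, g (k + 1)) := by
  induction m generalizing g with
  | zero =>
    refine ⟨SimpleGraph.Walk.nil, by simp, fun v => ?_, fun e => by simp⟩
    simp
  | succ m ih =>
    obtain ⟨p, h1, h2, h3⟩ := ih (fun k => g (k + 1)) (fun k hk => hg _ (by omega))
      (fun k hk k' hk' h => by have := hi _ (by omega) _ (by omega) h; omega)
    refine ⟨SimpleGraph.Walk.cons (hg 0 (by omega)) p, ?_, fun v => ?_, fun e => ?_⟩
    · rw [SimpleGraph.Walk.cons_isPath_iff]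
      refine ⟨h1, fun h => ?_⟩
      obtain ⟨k, hk, h4⟩ := (h2 _).1 h
      have := hi 0 (by omega) (k + 1) (by omega) h4
      omega
    · rw [SimpleGraph.Walk.support_cons, List.mem_cons, h2]
      constructor
      · rintro (rfl | ⟨k, hk, rfl⟩)
        · exact ⟨0, by omega, rfl⟩
        · exact ⟨k + 1, by omega, rfl⟩
      · rintro ⟨_ | k, hk, rfl⟩
        · exact Or.inl rfl
        · exact Or.inr ⟨k, by omega, rfl⟩
    · rw [SimpleGraph.Walk.edges_cons, List.mem_cons, h3]
      constructor
      · rintro (rfl | ⟨k, hk, rfl⟩)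
        · exact ⟨0, by omega, rfl⟩
        · exact ⟨k + 1, by omega, rfl⟩
      · rintro ⟨_ | k, hk, rfl⟩
        · exact Or.inl rfl
        · exact Or.inr ⟨k, by omega, rfl⟩

theorem exists_cycle_of_seq {m : ℕ} (hm : 2 ≤ m) (g : ℕ → V) (hg : ∀ k < m, G.Adj (g k) (g (k + 1)))
    (hg' : G.Adj (g m) (g 0))
    (hi : ∀ k ≤ m, ∀ k' ≤ m, g k = g k' → k = k') :
    ∃ p : G.Walk (g m) (g m), p.IsCycle ∧ ∀ e, e ∈ p.edges ↔ e = s(g m, g 0) ∨ ∃ k < m,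
      e = s(g k, g (k + 1)) := by
  obtain ⟨p, h1, h2, h3⟩ := exists_path_of_seq m g hg hi
  refine ⟨SimpleGraph.Walk.cons hg' p, ?_, fun e => ?_⟩
  · rw [SimpleGraph.Walk.cons_isCycle_iff]
    refine ⟨h1, fun h => ?_⟩
    obtain ⟨k, hk, h4⟩ := (h3 _).1 h
    rw [Sym2.eq_iff] at h4
    rcases h4 with ⟨h4, h5⟩ | ⟨h4, h5⟩
    · have := hi _ le_rfl _ (by omega) h4; omega
    · have := hi _ le_rfl _ (by omega) h4
      have := hi 0 (by omega) _ (by omega) h5; omega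
  · rw [SimpleGraph.Walk.edges_cons, List.mem_cons, h3]

variable {n : ℕ} [NeZero n] {c : Fin n → V}

/-- The edges of the cycle `c`. -/
def IsCycEdge (c : Fin n → V) (e : Sym2 V) : Prop := ∃ k, e = s(cyc c k, cyc c (k + 1))

theorem exists_cycle_of_leafCycle (hc : IsLeafCycle G c) :
    ∃ (a : V) (p : G.Walk a a), p.IsCycle ∧ ∀ e, e ∈ p.edges ↔ IsCycEdge c e := by
  have h3 := hc.three_le
  have hn : cyc c (n - 1 + 1) = cyc c 0 := by
    rw [show n - 1 + 1 = 0 + n by omega, cyc_add]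
  obtain ⟨p, h1, h2⟩ := exists_cycle_of_seq (m := n - 1) (by omega) (cyc c)
    (fun k _ => cyc_adj hc k) (hn ▸ cyc_adj hc (n - 1))
    (fun k hk k' hk' h => by
      have := cyc_inj hc h
      rwa [Nat.mod_eq_of_lt (by omega), Nat.mod_eq_of_lt (by omega)] at this)
  refine ⟨_, p, h1, fun e => ?_⟩
  rw [h2]
  constructor
  · rintro (rfl | ⟨k, -, rfl⟩)
    · exact ⟨n - 1, by rw [hn]⟩
    · exact ⟨k, rfl⟩
  · rintro ⟨k, rfl⟩
    have e1 : cyc c (k + 1) = cyc c (k % n + 1) := by rw [← cyc_mod, ← cyc_mod c (k % n + 1)]; simp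
    rw [e1, ← cyc_mod c k]
    have h4 := Nat.mod_lt k (show n > 0 by omega)
    by_cases e : k % n = n - 1
    · left; rw [e, hn]
    · right; exact ⟨k % n, by omega, rfl⟩

theorem cycEdge_congr (hG : IsCactus G) (hc : IsLeafCycle G c) {n' : ℕ} [NeZero n']
    {c' : Fin n' → V} (hc' : IsLeafCycle G c')
    {e : Sym2 V} (h : IsCycEdge c e) (h' : IsCycEdge c' e) (f : Sym2 V) : IsCycEdge c f ↔
      IsCycEdge c' f := by
  obtain ⟨a, p, hp, hp'⟩ := exists_cycle_of_leafCycle hc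
  obtain ⟨b, q, hq, hq'⟩ := exists_cycle_of_leafCycle hc'
  rw [← hp', ← hq']
  exact hG.2 a b p q hp hq e ((hp' e).2 h) ((hq' e).2 h') f

theorem cyc_add_inj (hc : IsLeafCycle G c) {i k k' : ℕ} (hk : k < n) (hk' : k' < n)
    (h : cyc c (i + k) = cyc c (i + k')) : k = k' := by
  have h1 : i + k ≡ i + k' [MOD n] := cyc_inj hc h
  have h2 : k % n = k' % n := Nat.ModEq.add_left_cancel' _ h1
  rwa [Nat.mod_eq_of_lt hk, Nat.mod_eq_of_lt hk'] at h2

/-- In a cactus the cycle has no chords, as a chord would give a second cycle sharing some but not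
all of its edges. -/
theorem cycEdge_of_adj (hG : IsCactus G) (hc : IsLeafCycle G c) {i j : ℕ}
    (h : G.Adj (cyc c i) (cyc c j)) :
    IsCycEdge c s(cyc c i, cyc c j) := by
  have h3 := hc.three_le
  obtain ⟨m, hm, hj⟩ : ∃ m < n, cyc c j = cyc c (i + m) := by
    refine ⟨(j + n * i - i) % n, Nat.mod_lt _ (by omega), ?_⟩
    rw [← cyc_mod c (i + _), Nat.add_mod, Nat.mod_mod, ← Nat.add_mod, ← cyc_mod c j]
    have : i ≤ n * i := Nat.le_mul_of_pos_left _ (by omega)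
    rw [show i + (j + n * i - i) = j + n * i by omega, Nat.add_mul_mod_self_left]
  rw [hj] at h ⊢
  by_cases e0 : m = 0
  · subst e0; exact absurd h (G.loopless.irrefl _)
  by_cases e1 : m = 1
  · subst e1; exact ⟨i, rfl⟩
  by_cases e2 : m = n - 1
  · subst e2
    refine ⟨i + (n - 1), ?_⟩
    rw [show i + (n - 1) + 1 = i + n by omega, cyc_add, Sym2.eq_swap]
  exfalso
  obtain ⟨q, hq, hq'⟩ := exists_cycle_of_seq (m := m) (by omega) (fun k => cyc c (i + k))
    (fun k _ => cyc_adj hc (i + k)) h.symm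
    (fun k hk k' hk' h => cyc_add_inj hc (by omega) (by omega) h)
  obtain ⟨a, p, hp, hp'⟩ := exists_cycle_of_leafCycle hc
  have h4 := hG.2 _ _ p q hp hq s(cyc c i, cyc c (i + 1)) ((hp' _).2 ⟨i, rfl⟩)
    ((hq' _).2 (Or.inr ⟨0, by omega, rfl⟩))
    s(cyc c (i + (n - 1)), cyc c (i + (n - 1) + 1))
  rcases (hq' _).1 (h4.1 ((hp' _).2 ⟨_, rfl⟩)) with h5 | ⟨k, hk, h5⟩
  · rw [Sym2.eq_iff] at h5
    rcases h5 with ⟨h5, -⟩ | ⟨h5, -⟩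
    · have := cyc_add_inj hc (by omega) (by omega) h5; omega
    · have := cyc_add_inj hc (by omega) (by omega) h5; omega
  · rw [Sym2.eq_iff] at h5
    rcases h5 with ⟨h5, -⟩ | ⟨h5, -⟩
    · have := cyc_add_inj hc (by omega) (by omega) h5; omega
    · have := cyc_add_inj hc (i := i) (k' := k + 1) (by omega) (by omega) h5; omega

/-! ### Leaf cycles of the reduced graph -/

theorem cyc_mem_part {j : ℕ} (h0 : 0 < j) (h1 : j < n) : cyc c j ∈ cyclePart G c :=
    (mem_cyclePart_iff _).2 ⟨j, h0, h1, Or.inl rfl⟩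

theorem range_not_part {v : V} (h : v ∈ Set.range c) (hv : v ∉ cyclePart G c) : v = c 0 := by
  obtain ⟨j, hj, rfl⟩ := (range_cyc c v).1 h
  by_cases e : j = 0
  · rw [e, cyc_zero]
  · exact absurd (cyc_mem_part (by omega) hj) hv

theorem centre_not_part (hc : IsLeafCycle G c) : c 0 ∉ cyclePart G c := by
  rw [mem_cyclePart_iff]
  have h3 := hc.three_le
  rintro ⟨j, h0, h1, h2 | h2⟩
  · rw [← cyc_zero c] at h2
    have := cyc_inj hc h2
    rw [Nat.mod_eq_of_lt h1, Nat.mod_eq_of_lt (by omega)] at this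
    omega
  · exact cyc_not_leaf hc 0 (cyc_zero c ▸ h2.2)

theorem cyc_neighbor (hc : IsLeafCycle G c) {j : ℕ} (h0 : 0 < j) (h1 : j < n) {w : V}
    (h : G.Adj (cyc c j) w) :
    w ∈ Set.range c ∨ IsLeaf G w := by
  exact hc.neighbor ⟨j, h1⟩ (by simp [Fin.ext_iff]; omega) w (by rwa [← cyc_val c ⟨j, h1⟩])

/-- A vertex outside the cycle has no neighbours in the removed part. -/
theorem kept_neighbor (hc : IsLeafCycle G c) {v w : V} (hv : v ∉ cyclePart G c) (hu : v ≠ c 0)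
    (h : G.Adj v w) : w ∉ cyclePart G c := by
  intro hw
  obtain ⟨j, h0, h1, rfl | ⟨h2, h3⟩⟩ := (mem_cyclePart_iff _).1 hw
  · rcases cyc_neighbor hc h0 h1 h.symm with h4 | h4
    · exact hu (range_not_part h4 hv)
    · exact hv ((mem_cyclePart_iff _).2 ⟨j, h0, h1, Or.inr ⟨h.symm, h4⟩⟩)
  · rw [h3.unique h.symm h2.symm] at hv
    exact hv (cyc_mem_part h0 h1)

variable {l : ℕ}

theorem replace_adj {v : V} (hv : v ∉ cyclePart G c) (hu : v ≠ c 0) (x) :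
    (replaceCycle G c l).Adj (Sum.inl ⟨v, hv⟩) x ↔ ∃ w, ∃ hw : w ∉ cyclePart G c, G.Adj v w ∧
      x = Sum.inl ⟨w, hw⟩ := by
  rcases x with ⟨w, hw⟩ | i
  · constructor
    · intro h; exact ⟨w, hw, h, rfl⟩
    · rintro ⟨w', hw', h, h2⟩
      simp only [Sum.inl.injEq, Subtype.mk.injEq] at h2
      subst h2; exact h
  · constructor
    · intro h; exact absurd h hu
    · rintro ⟨w', hw', h, h2⟩
      simp at h2

theorem isLeaf_kept (hc : IsLeafCycle G c) {v : V} (hv : v ∉ cyclePart G c) (hu : v ≠ c 0) :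
    IsLeaf (replaceCycle G c l) (Sum.inl ⟨v, hv⟩) ↔ IsLeaf G v := by
  constructor
  · rintro ⟨x, h1, h2⟩
    obtain ⟨w, hw, h3, rfl⟩ := (replace_adj hv hu _).1 h1
    refine ⟨w, h3, fun w' hw' => ?_⟩
    have := h2 (Sum.inl ⟨w', kept_neighbor hc hv hu hw'⟩) ((replace_adj hv hu _).2
      ⟨w', _, hw', rfl⟩)
    simpa using this
  · rintro ⟨w, h1, h2⟩
    refine ⟨Sum.inl ⟨w, kept_neighbor hc hv hu h1⟩, (replace_adj hv hu _).2 ⟨w, _, h1, rfl⟩,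
      fun x hx => ?_⟩
    obtain ⟨w', hw, h3, rfl⟩ := (replace_adj hv hu _).1 hx
    simp [h2 w' h3]

theorem centre_not_leaf (hc : IsLeafCycle G c) : ¬ IsLeaf G (c 0) :=
    fun h => cyc_not_leaf hc 0 (cyc_zero c ▸ h)

theorem leafCount_kept (hc : IsLeafCycle G c) [NeZero l] {v : V} (hv : v ∉ cyclePart G c)
    (hu : v ≠ c 0) :
    leafCount (replaceCycle G c l) (Sum.inl ⟨v, hv⟩) = leafCount G v := by
  unfold leafCount
  symm
  refine Set.ncard_congr (fun w hw => Sum.inl ⟨w, kept_neighbor hc hv hu hw.1⟩) ?_ ?_ ?_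
  · rintro w ⟨h1, h2⟩
    refine ⟨h1, (isLeaf_kept hc _ ?_).2 h2⟩
    rintro rfl; exact centre_not_leaf hc h2
  · intro a b _ _ h; simpa using h
  · rintro x ⟨h1, h2⟩
    obtain ⟨w, hw, h3, rfl⟩ := (replace_adj hv hu _).1 h1
    have hwu : w ≠ c 0 := by
      rintro rfl
      have := h2.unique (a := Sum.inl ⟨v, hv⟩) (b := Sum.inr 0) h1.symm rfl
      simp at this
    exact ⟨w, ⟨h3, (isLeaf_kept hc _ hwu).1 h2⟩, rfl⟩

variable {n' : ℕ} [NeZero n'] {c' : Fin n' → V}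

/-- Another leaf cycle either has the same edges, possibly with a different connecting vertex, or
avoids the removed part and is a leaf cycle of the reduced graph. -/
theorem leafCycle_cases (hG : IsCactus G) (hc : IsLeafCycle G c) (hc' : IsLeafCycle G c') :
    (∀ f, IsCycEdge c' f → IsCycEdge c f) ∨ ∀ i, c' i ∉ cyclePart G c := by
  by_cases e : ∃ e, IsCycEdge c e ∧ IsCycEdge c' e
  · obtain ⟨e, h1, h2⟩ := e
    exact Or.inl fun f => (cycEdge_congr hG hc hc' h1 h2 f).2
  · right
    intro i hi
    rw [← cyc_val c' i] at hi
    obtain ⟨j, h0, h1, h2 | h2⟩ := (mem_cyclePart_iff _).1 hi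
    · have h3 := cyc_adj hc' i
      rw [h2] at h3
      have h4 := (cyc_neighbor hc h0 h1 h3).resolve_right (cyc_not_leaf hc' _)
      obtain ⟨k, -, hk⟩ := (range_cyc c _).1 h4
      rw [hk] at h3
      refine e ⟨_, cycEdge_of_adj hG hc h3, i, ?_⟩
      rw [h2, hk]
    · exact cyc_not_leaf hc' _ h2.2

theorem kept_leafCycle_ne (hc : IsLeafCycle G c) (hc' : IsLeafCycle G c')
    (h : ∀ i, c' i ∉ cyclePart G c) {i : Fin n'} (hi : i ≠ 0) :
    c' i ≠ c 0 := by
  intro e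
  have h3 := hc.three_le
  have h1 := cyc_adj hc 0
  rw [cyc_zero, ← e] at h1
  rcases hc'.neighbor i hi _ h1 with ⟨k, hk⟩ | h4
  · exact h k (hk ▸ cyc_mem_part (by omega) (by omega))
  · exact cyc_not_leaf hc _ h4

theorem leafCycle_replace (hc : IsLeafCycle G c) (hc' : IsLeafCycle G c')
    (h : ∀ i, c' i ∉ cyclePart G c) :
    IsLeafCycle (replaceCycle G c l) (fun i => Sum.inl ⟨c' i, h i⟩) := by
  refine ⟨hc'.three_le, fun i j hij => hc'.injective (by simpa using hij), fun i => hc'.adj i,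
    fun i hi x hx => ?_⟩
  obtain ⟨w, hw, h3, rfl⟩ := (replace_adj (h i) (kept_leafCycle_ne hc hc' h hi) _).1 hx
  rcases hc'.neighbor i hi w h3 with ⟨k, rfl⟩ | h4
  · exact Or.inl ⟨k, rfl⟩
  · refine Or.inr ((isLeaf_kept hc hw ?_).2 h4)
    rintro rfl; exact centre_not_leaf hc h4

theorem color_replace (hc : IsLeafCycle G c) [NeZero l] (hc' : IsLeafCycle G c')
    (h : ∀ i, c' i ∉ cyclePart G c) :
    color (replaceCycle G c l) (fun i => Sum.inl ⟨c' i, h i⟩) = color G c' := by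
  funext i
  unfold color
  by_cases hi : i = 0
  · rw [if_pos hi, if_pos hi]
  · rw [if_neg hi, if_neg hi, leafCount_kept hc (h i) (kept_leafCycle_ne hc hc' h hi)]

theorem requiredEdge_replace (hc : IsLeafCycle G c) [NeZero l] (hc' : IsLeafCycle G c')
    (h : ∀ i, c' i ∉ cyclePart G c) (i : Fin n') :
    IsRequiredEdge (replaceCycle G c l) (fun i => Sum.inl ⟨c' i, h i⟩) i ↔
      IsRequiredEdge G c' i := by
  unfold IsRequiredEdge IsExceptionalEdge leafSequence
  rw [color_replace hc hc' h]

theorem LabelledStrategy.HasProperEdgeStates.symm {Ω : Type} {B : LabelledStrategy G Ω} {x y : V}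
    (h : B.HasProperEdgeStates x y) :
    B.HasProperEdgeStates y x := by
  obtain ⟨h1, h2, h3, h4, h5, h6, h7⟩ := h
  have e : B.idleStates y x = B.idleStates x y := by
    unfold LabelledStrategy.idleStates; rw [Set.union_comm]
  exact ⟨h2, h1, e ▸ h3, h4.symm, h6, h5, e ▸ h7⟩

variable {Ω : Type} {B : LabelledStrategy (replaceCycle G c l) Ω} {d : ℕ → ℕ} {φ : ℕ × ℕ → V}
    {lev : Ω → ℕ}

theorem lift_cycEdge (hφ : Embeds G (c 0) (cyclePart G c) n d φ) (hφ' : ∀ i, φ (i, 0) = cyc c i)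
    (hl : IsLevelling B lev) (hΩ : Nonempty Ω)
    (h0 : n % 4 = 0 → ∀ α, lev α ≠ 2) {x y : V} (h : IsCycEdge c s(x, y)) :
      (liftStrategy hφ B lev).HasProperEdgeStates x y := by
  obtain ⟨k, hk⟩ := h
  have hn : 0 < n := by have := hφ.four_le; omega
  have key : (liftStrategy hφ B lev).HasProperEdgeStates (cyc c k) (cyc c (k + 1)) := by
    have := hl.lift_proper_cycle hφ hΩ h0 (Nat.mod_lt k hn)
    rw [hφ', hφ', cyc_succIdx, cyc_mod, ← cyc_mod c (k % n + 1), Nat.mod_add_mod, cyc_mod] at this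
    exact this
  rw [Sym2.eq_iff] at hk
  rcases hk with ⟨rfl, rfl⟩ | ⟨rfl, rfl⟩
  · exact key
  · exact key.symm

/-- A leaf cycle of `G` either consists of edges of the cycle, all of which have proper edge states,
or is a leaf cycle of the reduced graph with the same required edges. -/
theorem lift_isProper (hG : IsCactus G) (hc : IsLeafCycle G c) [NeZero l]
    (hφ : Embeds G (c 0) (cyclePart G c) n d φ) (hφ' : ∀ i, φ (i, 0) = cyc c i)
    (hl : IsLevelling B lev) (hΩ : Nonempty Ω)
    (h0 : n % 4 = 0 → ∀ α, lev α ≠ 2) (hB : B.IsProper) : (liftStrategy hφ B lev).IsProper := by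
  intro n' _ c' hc' i hi
  rcases leafCycle_cases hG hc hc' with h | h
  · refine lift_cycEdge hφ hφ' hl hΩ h0 (h _ ⟨i, ?_⟩)
    rw [cyc_val, cyc_val_succ]
  · exact hl.lift_proper_kept hφ (h i) (h (i + 1)) (hc'.adj i).ne
      (hB n' _ (leafCycle_replace hc hc' h) i ((requiredEdge_replace hc hc' h i).2 hi))

theorem leaf_part (hc : IsLeafCycle G c) {x y : V} (hy : IsLeaf G y) (hxy : G.Adj x y)
    (h : y ∈ cyclePart G c) :
    ∃ j, 0 < j ∧ j < n ∧ x = cyc c j := by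
  obtain ⟨j, h0, h1, rfl | h2⟩ := (mem_cyclePart_iff _).1 h
  · exact absurd hy (cyc_not_leaf hc j)
  · exact ⟨j, h0, h1, hy.unique hxy.symm h2.1.symm⟩

theorem mem_part_of_leaf (hc : IsLeafCycle G c) {x y z : V} (hy : IsLeaf G y) (hz : IsLeaf G z)
    (hxy : G.Adj x y) (hxz : G.Adj x z)
    (h : y ∈ cyclePart G c) : z ∈ cyclePart G c := by
  obtain ⟨j, h0, h1, rfl⟩ := leaf_part hc hy hxy h
  exact (mem_cyclePart_iff _).2 ⟨j, h0, h1, Or.inr ⟨hxz, hz⟩⟩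

theorem lift_isLeafGrouped (hc : IsLeafCycle G c) (hφ : Embeds G (c 0) (cyclePart G c) n d φ)
    (hφ' : ∀ i, φ (i, 0) = cyc c i)
    (h0 : n % 4 = 0 → ∀ α, lev α ≠ 2) (hB : B.IsLeafGrouped) :
      (liftStrategy hφ B lev).IsLeafGrouped := by
  intro p x y z hxy hxz hy hz hyp hzp
  have hnode : ∀ y, y ∈ cyclePart G c → y ∈ liftPos φ B p → IsLeaf G y → G.Adj x y →
      ∃ i b, φ (i, b + 1) = y ∧ Occ n p.1.2 (i, b + 1) ∧ φ (i, 0) = x := by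
    intro y h1 h2 h3 h4
    rcases h2 with h2 | ⟨⟨i, _ | b⟩, h2, rfl⟩
    · exact absurd h1 h2.2.1
    · rw [hφ'] at h3
      exact absurd h3 (cyc_not_leaf hc i)
    · exact ⟨i, b, rfl, h2, h3.unique (hφ.adj_leaf i b
        (occ_node hφ.two_le hφ.even p.2.1 h2)).symm h4.symm⟩
  have hkept : ∀ y, y ∉ cyclePart G c → y ∈ liftPos φ B p → IsLeaf G y → y ≠ c 0 ∧
    y ∈ outerPos B p.1.1 := by
    intro y h1 h2 h3
    have h4 : y ≠ c 0 := by rintro rfl; exact centre_not_leaf hc h3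
    refine ⟨h4, ?_⟩
    rcases h2 with h2 | ⟨x, h2, rfl⟩
    · exact h2
    · rw [hφ.eq_zero (occ_node hφ.two_le hφ.even p.2.1 h2) h1] at h4
      exact absurd hφ.zero h4
  by_cases hyP : y ∈ cyclePart G c
  · have hzP := mem_part_of_leaf hc hy hz hxy hxz hyP
    obtain ⟨i, b, rfl, h1, h2⟩ := hnode y hyP hyp hy hxy
    obtain ⟨i', b', rfl, h3, h4⟩ := hnode z hzP hzp hz hxz
    have := hφ.inj (i, 0) (i', 0) ⟨h1.1, Or.inl rfl⟩ ⟨h3.1, Or.inl rfl⟩ (h2.trans h4.symm)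
    simp only [Prod.mk.injEq, and_true] at this
    subst this
    rw [occ_leaf_unique ?_ h1 h3]
    have := hφ.even
    by_cases e : n % 4 = 0
    · exact Or.inr (p.2.2 ▸ h0 e _)
    · exact Or.inl (by omega)
  · have hzP : z ∉ cyclePart G c := fun h => hyP (mem_part_of_leaf hc hz hy hxz hxy h)
    obtain ⟨h1, h2, h3, h4⟩ := hkept y hyP hyp hy
    obtain ⟨h5, h6, h7, h8⟩ := hkept z hzP hzp hz
    have h9 : x ∉ cyclePart G c := kept_neighbor hc hyP h1 hxy.symm
    have := hB p.1.1 (Sum.inl ⟨x, h9⟩) (Sum.inl ⟨y, h3⟩) (Sum.inl ⟨z, h7⟩) hxy hxz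
      ((isLeaf_kept hc _ h1).2 hy) ((isLeaf_kept hc _ h5).2 hz) h4 h8
    simpa using this
end

/-! ### Configurations and labelled strategies -/

section
variable {V : Type u} {G : SimpleGraph V}

open Classical in
theorem edn_exists [Finite V] (G : SimpleGraph V) : ∃ 𝒞 F, IsEternalGuardStrategy G (EDN G) 𝒞 F ∧
    ∀ C ∈ 𝒞, C.Nodup := by
  have := Fintype.ofFinite V
  refine Nat.sInf_mem (s := {k | ∃ 𝒞 F, IsEternalGuardStrategy G k 𝒞 F ∧ ∀ C ∈ 𝒞, C.Nodup}) ?_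
  refine ⟨Fintype.card V, {Finset.univ.val}, fun C D => C = Finset.univ.val ∧ D = Finset.univ.val,
    ⟨⟨_, rfl⟩, ?_, fun C D h => h, fun C D h => ⟨h.2, h.1⟩, ?_, ?_⟩, ?_⟩
  · rintro C rfl; rfl
  · rintro C D ⟨rfl, rfl⟩
    refine ⟨Finset.univ.val.map fun v => (v, v), by simp, by simp, ?_⟩
    intro p hp
    simp only [Multiset.mem_map] at hp
    obtain ⟨v, -, rfl⟩ := hp
    exact Or.inl rfl
  · rintro C rfl v; exact Or.inl (Finset.mem_univ v)
  · rintro C rfl; exact Finset.univ.nodup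

theorem egc_exists [Finite V] (G : SimpleGraph V) : ∃ 𝒞 F, IsEternalGuardStrategy G
    (EGC G) 𝒞 F := by
  obtain ⟨𝒞, F, h, -⟩ := edn_exists G
  exact Nat.sInf_mem (s := {k | ∃ 𝒞 F, IsEternalGuardStrategy G k 𝒞 F}) ⟨_, 𝒞, F, h⟩

theorem egc_le_edn [Finite V] (G : SimpleGraph V) : EGC G ≤ EDN G := by
  obtain ⟨𝒞, F, h, -⟩ := edn_exists G
  exact Nat.sInf_le ⟨𝒞, F, h⟩

/-- A strategy without double occupation as a labelled strategy. A pairing of guards is chosen once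
for each pair of configurations, in the order of an enumeration, and reversed for the other
direction. -/
theorem exists_labelled [Finite V] {k : ℕ} {𝒞 : Set (Multiset V)}
    {F : Multiset V → Multiset V → Prop}
    (h : IsEternalGuardStrategy G k 𝒞 F) (hn : ∀ C ∈ 𝒞, C.Nodup) : ∃ (N : ℕ)
      (B : LabelledStrategy G (Fin N)), B.IsDefending k := by
  classical
  have := Fintype.ofFinite V
  have hfin : 𝒞.Finite := by
    refine (Set.Finite.image Finset.val (Set.finite_univ (α := Finset V))).subset ?_
    intro C hC
    exact ⟨⟨C, hn C hC⟩, trivial, rfl⟩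
  have := hfin.to_subtype
  let e : 𝒞 ≃ Fin (Nat.card 𝒞) := Finite.equivFin 𝒞
  let conf : Fin (Nat.card 𝒞) → Multiset V := fun α => (e.symm α).1
  have hconf : ∀ α, conf α ∈ 𝒞 := fun α => (e.symm α).2
  have hT : ∀ α β, ∃ T : Multiset (V × V), F (conf α) (conf β) → T.map Prod.fst = conf α ∧
    T.map Prod.snd = conf β ∧ ∀ p ∈ T, p.1 = p.2 ∨ G.Adj p.1 p.2 := by
    intro α β
    by_cases hF : F (conf α) (conf β)
    · obtain ⟨T, hT⟩ := h.traversable _ _ hF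
      exact ⟨T, fun _ => hT⟩
    · exact ⟨0, fun h => absurd h hF⟩
  choose T hT using hT
  let mv : Fin (Nat.card 𝒞) → Fin (Nat.card 𝒞) → Set (V × V) := fun α β =>
    if α < β then {x | x ∈ T α β} else {x | x.swap ∈ T β α}
  have hsymm : ∀ α β, α ≠ β → ∀ a b, (a, b) ∈ mv α β → (b, a) ∈ mv β α := by
    intro α β hne a b hab
    simp only [mv] at hab ⊢
    by_cases hlt : α < β
    · rw [if_pos hlt] at hab
      rw [if_neg (not_lt.2 hlt.le)]
      exact hab
    · rw [if_neg hlt] at hab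
      rw [if_pos (lt_of_le_of_ne (not_lt.1 hlt) hne.symm)]
      exact hab
  have hvalid : ∀ α β, F (conf α) (conf β) → ∀ a b, (a, b) ∈ T α β → a ∈ conf α ∧ b ∈ conf β ∧
    (G.Adj a b ∨ a = b) := by
    intro α β hF a b hab
    obtain ⟨h1, h2, h3⟩ := hT α β hF
    exact ⟨h1 ▸ Multiset.mem_map_of_mem Prod.fst hab, h2 ▸ Multiset.mem_map_of_mem Prod.snd hab,
      (h3 _ hab).symm⟩
  have hmv : ∀ α β, α ≠ β → F (conf α) (conf β) → ∀ a b, (a, b) ∈ mv α β → a ∈ conf α ∧ b ∈ conf β ∧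
    (G.Adj a b ∨ a = b) := by
    intro α β hne hF a b hab
    simp only [mv] at hab
    split_ifs at hab
    · exact hvalid α β hF a b hab
    · obtain ⟨h1, h2, h3⟩ := hvalid β α (h.symm _ _ hF) b a hab
      exact ⟨h2, h1, h3.imp (fun h => h.symm) Eq.symm⟩
  have hleft : ∀ α β, α ≠ β → F (conf α) (conf β) → ∀ a ∈ conf α, ∃! b, (a, b) ∈ mv α β := by
    intro α β hne hF a ha
    have key : ∀ (T : Multiset (V × V)) (f : V × V → V), (T.map f) = conf α → (∃ x ∈ T, f x = a) ∧
      ∀ x ∈ T, ∀ y ∈ T, f x = f y → x = y := by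
      intro T f hf
      refine ⟨Multiset.mem_map.1 (hf ▸ ha), fun x hx y hy =>
        Multiset.inj_on_of_nodup_map (hf ▸ hn _ (hconf α)) x hx y hy⟩
    simp only [mv]
    split_ifs with hlt
    · obtain ⟨⟨x, h1, h2⟩, h3⟩ := key (T α β) Prod.fst (hT α β hF).1
      obtain ⟨x1, x2⟩ := x
      simp only at h2; subst h2
      refine ⟨x2, h1, fun b hb => ?_⟩
      have := h3 _ hb _ h1 rfl
      simpa using this
    · obtain ⟨⟨x, h1, h2⟩, h3⟩ := key (T β α) Prod.snd (hT β α (h.symm _ _ hF)).2.1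
      obtain ⟨x1, x2⟩ := x
      simp only at h2; subst h2
      refine ⟨x1, h1, fun b hb => ?_⟩
      have := h3 (b, x2) hb _ h1 rfl
      simpa using this
  refine ⟨_, { graph := { Adj := fun α β => α ≠ β ∧ F (conf α) (conf β)
                          symm := ⟨fun α β h1 => ⟨h1.1.symm, h.symm _ _ h1.2⟩⟩
                          loopless := ⟨fun α h1 => h1.1 rfl⟩ }
               pos := fun α => {v | v ∈ conf α}
               move := mv
               move_valid := fun α β h1 => hmv α β h1.1 h1.2
               move_left := fun α β h1 => hleft α β h1.1 h1.2
               move_right := fun α β h1 b hb => by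
                 obtain ⟨a, ha, hu⟩ := hleft β α h1.1.symm (h.symm _ _ h1.2) b hb
                 exact ⟨a, hsymm _ _ h1.1.symm _ _ ha, fun a' ha' => hu a' (hsymm _ _ h1.1 _ _ ha')⟩
               move_symm := fun α β h1 => hsymm α β h1.1 }, ?_, ?_, ?_⟩
  · obtain ⟨C, hC⟩ := h.nonempty
    exact ⟨e ⟨C, hC⟩⟩
  · intro α
    refine ⟨Set.toFinite _, ?_⟩
    have h1 : {v | v ∈ conf α} = ↑(⟨conf α, hn _ (hconf α)⟩ : Finset V) := rfl
    show Set.ncard {v | v ∈ conf α} = k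
    rw [h1, Set.ncard_coe_finset]
    exact h.card_eq _ (hconf α)
  · intro α v
    rcases h.defends _ (hconf α) v with h1 | ⟨D, hD, h1, h2⟩
    · exact Or.inl h1
    · have hD' : conf (e ⟨D, hD⟩) = D := congrArg Subtype.val (e.symm_apply_apply ⟨D, hD⟩)
      by_cases h3 : α = e ⟨D, hD⟩
      · left
        show v ∈ conf α
        rw [h3, hD']; exact h2
      · exact Or.inr ⟨e ⟨D, hD⟩, ⟨h3, by rw [hD']; exact h1⟩, by
          show v ∈ conf _; rw [hD']; exact h2⟩

/-- A defending labelled strategy bounds the m-eternal domination number. -/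
theorem edn_le_of_isDefending [Finite V] {Ω : Type} {B : LabelledStrategy G Ω} {m : ℕ}
    (hB : B.IsDefending m) : EDN G ≤ m := by
  classical
  have := Fintype.ofFinite V
  let conf : Ω → Multiset V := fun α => (B.pos α).toFinset.val
  have hconf : ∀ α v, v ∈ conf α ↔ v ∈ B.pos α := fun α v => by simp [conf]
  refine Nat.sInf_le ⟨Set.range conf, fun C D => ∃ α β, B.graph.Adj α β ∧ C = conf α ∧ D = conf β,
    ⟨?_, ?_, ?_, ?_, ?_, ?_⟩, ?_⟩
  · obtain ⟨α⟩ := hB.1; exact ⟨_, α, rfl⟩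
  · rintro _ ⟨α, rfl⟩
    rw [← (hB.2.1 α).2, Set.ncard_eq_toFinset_card']
    rfl
  · rintro C D ⟨α, β, -, rfl, rfl⟩; exact ⟨⟨_, rfl⟩, ⟨_, rfl⟩⟩
  · rintro C D ⟨α, β, h, rfl, rfl⟩; exact ⟨β, α, h.symm, rfl, rfl⟩
  · rintro C D ⟨α, β, h, rfl, rfl⟩
    refine ⟨(B.move α β).toFinset.val, ?_, ?_, ?_⟩
    · refine (Multiset.Nodup.ext ?_ (Finset.nodup _)).2 fun v => ?_
      · refine Multiset.Nodup.map_on ?_ (Finset.nodup _)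
        rintro ⟨a, b⟩ hx ⟨a', b'⟩ hy (rfl : a = a')
        simp only [Finset.mem_val, Set.mem_toFinset] at hx hy
        rw [(B.move_left _ _ h _ (B.move_valid _ _ h _ _ hx).1).unique hx hy]
      · simp only [Multiset.mem_map, Finset.mem_val, Set.mem_toFinset]
        constructor
        · rintro ⟨⟨a, b⟩, hx, rfl⟩
          exact (B.move_valid _ _ h _ _ hx).1
        · intro hv
          obtain ⟨b, hb, -⟩ := B.move_left _ _ h _ hv
          exact ⟨(v, b), hb, rfl⟩
    · refine (Multiset.Nodup.ext ?_ (Finset.nodup _)).2 fun v => ?_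
      · refine Multiset.Nodup.map_on ?_ (Finset.nodup _)
        rintro ⟨a, b⟩ hx ⟨a', b'⟩ hy (rfl : b = b')
        simp only [Finset.mem_val, Set.mem_toFinset] at hx hy
        rw [(B.move_right _ _ h _ (B.move_valid _ _ h _ _ hx).2.1).unique hx hy]
      · simp only [Multiset.mem_map, Finset.mem_val, Set.mem_toFinset]
        constructor
        · rintro ⟨⟨a, b⟩, hx, rfl⟩
          exact (B.move_valid _ _ h _ _ hx).2.1
        · intro hv
          obtain ⟨a, ha, -⟩ := B.move_right _ _ h _ hv
          exact ⟨(a, v), ha, rfl⟩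
    · rintro ⟨a, b⟩ hx
      simp only [Finset.mem_val, Set.mem_toFinset] at hx
      exact (B.move_valid _ _ h _ _ hx).2.2.symm
  · rintro _ ⟨α, rfl⟩ v
    rcases hB.2.2 α v with h | ⟨β, h1, h2⟩
    · exact Or.inl ((hconf α v).2 h)
    · exact Or.inr ⟨_, ⟨β, rfl⟩, ⟨α, β, h1, rfl, rfl⟩, (hconf β v).2 h2⟩
  · rintro _ ⟨α, rfl⟩; exact Finset.nodup _

theorem exists_labelled_edn [Finite V] (G : SimpleGraph V) :
    ∃ (N : ℕ) (B : LabelledStrategy G (Fin N)), B.IsDefending (EDN G) := by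
  obtain ⟨𝒞, F, h, hn⟩ := edn_exists G
  exact exists_labelled h hn
end

/-! ### Projection of configurations to the reduced graph -/

section
variable {V : Type u} {G : SimpleGraph V}

theorem Traversable.refl (C : Multiset V) : Traversable G C C := by
  refine ⟨C.map fun v => (v, v), by simp, by simp, fun p hp => ?_⟩
  obtain ⟨v, -, rfl⟩ := Multiset.mem_map.1 hp
  exact Or.inl rfl

theorem Traversable.symm {C D : Multiset V} (h : Traversable G C D) : Traversable G D C := by
  obtain ⟨T, h1, h2, h3⟩ := h
  refine ⟨T.map Prod.swap, by simpa using h2, by simpa using h1, fun p hp => ?_⟩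
  obtain ⟨v, hv, rfl⟩ := Multiset.mem_map.1 hp
  exact (h3 v hv).imp Eq.symm fun h => h.symm

theorem Traversable.add {C D C' D' : Multiset V} (h : Traversable G C D)
    (h' : Traversable G C' D') : Traversable G (C + C') (D + D') := by
  obtain ⟨T, h1, h2, h3⟩ := h
  obtain ⟨T', h1', h2', h3'⟩ := h'
  refine ⟨T + T', by rw [Multiset.map_add, h1, h1'], by rw [Multiset.map_add, h2, h2'],
    fun p hp => ?_⟩
  rcases Multiset.mem_add.1 hp with h | h
  · exact h3 p h
  · exact h3' p h

theorem Traversable.of_adj {a b : V} (h : G.Adj a b) : Traversable G {a} {b} :=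
  ⟨{(a, b)}, by simp, by simp, fun p hp => by rw [Multiset.mem_singleton.1 hp]; exact Or.inr h⟩

open Classical in
/-- The guards that reach `S` come from the closed neighbourhood of `S`. -/
theorem Traversable.countP_le {C D : Multiset V} (h : Traversable G C D) {S S' : V → Prop}
    (hS : ∀ a b, S b → a = b ∨ G.Adj a b → S' a) : D.countP S ≤ C.countP S' := by
  obtain ⟨T, rfl, rfl, h3⟩ := h
  rw [Multiset.countP_map, Multiset.countP_map]
  refine Multiset.card_le_card ?_
  rw [Multiset.le_filter]
  refine ⟨Multiset.filter_le _ _, fun p hp => ?_⟩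
  rw [Multiset.mem_filter] at hp
  exact hS _ _ hp.2 (h3 p hp.1)

theorem Traversable.mem {C D : Multiset V} (h : Traversable G C D) {b : V} (hb : b ∈ D) :
    ∃ a ∈ C, a = b ∨ G.Adj a b := by
  obtain ⟨T, rfl, rfl, h3⟩ := h
  obtain ⟨p, hp, rfl⟩ := Multiset.mem_map.1 hb
  exact ⟨p.1, Multiset.mem_map_of_mem _ hp, h3 p hp⟩

/-- Guards on `u` and a neighbour of it, at most one on the neighbour, can be rearranged at will, if
a guard remains on `u` whenever the occupied neighbour changes. -/
theorem traversable_star {u y y' : V} (h : G.Adj u y) (h' : G.Adj u y') {p q p' q' : ℕ}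
    (hp : p + q = p' + q')
    (hq : q ≤ 1) (hq' : q' ≤ 1) (hy : y = y' ∨ q = 0 ∨ q' = 0 ∨ 1 ≤ p) :
    Traversable G (Multiset.replicate p u + Multiset.replicate q y)
      (Multiset.replicate p' u + Multiset.replicate q' y') := by
  obtain rfl | rfl : q = 0 ∨ q = 1 := by omega
  · obtain rfl | rfl : q' = 0 ∨ q' = 1 := by omega
    · rw [show p = p' by omega]; exact Traversable.refl _
    · rw [show p = p' + 1 by omega, Multiset.replicate_add, Multiset.replicate_one,
        Multiset.replicate_one, Multiset.replicate_zero, add_zero]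
      exact (Traversable.refl _).add (Traversable.of_adj h')
  · obtain rfl | rfl : q' = 0 ∨ q' = 1 := by omega
    · rw [show p' = p + 1 by omega, Multiset.replicate_add, Multiset.replicate_one,
        Multiset.replicate_one, Multiset.replicate_zero, add_zero]
      exact (Traversable.refl _).add (Traversable.of_adj h.symm)
    · obtain rfl : p = p' := by omega
      by_cases e : y = y'
      · subst e; exact Traversable.refl _
      · have hp1 : 1 ≤ p := by
          rcases hy with hy | hy | hy | hy
          · exact absurd hy e
          all_goals omega
        obtain ⟨r, rfl⟩ : ∃ r, p = r + 1 := ⟨p - 1, by omega⟩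
        have h1 := (Traversable.refl (G := G) (Multiset.replicate r u)).add
          ((Traversable.of_adj h').add (Traversable.of_adj h.symm))
        rw [add_comm ({y'} : Multiset V) {u}, ← add_assoc, ← add_assoc] at h1
        rwa [Multiset.replicate_add, Multiset.replicate_one, Multiset.replicate_one,
          Multiset.replicate_one]

variable {n : ℕ} [NeZero n] {c : Fin n → V} {l : ℕ}

/-- The vertex is the connecting vertex or belongs to the removed part. -/
def InPart (G : SimpleGraph V) (c : Fin n → V) (v : V) : Prop := v = c 0 ∨ v ∈ cyclePart G c

theorem inPart_adj (hc : IsLeafCycle G c) {a b : V} (ha : InPart G c a) (hb : ¬ InPart G c b)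
    (h : a = b ∨ G.Adj a b) : a = c 0 := by
  unfold InPart at hb
  push Not at hb
  rcases h with rfl | h
  · exact absurd ha (by unfold InPart; tauto)
  · exact ha.resolve_right (kept_neighbor hc hb.2 hb.1 h.symm)

open Classical in
/-- Contraction of the removed part to the connecting vertex. -/
noncomputable def contract (hu : c 0 ∉ cyclePart G c) (l : ℕ) (v : V) :
    {v : V // v ∉ cyclePart G c} ⊕ Fin l :=
  if h : v ∈ cyclePart G c then Sum.inl ⟨c 0, hu⟩ else Sum.inl ⟨v, h⟩

theorem contract_part (hu : c 0 ∉ cyclePart G c) {v : V} (h : InPart G c v) :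
    contract hu l v = Sum.inl ⟨c 0, hu⟩ := by
  unfold contract
  rcases h with rfl | h
  · rw [dif_neg hu]
  · rw [dif_pos h]

theorem contract_kept (hu : c 0 ∉ cyclePart G c) {v : V} (h : v ∉ cyclePart G c) :
    contract hu l v = Sum.inl ⟨v, h⟩ := by
  unfold contract; rw [dif_neg h]

open Classical in
/-- The guards outside the cycle and the connecting vertex, in the reduced graph. -/
noncomputable def outer (hu : c 0 ∉ cyclePart G c) (l : ℕ) (C : Multiset V) :
    Multiset ({v : V // v ∉ cyclePart G c} ⊕ Fin l) :=
  (C.filter fun v => ¬ InPart G c v).map (contract hu l)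

open Classical in
theorem filter_not_and {X : Type*} (T : Multiset X) (p q : X → Prop) :
    T.filter (fun x => ¬ (p x ∧ q x)) = T.filter (fun x => ¬ p x) + T.filter
      (fun x => p x ∧ ¬ q x) := by
  rw [Multiset.filter_add_filter, (Multiset.filter_eq_nil (s := T)
    (p := fun x => ¬ p x ∧ p x ∧ ¬ q x)).2, add_zero]
  · exact Multiset.filter_congr fun x _ => by tauto
  · exact fun x _ => by tauto

open Classical in
/-- During a transition between configurations of `G`, `o` guards leave the cycle and `i` guards
enter it, all of them through the connecting vertex. -/
theorem traversable_outer (hc : IsLeafCycle G c) (hu : c 0 ∉ cyclePart G c) {C D : Multiset V}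
    (h : Traversable G C D) :
    ∃ o i : ℕ, o ≤ C.countP (· = c 0) ∧ i ≤ D.countP (· = c 0) ∧
      C.countP (InPart G c) + i = D.countP (InPart G c) + o ∧
      Traversable (replaceCycle G c l) (outer hu l C + Multiset.replicate o (Sum.inl ⟨c 0, hu⟩))
        (outer hu l D + Multiset.replicate i (Sum.inl ⟨c 0, hu⟩)) := by
  obtain ⟨T, rfl, rfl, h3⟩ := h
  set P := InPart G c
  have hPu : ∀ p ∈ T, P p.1 → ¬ P p.2 → p.1 = c 0 := fun p hp h1 h2 => inPart_adj hc h1 h2 (h3 p hp)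
  have hPu' : ∀ p ∈ T, P p.2 → ¬ P p.1 → p.2 = c 0 := fun p hp h1 h2 =>
    inPart_adj hc h1 h2 ((h3 p hp).imp Eq.symm fun h => h.symm)
  have split1 : T.filter (fun p => ¬ (P p.1 ∧ P p.2)) = T.filter (fun p => ¬ P p.1) + T.filter
    (fun p => P p.1 ∧ ¬ P p.2) := by
    exact filter_not_and T _ _
  have split2 : T.filter (fun p => ¬ (P p.1 ∧ P p.2)) = T.filter (fun p => ¬ P p.2) + T.filter
    (fun p => P p.2 ∧ ¬ P p.1) := by
    rw [← filter_not_and T (fun p => P p.2) (fun p => P p.1)]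
    exact Multiset.filter_congr fun p _ => by tauto
  refine ⟨(T.filter fun p => P p.1 ∧ ¬ P p.2).card, (T.filter fun p => P p.2 ∧ ¬ P p.1).card, ?_,
    ?_, ?_, ?_⟩
  · rw [Multiset.countP_map]
    refine Multiset.card_le_card ?_
    rw [Multiset.le_filter]
    refine ⟨Multiset.filter_le _ _, fun p hp => ?_⟩
    rw [Multiset.mem_filter] at hp
    exact hPu p hp.1 hp.2.1 hp.2.2
  · rw [Multiset.countP_map]
    refine Multiset.card_le_card ?_
    rw [Multiset.le_filter]
    refine ⟨Multiset.filter_le _ _, fun p hp => ?_⟩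
    rw [Multiset.mem_filter] at hp
    exact hPu' p hp.1 hp.2.1 hp.2.2
  · rw [Multiset.countP_map, Multiset.countP_map]
    have e1 := congrArg Multiset.card split1
    have e2 := congrArg Multiset.card split2
    rw [Multiset.card_add] at e1 e2
    have e3 := congrArg Multiset.card (Multiset.filter_add_not (fun p => P p.1) T)
    have e4 := congrArg Multiset.card (Multiset.filter_add_not (fun p => P p.2) T)
    rw [Multiset.card_add] at e3 e4
    omega
  · refine ⟨(T.filter fun p => ¬ (P p.1 ∧ P p.2)).map fun p =>
      (contract hu l p.1, contract hu l p.2), ?_, ?_, ?_⟩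
    · rw [Multiset.map_map, split1, Multiset.map_add, outer, Multiset.filter_map, Multiset.map_map]
      congr 1
      rw [← Multiset.map_const']
      refine Multiset.map_congr rfl fun p hp => ?_
      rw [Multiset.mem_filter] at hp
      exact contract_part hu hp.2.1
    · rw [Multiset.map_map, split2, Multiset.map_add, outer, Multiset.filter_map, Multiset.map_map]
      congr 1
      rw [← Multiset.map_const']
      refine Multiset.map_congr rfl fun p hp => ?_
      rw [Multiset.mem_filter] at hp
      exact contract_part hu hp.2.1
    · intro p hp
      obtain ⟨⟨a, b⟩, hq, rfl⟩ := Multiset.mem_map.1 hp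
      rw [Multiset.mem_filter] at hq
      obtain ⟨hq, hne⟩ := hq
      simp only at hne ⊢
      have key : a ∉ cyclePart G c ∧ b ∉ cyclePart G c := by
        have h4 := hPu _ hq
        have h5 := hPu' _ hq
        simp only at h4 h5
        constructor <;> intro h6
        · have h7 : P a := Or.inr h6
          have := h4 h7 fun h => hne ⟨h7, h⟩
          exact hu (this ▸ h6)
        · have h7 : P b := Or.inr h6
          have := h5 h7 fun h => hne ⟨h, h7⟩
          exact hu (this ▸ h6)
      rw [contract_kept hu key.1, contract_kept hu key.2]
      rcases h3 _ hq with h | h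
      · simp only at h; left; simp [h]
      · exact Or.inr h

open Classical in
/-- The number of guards put on a new leaf, when `K` guards are dropped and enough guards are kept
on the connecting vertex: as many as `C` has there, and at least `e`. -/
noncomputable def leafGuard (G : SimpleGraph V) (c : Fin n → V) (K e : ℕ) (C : Multiset V) : ℕ :=
  if K + max (C.countP (· = c 0)) e < C.countP (InPart G c) then 1 else 0

open Classical in
/-- The configuration of the reduced graph for `C`: `K` guards of the cycle are dropped, the others
stand on the connecting vertex, except perhaps one, which stands on the leaf `y`. -/
noncomputable def project (hu : c 0 ∉ cyclePart G c) (K e : ℕ) (C : Multiset V) (y : Fin l) :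
    Multiset ({v : V // v ∉ cyclePart G c} ⊕ Fin l) :=
  outer hu l C + (Multiset.replicate (C.countP (InPart G c) - K - leafGuard G c K e C)
    (Sum.inl ⟨c 0, hu⟩) +
    Multiset.replicate (leafGuard G c K e C) (Sum.inr y))

theorem leafGuard_le (K e : ℕ) (C : Multiset V) : leafGuard G c K e C ≤ 1 := by
  unfold leafGuard; split_ifs <;> omega

open Classical in
theorem leafGuard_spec {K e : ℕ} {C : Multiset V} (h : K + max (C.countP (· = c 0)) e ≤ C.countP
    (InPart G c)) :
    K + max (C.countP (· = c 0)) e + leafGuard G c K e C ≤ C.countP (InPart G c) := by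
  unfold leafGuard; split_ifs <;> omega

open Classical in
theorem traversable_project (hc : IsLeafCycle G c) (hu : c 0 ∉ cyclePart G c) {K e : ℕ}
    {C D : Multiset V} (h : Traversable G C D)
    (hC : K + max (C.countP (· = c 0)) e ≤ C.countP (InPart G c))
      (hD : K + max (D.countP (· = c 0)) e ≤ D.countP (InPart G c))
    {y y' : Fin l} (hy : y = y' ∨ leafGuard G c K e C = 0 ∨ leafGuard G c K e D = 0) :
    Traversable (replaceCycle G c l) (project hu K e C y) (project hu K e D y') := by
  obtain ⟨o, i, h1, h2, h3, h4⟩ := traversable_outer (l := l) hc hu h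
  have h5 := leafGuard_spec hC
  have h6 := leafGuard_spec hD
  have h7 := leafGuard_le (G := G) (c := c) K e C
  have h8 := leafGuard_le (G := G) (c := c) K e D
  unfold project
  have aux : ∀ (C : Multiset V) (o : ℕ) (y : Fin l), o + leafGuard G c K e C + K ≤ C.countP
    (InPart G c) →
      outer hu l C + (Multiset.replicate (C.countP (InPart G c) - K - leafGuard G c K e C)
        (Sum.inl ⟨c 0, hu⟩) +
        Multiset.replicate (leafGuard G c K e C) (Sum.inr y)) =
      (outer hu l C + Multiset.replicate o (Sum.inl ⟨c 0, hu⟩)) +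
        (Multiset.replicate (C.countP (InPart G c) - K - leafGuard G c K e C - o)
          (Sum.inl ⟨c 0, hu⟩) +
        Multiset.replicate (leafGuard G c K e C) (Sum.inr y)) := by
    intro C o y h
    rw [show C.countP (InPart G c) - K - leafGuard G c K e C = o +
      (C.countP (InPart G c) - K - leafGuard G c K e C - o) by omega,
      Multiset.replicate_add, add_tsub_cancel_left]
    simp only [add_assoc]
  rw [aux C o y (by omega), aux D i y' (by omega)]
  refine h4.add (traversable_star (G := replaceCycle G c l) (u := Sum.inl ⟨c 0, hu⟩)
    (y := Sum.inr y) (y' := Sum.inr y') rfl rfl (by omega) h7 h8 ?_)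
  rcases hy with hy | hy | hy
  · left; rw [hy]
  · exact Or.inr (Or.inl hy)
  · exact Or.inr (Or.inr (Or.inl hy))

open Classical in
theorem traversable_project_self (hu : c 0 ∉ cyclePart G c) {K e : ℕ} {C : Multiset V}
    (hC : K + max (C.countP (· = c 0)) e ≤ C.countP (InPart G c)) {y y' : Fin l}
      (hy : y = y' ∨ 1 ≤ e) :
    Traversable (replaceCycle G c l) (project hu K e C y) (project hu K e C y') := by
  have h5 := leafGuard_spec hC
  unfold project
  refine (Traversable.refl _).add (traversable_star (G := replaceCycle G c l)
    (u := Sum.inl ⟨c 0, hu⟩) (y := Sum.inr y) (y' := Sum.inr y') rfl rfl rfl (leafGuard_le K e C)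
    (leafGuard_le K e C) ?_)
  rcases hy with hy | hy
  · left; rw [hy]
  · omega

open Classical in
theorem card_project (hu : c 0 ∉ cyclePart G c) {K e : ℕ} {C : Multiset V}
    (hC : K + max (C.countP (· = c 0)) e ≤ C.countP (InPart G c)) (y : Fin l) :
    Multiset.card (project hu K e C y) + K = Multiset.card C := by
  have h5 := leafGuard_spec hC
  unfold project outer
  simp only [Multiset.card_add, Multiset.card_map, Multiset.card_replicate]
  have h6 := congrArg Multiset.card (Multiset.filter_add_not (InPart G c) C)
  rw [Multiset.card_add, ← Multiset.countP_eq_card_filter] at h6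
  omega

open Classical in
/-- The lower bound, from bounds on the number of guards on the cycle in each configuration: `h1`
leaves enough guards on the connecting vertex after dropping `K` guards, and `h2` provides one for
the attacked new leaf. If there are several new leaves, `e = 1` keeps a guard on the connecting
vertex through which the guard on a leaf can be exchanged. -/
theorem egc_replace_add_le [NeZero l] (hc : IsLeafCycle G c) {K e M : ℕ} {𝒞 : Set (Multiset V)}
    {F : Multiset V → Multiset V → Prop}
    (hS : IsEternalGuardStrategy G M 𝒞 F) (hl : ∀ y y' : Fin l, y = y' ∨ 1 ≤ e)
    (h1 : ∀ C ∈ 𝒞, K + max (C.countP (· = c 0)) e ≤ C.countP (InPart G c))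
    (h2 : ∀ C ∈ 𝒞, ∃ D ∈ 𝒞, (D = C ∨ F C D) ∧ K + max (D.countP (· = c 0)) e < D.countP
      (InPart G c)) :
    EGC (replaceCycle G c l) + K ≤ M := by
  have hu := centre_not_part hc
  obtain ⟨C₀, hC₀⟩ := hS.nonempty
  have hM := card_project (l := l) hu (h1 C₀ hC₀) 0
  rw [hS.card_eq _ hC₀] at hM
  suffices EGC (replaceCycle G c l) ≤ M - K by omega
  set 𝒞' : Set (Multiset ({v : V // v ∉ cyclePart G c} ⊕ Fin l)) :=
    {A | ∃ C ∈ 𝒞, ∃ y, A = project hu K e C y}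
  refine Nat.sInf_le ⟨𝒞', fun A A' => A ∈ 𝒞' ∧ A' ∈ 𝒞' ∧ Traversable (replaceCycle G c l) A A',
    ⟨_, C₀, hC₀, 0, rfl⟩, ?_, fun A A' h => ⟨h.1, h.2.1⟩,
    fun A A' h => ⟨h.2.1, h.1, h.2.2.symm⟩, fun A A' h => h.2.2, ?_⟩
  · rintro _ ⟨C, hC, y, rfl⟩
    have := card_project hu (h1 C hC) y
    rw [hS.card_eq _ hC] at this
    omega
  · rintro _ ⟨C, hC, y, rfl⟩ v
    -- the projection of a configuration that is equal or joined to `C` can be reached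
    have step : ∀ D ∈ 𝒞, ∀ y', (D = C ∧ (y = y' ∨ 1 ≤ e)) ∨ (F C D ∧
      (y = y' ∨ leafGuard G c K e C = 0 ∨ leafGuard G c K e D = 0)) → v ∈ project hu K e D y' →
        v ∈ project hu K e C y ∨ ∃ A' ∈ 𝒞', (project hu K e C y ∈ 𝒞' ∧ A' ∈ 𝒞' ∧
          Traversable (replaceCycle G c l) (project hu K e C y) A') ∧ v ∈ A' := by
      intro D hD y' hy hv
      refine Or.inr ⟨_, ⟨D, hD, y', rfl⟩, ⟨⟨C, hC, y, rfl⟩, ⟨D, hD, y', rfl⟩, ?_⟩, hv⟩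
      rcases hy with ⟨rfl, hy⟩ | ⟨hF, hy⟩
      · exact traversable_project_self hu (h1 _ hC) hy
      · exact traversable_project hc hu (hS.traversable _ _ hF) (h1 C hC) (h1 D hD) hy
    rcases v with ⟨v, hv⟩ | y'
    · have key : ∀ D ∈ 𝒞, v ∈ D → Sum.inl ⟨v, hv⟩ ∈ project hu K e D y := by
        intro D hD h
        unfold project
        by_cases ev : v = c 0
        · subst ev
          have h3 := leafGuard_spec (h1 D hD)
          have h4 : 0 < D.countP (· = c 0) := Multiset.countP_pos.2 ⟨_, h, rfl⟩
          refine Multiset.mem_add.2 (Or.inr (Multiset.mem_add.2 (Or.inl ?_)))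
          exact Multiset.mem_replicate.2 ⟨by omega, rfl⟩
        · refine Multiset.mem_add.2 (Or.inl ?_)
          refine Multiset.mem_map.2 ⟨v, Multiset.mem_filter.2 ⟨h, ?_⟩, contract_kept hu hv⟩
          unfold InPart; tauto
      rcases hS.defends C hC v with h | ⟨D, hD, hF, h⟩
      · exact Or.inl (key C hC h)
      · exact step D hD y (Or.inr ⟨hF, Or.inl rfl⟩) (key D hD h)
    · have key : ∀ D ∈ 𝒞, leafGuard G c K e D = 1 → Sum.inr y' ∈ project hu K e D y' := by
        intro D hD h
        unfold project
        refine Multiset.mem_add.2 (Or.inr (Multiset.mem_add.2 (Or.inr ?_)))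
        exact Multiset.mem_replicate.2 ⟨by omega, rfl⟩
      obtain ⟨D, hD, hCD, h3⟩ := h2 C hC
      have h4 : leafGuard G c K e D = 1 := by unfold leafGuard; rw [if_pos h3]
      by_cases h5 : leafGuard G c K e C = 1
      · exact step C hC y' (Or.inl ⟨rfl, hl _ _⟩) (key C hC h5)
      · rcases hCD with rfl | hCD
        · exact absurd h4 h5
        · refine step D hD y' (Or.inr ⟨hCD, Or.inr (Or.inl ?_)⟩) (key D hD h4)
          have := leafGuard_le (G := G) (c := c) K e C
          omega
end

/-! ### Counting guards on the cycle -/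

section
variable {V : Type u} {G : SimpleGraph V} {n : ℕ} [NeZero n] {c : Fin n → V}

/-- The vertex `v` is the `j`-th cycle vertex or one of its leaves. -/
def Bunch (G : SimpleGraph V) (c : Fin n → V) (j : ℕ) (v : V) : Prop :=
    v = cyc c j ∨ (G.Adj (cyc c j) v ∧ IsLeaf G v)

theorem Bunch.unique (hc : IsLeafCycle G c) {i j : ℕ} (hi : i < n) (hj : j < n) {v : V}
    (h : Bunch G c i v) (h' : Bunch G c j v) : i = j := by
  have key : cyc c i = cyc c j := by
    rcases h with rfl | h <;> rcases h' with h' | h'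
    · exact h'
    · exact absurd h'.2 (cyc_not_leaf hc i)
    · exact absurd (h' ▸ h.2) (cyc_not_leaf hc j)
    · exact h.2.unique h.1.symm h'.1.symm
  have := cyc_inj hc key
  rwa [Nat.mod_eq_of_lt hi, Nat.mod_eq_of_lt hj] at this

open Classical in
/-- The number of guards on a cycle vertex and its leaves. -/
noncomputable def bunchCount (G : SimpleGraph V) (c : Fin n → V) (C : Multiset V) (j : ℕ) : ℕ :=
    C.countP (Bunch G c j)

open Classical in
theorem sum_bunchCount_le (hc : IsLeafCycle G c) (C : Multiset V) :
    C.countP (· = c 0) + ∑ j ∈ Finset.Ico 1 n, bunchCount G c C j ≤ C.countP (InPart G c) := by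
  unfold bunchCount
  induction C using Multiset.induction_on with
  | empty => simp
  | cons a C ih =>
    simp only [Multiset.countP_cons, Finset.sum_add_distrib]
    have key : (if a = c 0 then 1 else 0) + ∑ j ∈ Finset.Ico 1 n,
      (if Bunch G c j a then 1 else 0) ≤ if InPart G c a then 1 else 0 := by
      rw [← Finset.card_filter]
      have h1 : ((Finset.Ico 1 n).filter fun j => Bunch G c j a).card ≤ 1 := by
        refine Finset.card_le_one.2 fun i hi j hj => ?_
        simp only [Finset.mem_filter, Finset.mem_Ico] at hi hj
        exact hi.2.unique hc hi.1.2 hj.1.2 hj.2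
      have h2 : ¬ a ∈ cyclePart G c → ((Finset.Ico 1 n).filter fun j =>
        Bunch G c j a).card = 0 := by
        intro h
        rw [Finset.card_eq_zero, Finset.filter_eq_empty_iff]
        intro j hj h'
        rw [Finset.mem_Ico] at hj
        exact h ((mem_cyclePart_iff _).2 ⟨j, by omega, hj.2, h'⟩)
      by_cases e1 : a = c 0
      · have := h2 (e1 ▸ centre_not_part hc)
        rw [if_pos e1, if_pos (show InPart G c a from Or.inl e1)]; omega
      · by_cases e2 : a ∈ cyclePart G c
        · rw [if_neg e1, if_pos (show InPart G c a from Or.inr e2)]; omega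
        · have := h2 e2
          rw [if_neg e1]; omega
    omega

/-- The red vertices at `4 * i + 3` with their white neighbours hold two guards each, those at
`4 * i + 5` one; vertex `1` is counted separately. -/
theorem sum_blocks (x : ℕ → ℕ) (k : ℕ) (h1 : ∀ i < k, 2 ≤ x (4 * i + 2) + x (4 * i + 3) + x
    (4 * i + 4)) (h2 : ∀ i < k, 1 ≤ x (4 * i + 5)) :
    3 * k + x 1 ≤ ∑ j ∈ Finset.Ico 1 (4 * k + 2), x j := by
  induction k with
  | zero => simp
  | succ k ih =>
    rw [show 4 * (k + 1) + 2 = 4 * k + 2 + 1 + 1 + 1 + 1 by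
      ring, Finset.sum_Ico_succ_top (by omega), Finset.sum_Ico_succ_top (by omega),
      Finset.sum_Ico_succ_top (by omega), Finset.sum_Ico_succ_top (by omega)]
    have h3 := h1 k (by omega)
    have h4 := h2 k (by omega)
    have h5 := ih (fun i hi => h1 i (by omega)) (fun i hi => h2 i (by omega))
    rw [show 4 * k + 2 + 1 = 4 * k + 3 by
      ring, show 4 * k + 3 + 1 = 4 * k + 4 by ring, show 4 * k + 4 + 1 = 4 * k + 5 by ring]
    omega

open Classical in
theorem two_le_countP {C : Multiset V} {p : V → Prop} {a b : V} (h : a ≠ b) (ha : a ∈ C)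
    (hb : b ∈ C) (pa : p a) (pb : p b) : 2 ≤ C.countP p := by
  have h1 : ({a, b} : Finset V).val ≤ C := by
    rw [Multiset.le_iff_subset (Finset.nodup _)]
    intro x hx
    simp only [Finset.mem_val, Finset.mem_insert, Finset.mem_singleton] at hx
    rcases hx with rfl | rfl <;> assumption
  rw [Multiset.countP_eq_card_filter, ← Finset.card_pair h, Finset.card_def]
  refine Multiset.card_le_card (Multiset.le_filter.2 ⟨h1, fun x hx => ?_⟩)
  simp only [Finset.mem_val, Finset.mem_insert, Finset.mem_singleton] at hx
  rcases hx with rfl | rfl <;> assumption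

variable {M : ℕ} {𝒞 : Set (Multiset V)} {F : Multiset V → Multiset V → Prop}

theorem guard_or_leaves (hS : IsEternalGuardStrategy G M 𝒞 F) {C : Multiset V} (hC : C ∈ 𝒞)
    {v w : V} (hvw : G.Adj v w) (hw : IsLeaf G w) :
    v ∈ C ∨ w ∈ C := by
  rcases hS.defends C hC w with h | ⟨D, hD, hF, h⟩
  · exact Or.inr h
  · obtain ⟨a, ha, h1 | h1⟩ := (hS.traversable _ _ hF).mem h
    · exact Or.inr (h1 ▸ ha)
    · exact Or.inl (hw.unique hvw.symm h1.symm ▸ ha)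

theorem exists_two_leaves [Finite V] {v : V} (h : 2 ≤ leafCount G v) :
    ∃ a b, a ≠ b ∧ (G.Adj v a ∧ IsLeaf G a) ∧ (G.Adj v b ∧ IsLeaf G b) := by
  obtain ⟨a, b, ha, hb, h1⟩ := (Set.one_lt_ncard_iff (Set.toFinite _)).1
    (show 1 < leafCount G v from h)
  exact ⟨a, b, h1, ha, hb⟩

open Classical in
theorem one_le_bunchCount [Finite V] (hS : IsEternalGuardStrategy G M 𝒞 F) {C : Multiset V}
    (hC : C ∈ 𝒞) {j : ℕ} (hj : 2 ≤ leafCount G (cyc c j)) :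
    1 ≤ bunchCount G c C j := by
  obtain ⟨a, b, -, ha, -⟩ := exists_two_leaves hj
  unfold bunchCount
  refine Multiset.countP_pos.2 ?_
  rcases guard_or_leaves hS hC ha.1 ha.2 with h | h
  · exact ⟨_, h, Or.inl rfl⟩
  · exact ⟨_, h, Or.inr ha⟩

open Classical in
/-- After an attack on a leaf of a red vertex, two guards stand on the vertex and its leaves. -/
theorem exists_two_le_bunchCount [Finite V] (hS : IsEternalGuardStrategy G M 𝒞 F) {C : Multiset V}
    (hC : C ∈ 𝒞) {j : ℕ} (hj : 2 ≤ leafCount G (cyc c j)) :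
    ∃ D ∈ 𝒞, (D = C ∨ F C D) ∧ 2 ≤ bunchCount G c D j := by
  obtain ⟨a, b, hab, ha, hb⟩ := exists_two_leaves hj
  have key : ∀ D ∈ 𝒞, a ∈ D → 2 ≤ bunchCount G c D j := by
    intro D hD haD
    rcases guard_or_leaves hS hD hb.1 hb.2 with h | h
    · refine two_le_countP (a := a) (b := cyc c j) ?_ haD h (Or.inr ha) (Or.inl rfl)
      exact ha.1.ne'
    · exact two_le_countP hab haD h (Or.inr ha) (Or.inr hb)
  rcases hS.defends C hC a with h | ⟨D, hD, hF, h⟩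
  · exact ⟨C, hC, Or.inl rfl, key C hC h⟩
  · exact ⟨D, hD, Or.inr hF, key D hD h⟩

open Classical in
theorem count_cyc_le (C : Multiset V) (j : ℕ) : C.countP (· = cyc c j) ≤ bunchCount G c C j := by
  unfold bunchCount
  rw [Multiset.countP_eq_card_filter, Multiset.countP_eq_card_filter]
  exact Multiset.card_le_card (Multiset.monotone_filter_right _ fun v hv => Or.inl hv)

open Classical in
/-- A red vertex, its leaves and its two neighbours on the cycle hold two guards in each
configuration. -/
theorem two_le_neighborhood [Finite V] (hG : IsCactus G) (hc : IsLeafCycle G c)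
    (hS : IsEternalGuardStrategy G M 𝒞 F) {C : Multiset V} (hC : C ∈ 𝒞) {j : ℕ} (hj0 : 0 < j)
    (hjn : j < n) (hj : 2 ≤ leafCount G (cyc c j)) :
    2 ≤ C.countP (· = cyc c (j - 1)) + bunchCount G c C j + C.countP (· = cyc c (j + 1)) := by
  obtain ⟨D, hD, hCD, h2⟩ := exists_two_le_bunchCount hS hC hj
  have htr : Traversable G C D := by
    rcases hCD with rfl | h
    · exact Traversable.refl _
    · exact hS.traversable _ _ h
  obtain ⟨S', hS'⟩ : ∃ S' : V → Prop, ∀ v, S' v ↔ v = cyc c (j - 1) ∨ Bunch G c j v ∨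
    v = cyc c (j + 1) := ⟨_, fun v => Iff.rfl⟩
  have h3 := htr.countP_le (S := Bunch G c j) (S' := S') ?_
  · have h4 : ∀ C : Multiset V, C.countP S' ≤ C.countP (· = cyc c
      (j - 1)) + bunchCount G c C j + C.countP (· = cyc c (j + 1)) := by
      intro C
      unfold bunchCount
      induction C using Multiset.induction_on with
      | empty => simp
      | cons a C ih =>
        simp only [Multiset.countP_cons]
        have : (if S' a then 1 else 0) ≤
            (if a = cyc c (j - 1) then 1 else 0) + (if Bunch G c j a then 1 else 0) +
              (if a = cyc c (j + 1) then 1 else 0) := by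
          have := hS' a
          split_ifs <;> first | omega | tauto
        omega
    have := h4 C
    unfold bunchCount at h2 this ⊢
    omega
  · intro a b hb hab
    rw [hS']
    rcases hb with rfl | hb
    · rcases hab with rfl | hab
      · exact Or.inr (Or.inl (Or.inl rfl))
      · rcases cyc_neighbor hc hj0 hjn hab.symm with h | h
        · obtain ⟨i, hi, rfl⟩ := (range_cyc c a).1 h
          obtain ⟨k, hk⟩ := cycEdge_of_adj hG hc hab.symm
          rw [Sym2.eq_iff] at hk
          rcases hk with ⟨e1, e2⟩ | ⟨e1, e2⟩
          · refine Or.inr (Or.inr (e2.trans ?_))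
            have : j ≡ k [MOD n] := cyc_inj hc e1
            rw [← cyc_mod c (k + 1), ← cyc_mod c (j + 1)]
            exact congrArg (cyc c) (this.symm.add_right 1)
          · refine Or.inl (e2.trans ?_)
            have : j - 1 + 1 ≡ k + 1 [MOD n] := by rw [Nat.sub_add_cancel hj0]; exact cyc_inj hc e1
            rw [← cyc_mod c k, ← cyc_mod c (j - 1)]
            exact congrArg (cyc c) (Nat.ModEq.add_right_cancel' 1 this).symm
        · exact Or.inr (Or.inl (Or.inr ⟨hab.symm, h⟩))
    · rcases hab with rfl | hab
      · exact Or.inr (Or.inl (Or.inr hb))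
      · exact Or.inr (Or.inl (Or.inl (hb.2.unique hab.symm hb.1.symm)))

open Classical in
theorem egc_lower_one [Finite V] (hG : IsCactus G) (hc : IsLeafCycle G c) {k : ℕ}
    (h : leafSequence G c = rwSequence (2 * k)) :
    EGC (replaceCycle G c 1) + (3 * k + 1) ≤ EGC G := by
  obtain ⟨𝒞, F, hS⟩ := egc_exists G
  have hn := length_of_leafSequence h
  have h3 := hc.three_le
  have hd := fun i => (leafCount_of_leafSequence (i := i) h).1
  have hsum : ∀ C ∈ 𝒞, C.countP (· = c 0) + 3 * k + bunchCount G c C 1 ≤ C.countP (InPart G c) := by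
    intro C hC
    have h1 := sum_bunchCount_le hc C
    have h2 := sum_blocks (bunchCount G c C) k (fun i hi => ?_) fun i hi =>
      one_le_bunchCount hS hC (hd _ (by omega))
    · rw [← congrArg (Finset.Ico 1) (show n = 4 * k + 2 by omega)] at h2
      omega
    · have h4 := two_le_neighborhood hG hc hS hC (j := 4 * i + 3) (by omega) (by omega)
        (hd _ (by omega))
      have h5 := count_cyc_le (G := G) (c := c) C (4 * i + 3 - 1)
      have h6 := count_cyc_le (G := G) (c := c) C (4 * i + 3 + 1)
      rw [show 4 * i + 3 - 1 = 4 * i + 2 by omega] at h4 h5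
      rw [show 4 * i + 3 + 1 = 4 * i + 4 by omega] at h4 h6
      omega
  -- there is only one new leaf, so no guard has to remain on the connecting vertex
  refine egc_replace_add_le (e := 0) hc hS (fun y y' => Or.inl (Subsingleton.elim _ _))
    (fun C hC => ?_) fun C hC => ?_
  · have := hsum C hC
    have := one_le_bunchCount hS hC (hd 1 rfl)
    omega
  · obtain ⟨D, hD, h1, h2⟩ := exists_two_le_bunchCount hS hC (hd 1 rfl)
    have := hsum D hD
    exact ⟨D, hD, h1, by omega⟩

open Classical in
theorem egc_lower_two [Finite V] (hG : IsCactus G) (hc : IsLeafCycle G c) {k : ℕ}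
    (h : leafSequence G c = rwSequence (2 * k + 1)) :
    EGC (replaceCycle G c 2) + (3 * k + 2) ≤ EGC G := by
  obtain ⟨𝒞, F, hS⟩ := egc_exists G
  have hn := length_of_leafSequence h
  have h3 := hc.three_le
  have hd := fun i => (leafCount_of_leafSequence (i := i) h).1
  have hsum : ∀ C ∈ 𝒞, C.countP (· = c 0) + 3 * k + bunchCount G c C 1 + bunchCount G c C
    (4 * k + 2) + bunchCount G c C (4 * k + 3) ≤ C.countP (InPart G c) := by
    intro C hC
    have h1 := sum_bunchCount_le hc C
    have h2 := sum_blocks (bunchCount G c C) k (fun i hi => ?_) fun i hi =>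
      one_le_bunchCount hS hC (hd _ (by omega))
    · rw [congrArg (Finset.Ico 1) (show n = 4 * k + 2 + 1 + 1 by omega),
        Finset.sum_Ico_succ_top (by omega), Finset.sum_Ico_succ_top (by omega)] at h1
      rw [show 4 * k + 2 + 1 = 4 * k + 3 by omega] at h1
      omega
    · have h4 := two_le_neighborhood hG hc hS hC (j := 4 * i + 3) (by omega) (by omega)
        (hd _ (by omega))
      have h5 := count_cyc_le (G := G) (c := c) C (4 * i + 3 - 1)
      have h6 := count_cyc_le (G := G) (c := c) C (4 * i + 3 + 1)
      rw [show 4 * i + 3 - 1 = 4 * i + 2 by omega] at h4 h5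
      rw [show 4 * i + 3 + 1 = 4 * i + 4 by omega] at h4 h6
      omega
  -- vertex `n - 1` may share its second guard with the connecting vertex, its neighbour
  have hlast : ∀ C ∈ 𝒞, 2 ≤ bunchCount G c C (4 * k + 2) + bunchCount G c C (4 * k + 3) + C.countP
    (· = c 0) := by
    intro C hC
    have h4 := two_le_neighborhood hG hc hS hC (j := 4 * k + 3) (by omega) (by omega)
      (hd _ (by omega))
    have h5 := count_cyc_le (G := G) (c := c) C (4 * k + 3 - 1)
    rw [show 4 * k + 3 - 1 = 4 * k + 2 by omega] at h4 h5
    rw [show 4 * k + 3 + 1 = 0 + n by omega, cyc_add, cyc_zero] at h4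
    omega
  refine egc_replace_add_le (e := 1) hc hS (fun y y' => Or.inr le_rfl) (fun C hC => ?_) fun C hC =>
    ?_
  · have := hsum C hC
    have := hlast C hC
    have := one_le_bunchCount hS hC (hd 1 rfl)
    have := one_le_bunchCount hS hC (hd (4 * k + 3) (by omega))
    omega
  · obtain ⟨D, hD, h1, h2⟩ := exists_two_le_bunchCount hS hC (hd 1 rfl)
    have := hsum D hD
    have := hlast D hD
    have := one_le_bunchCount hS hD (hd (4 * k + 3) (by omega))
    exact ⟨D, hD, h1, by omega⟩
end

/-! ### Correctness of the replacement -/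

section
variable {V : Type u} {G : SimpleGraph V} {n : ℕ} [NeZero n] {c : Fin n → V} {l : ℕ}

theorem isLeaf_new (hu : c 0 ∉ cyclePart G c) (i : Fin l) : IsLeaf (replaceCycle G c l)
    (Sum.inr i) := by
  refine ⟨Sum.inl ⟨c 0, hu⟩, rfl, ?_⟩
  rintro (⟨v, hv⟩ | j) h
  · have : v = c 0 := h
    subst this; rfl
  · exact absurd h id

theorem new_leaf_unique (hu : c 0 ∉ cyclePart G c) {Ω : Type}
    {B : LabelledStrategy (replaceCycle G c l) Ω} (hB : B.IsLeafGrouped)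
    (α : Ω) (i j : Fin l) (hi : Sum.inr i ∈ B.pos α) (hj : Sum.inr j ∈ B.pos α) : i = j := by
  have := hB α (Sum.inl ⟨c 0, hu⟩) (Sum.inr i) (Sum.inr j) rfl rfl (isLeaf_new hu i)
    (isLeaf_new hu j) hi hj
  simpa using this

/-- The properties of the lifted strategy of a given strategy of the reduced graph. -/
structure IsLiftOf (G : SimpleGraph V) (c : Fin n → V) {Ω' Ω : Type}
    (B' : LabelledStrategy (replaceCycle G c l) Ω') (B : LabelledStrategy G Ω) (m : ℕ) : Prop where
  defending : B.IsDefending m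
  cycle : ∀ i, B.HasProperEdgeStates (c i) (c (i + 1))
  kept : ∀ x y : {v : V // v ∉ cyclePart G c}, G.Adj x.1 y.1 →
    B'.HasProperEdgeStates (Sum.inl x) (Sum.inl y) → B.HasProperEdgeStates x.1 y.1
  proper : B'.IsProper → B.IsProper
  grouped : B'.IsLeafGrouped → B.IsLeafGrouped

theorem isLiftOf_lift (hG : IsCactus G) (hc : IsLeafCycle G c) [NeZero l] {d : ℕ → ℕ}
    {φ : ℕ × ℕ → V}
    (hφ : Embeds G (c 0) (cyclePart G c) n d φ) (hφ' : ∀ i, φ (i, 0) = cyc c i) {Ω : Type}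
      {B : LabelledStrategy (replaceCycle G c l) Ω} {lev : Ω → ℕ}
    (hl : IsLevelling B lev) (h0 : n % 4 = 0 → ∀ α, lev α ≠ 2) {m : ℕ}
      (hd : (liftStrategy hφ B lev).IsDefending m) :
    IsLiftOf G c B (liftStrategy hφ B lev) m := by
  have hΩ : Nonempty Ω := hd.1.map fun p => p.1.1
  refine ⟨hd, fun i => ?_, fun x y hxy h => hl.lift_proper_kept hφ x.2 y.2 hxy.ne h,
    lift_isProper hG hc hφ hφ' hl hΩ h0, lift_isLeafGrouped hc hφ hφ' h0⟩
  refine lift_cycEdge hφ hφ' hl hΩ h0 ⟨i, ?_⟩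
  rw [cyc_val, cyc_val_succ]

/-- The upper bound, the lower bound and the lifting of strategies give all properties of the
replacement. -/
theorem isCorrectReplacement_of_lift [Finite V] (hc : IsLeafCycle G c) {K : ℕ}
    (hupper : EDN G ≤ EDN (replaceCycle G c l) + K) (hlower : EGC (replaceCycle G c l) + K ≤ EGC G)
    (hlift : ∀ (m : ℕ) (Ω' : Type) [Finite Ω'] (B' : LabelledStrategy (replaceCycle G c l) Ω'),
      B'.IsDefending m →
      (∀ α (i j : Fin l), Sum.inr i ∈ B'.pos α → Sum.inr j ∈ B'.pos α → i = j) →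
      ∃ (Ω : Type) (_ : Finite Ω) (B : LabelledStrategy G Ω), IsLiftOf G c B' B (m + K)) :
    IsCorrectReplacement G c l K := by
  have htight : EDN (replaceCycle G c l) = EGC (replaceCycle G c l) →
      EDN G = EDN (replaceCycle G c l) + K ∧ EGC G = EGC (replaceCycle G c l) + K := by
    intro h
    have := egc_le_edn G
    omega
  refine ⟨hupper, hlower, htight, fun m Ω' _ B' hB hB' => ?_, ?_⟩
  · obtain ⟨Ω, hΩ, B, h⟩ := hlift m Ω' B' hB hB'
    exact ⟨Ω, hΩ, B, h.defending, h.cycle, h.kept, h.proper, h.grouped⟩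
  · rintro m ⟨h1, h2, Ω', hΩ', B', h3, h4, h5⟩
    obtain ⟨h6, h7⟩ := htight (h1.trans h2.symm)
    obtain ⟨Ω, hΩ, B, h⟩ := hlift m Ω' B' h3 (new_leaf_unique (centre_not_part hc) h5)
    exact ⟨h6.trans (by rw [h1]), h7.trans (by rw [h2]), Ω, hΩ, B, h.defending, h.proper h4,
      h.grouped h5⟩

theorem isCorrectReplacement_one [Finite V] (hG : IsCactus G) (hc : IsLeafCycle G c) {k : ℕ}
    (h : leafSequence G c = rwSequence (2 * k)) :
    IsCorrectReplacement G c 1 (3 * k + 1) := by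
  have hn := length_of_leafSequence h
  have h3 := hc.three_le
  obtain ⟨φ, hφ, hφ'⟩ := exists_embeds hc h (by omega)
  refine isCorrectReplacement_of_lift hc ?_ (egc_lower_one hG hc h) fun m Ω' _ B' hB _ => ?_
  · obtain ⟨N, B, hB⟩ := exists_labelled_edn (replaceCycle G c 1)
    exact edn_le_of_isDefending (lift_isDefending_one hφ (k := k) (by omega) hB)
  · exact ⟨_, finite_liftState hφ.even, _, isLiftOf_lift hG hc hφ hφ'
      (isLevelling_levOne hφ.not_part (by omega) hB) (by omega)
      (lift_isDefending_one hφ (k := k) (by omega) hB)⟩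

theorem isDefendedWith_one [Finite V] (hG : IsCactus G) (hc : IsLeafCycle G c) {k : ℕ}
    (h : leafSequence G c = rwSequence (2 * k)) {m : ℕ}
    (hm : IsDefendedWith (replaceCycle G c 1) m) : IsDefendedWith G (m + (3 * k + 1)) := by
  have hr := isCorrectReplacement_one hG hc h
  obtain ⟨h1, h2, Ω', hΩ', B', h3, h4⟩ := hm
  obtain ⟨h6, h7⟩ := hr.tight (h1.trans h2.symm)
  obtain ⟨Ω, hΩ, B, hB, -, -, h8, -⟩ := hr.strategy m Ω' B' h3 fun _ _ _ _ _ =>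
    Subsingleton.elim _ _
  exact ⟨h6.trans (by rw [h1]), h7.trans (by rw [h2]), Ω, hΩ, B, hB, h8 h4⟩

theorem isCorrectReplacement_two [Finite V] (hG : IsCactus G) (hc : IsLeafCycle G c) {k : ℕ}
    (h : leafSequence G c = rwSequence (2 * k + 1)) :
    IsCorrectReplacement G c 2 (3 * k + 2) := by
  have hn := length_of_leafSequence h
  obtain ⟨φ, hφ, hφ'⟩ := exists_embeds hc h (by omega)
  refine isCorrectReplacement_of_lift hc ?_ (egc_lower_two hG hc h) fun m Ω' _ B' hB hB' => ?_
  · obtain ⟨N, B, hB⟩ := exists_labelled_edn (replaceCycle G c 2)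
    exact edn_le_of_isDefending (lift_isDefending_two hφ (k := k) (by omega) hB)
  · refine ⟨_, finite_liftState hφ.even, _, isLiftOf_lift hG hc hφ hφ'
      (isLevelling_two hφ.not_part (by omega) hB) (fun _ α hα => ?_)
      (lift_isDefending_two hφ (k := k) (by omega) hB)⟩
    -- three guards on the star would occupy both new leaves
    have h2 := (starCount_two_le hφ.not_part B' α).2 (by omega)
    have := hB' α 0 1 h2.1 h2.2
    simp at this
end

end EternalDomination

theorem mainTheorem4 {V : Type u} [Finite V] (G : SimpleGraph V)
    (hG : EternalDomination.IsCactus G) {n : ℕ} [NeZero n] (c : Fin n → V)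
    (hc : EternalDomination.IsLeafCycle G c) (k : ℕ) :
    (EternalDomination.leafSequence G c = EternalDomination.rwSequence (2 * k) →
      EternalDomination.IsCorrectReplacement G c 1 (3 * k + 1) ∧
      ∀ m : ℕ, EternalDomination.IsDefendedWith (EternalDomination.replaceCycle G c 1) m →
        EternalDomination.IsDefendedWith G (m + (3 * k + 1))) ∧
    (EternalDomination.leafSequence G c = EternalDomination.rwSequence (2 * k + 1) →
      EternalDomination.IsCorrectReplacement G c 2 (3 * k + 2)) :=
  ⟨fun h => ⟨EternalDomination.isCorrectReplacement_one hG hc h, fun _ =>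
    EternalDomination.isDefendedWith_one hG hc h⟩,
    fun h => EternalDomination.isCorrectReplacement_two hG hc h⟩
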